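/- Let $A>0$. On the unit interval $(0,1)$ consider the stochastic compressible Navier--Stokes system $$\rho_t+(\rho u)_x=0,\qquad \mathrm d(\rho u)+(\rho u^2+A^2\rho)_x\,\mathrm dt=u_{xx}\,\mathrm dt+\rho\sum_{k\ge1}\sigma_k\,\mathrm dW^k,\qquad u(t,0)=u(t,1)=0, \tag{1}$$ on a stochastic basis $(\Omega,\mathcal F,\mathbb P,\{\mathcal F_t\}_{t\ge0},W)$, where $W=(W^k)_{k\ge1}$ are independent standard Brownian motions relative to $\{\mathcal F_t\}$, and $\sigma_k\in H^2(0,1)\cap H^1_0(0,1)$ satisfy $\int_0^1\sum_{k}|(\sigma_k)_{xx}|^2\,\mathrm dx<\infty$. Let $$\mathcal X=\Big\{(\rho,u)\in H^1(0,1)\times H^1_0(0,1):\ \int_0^1\rho\,\mathrm dx=1,\ \rho>0\text{ on }[0,1]\Big\}$$ and, for $(\rho,u)\in\mathcal X$, let $$\mathcal E(\rho,u)=\int_0^1\Big(\tfrac12\rho u^2+A^2\rho\log\rho\Big)\mathrm dx+\frac12\int_0^1\Big(\frac{\rho_xu}{\rho}+\frac12\frac{\rho_x^2}{\rho^3}\Big)\mathrm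 dx .$$ A solution of (1) with (deterministic) initial datum $(\rho_0,u_0)\in\mathcal X$ is a pair $(\rho,u)$ of adapted processes on this basis, almost surely continuous in time with values in $L^2(0,1)$, with $\rho\in L^\infty(0,T;H^1)$ and $u\in L^\infty(0,T;H^1_0)\cap L^2(0,T;H^2)$ for all $T>0$ almost surely, which satisfies $(\rho,u)(0)=(\rho_0,u_0)$ and the time-integrated form of (1), in the sense of distributions in $x$ and with the stochastic integral understood in the sense of Itô. **Theorem (continuous dependence).** Let $(\rho^n,u^n)$, $n\in\mathbb N$, be solutions of (1) with initial data $(\rho^n_0,u^n_0)\in\mathcal X$ such that $\sup_n\mathcal E(\rho_0^n,u_0^n)<\infty$, and let $(\rho,u)$ be a solution of (1), on the same stochastic basis, with initial datum $(\rho_0,u_0)\in\mathcal X$. If $(\rho_0^n,u_0^n)\to(\rho_0,u_0)$ in $L^2(0,1)\times L^2(0,1)$, then, almost surely, $$(\rho^n(t),u^n(t))\to(\rho(t),u(t))\quad\text{in }L^2(0,1)\times L^2(0,1)\quad\text{for every }t\ge0 .$$ -/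

import Mathlib

open MeasureTheory ProbabilityTheory Set Filter Topology
open scoped NNReal ENNReal

namespace CNSE

noncomputable section

/-! ### Function spaces on the unit interval -/

/-- Lebesgue measure on `(0,1)`. -/
def unitVol : Measure ℝ := volume.restrict (Ioo (0 : ℝ) 1)

/-- `f ∈ H¹(0,1)`, where an `H¹` function on the interval is identified with its unique absolutely
continuous representative on `[0,1]`. Its weak derivative `f_x` is then the classical derivative
`deriv f`, which exists almost everywhere in `(0,1)`. Values outside `[0,1]` play no role. -/
def MemH1 (f : ℝ → ℝ) : Prop :=
  AbsolutelyContinuousOnInterval f 0 1 ∧ MemLp (deriv f) 2 unitVol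

/-- `f ∈ H¹₀(0,1)`. -/
def MemH10 (f : ℝ → ℝ) : Prop :=
  MemH1 f ∧ f 0 = 0 ∧ f 1 = 0

/-- `f ∈ H²(0,1)`: `f ∈ H¹` and its weak derivative is (a.e. equal to) an `H¹` function. Then
`f_xx` is `deriv (deriv f)` almost everywhere in `(0,1)`. -/
def MemH2 (f : ℝ → ℝ) : Prop :=
  MemH1 f ∧ ∃ g : ℝ → ℝ, MemH1 g ∧ deriv f =ᵐ[unitVol] g

/-- Convergence in `L²(0,1)`. -/
def TendstoL2 {ι : Type*} (l : Filter ι) (f : ι → ℝ → ℝ) (g : ℝ → ℝ) : Prop :=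
  Tendsto (fun i => eLpNorm (fun x => f i x - g x) 2 unitVol) l (𝓝 0)

/-- Test functions `φ ∈ C_c^∞(0,1)`. -/
def IsTestFunction (φ : ℝ → ℝ) : Prop :=
  ContDiff ℝ ((⊤ : ℕ∞) : WithTop ℕ∞) φ ∧ HasCompactSupport φ ∧ tsupport φ ⊆ Ioo (0 : ℝ) 1

/-- The phase space `𝒳` of pairs `(ρ,u) ∈ H¹ × H¹₀` with `ρ > 0` and `∫ρ = 1`. -/
def PhaseSpace : Set ((ℝ → ℝ) × (ℝ → ℝ)) :=
  {p | MemH1 p.1 ∧ MemH10 p.2 ∧ (∫ x in (0 : ℝ)..1, p.1 x) = 1 ∧ ∀ x ∈ Icc (0 : ℝ) 1, 0 < p.1 x}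

/-- The entropy `ℋ(ρ,u) = ∫ (ρ u² / 2 + A² ρ log ρ) dx`. -/
def entropy (A : ℝ) (ρ u : ℝ → ℝ) : ℝ :=
  ∫ x in (0 : ℝ)..1, (1 / 2 * ρ x * u x ^ 2 + A ^ 2 * (ρ x * Real.log (ρ x)))

/-- The modified energy
`ℰ(ρ,u) = ℋ(ρ,u) + (1/2) ∫ (ρ_x u / ρ + (1/2) ρ_x² / ρ³) dx`. -/
def modifiedEnergy (A : ℝ) (ρ u : ℝ → ℝ) : ℝ :=
  entropy A ρ u
    + 1 / 2 * ∫ x in (0 : ℝ)..1,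
        (deriv ρ x * u x / ρ x + 1 / 2 * (deriv ρ x ^ 2 / ρ x ^ 3))

/-! ### The noise -/

/-- The noise coefficients: `σ_k ∈ H² ∩ H¹₀` and `∫ ∑_k |(σ_k)_xx|² dx < ∞`. -/
structure IsNoiseCoefficient (σ : ℕ → ℝ → ℝ) : Prop where
  memH2 : ∀ k, MemH2 (σ k)
  memH10 : ∀ k, MemH10 (σ k)
  summable : ∫⁻ x, ∑' k, ‖deriv (deriv (σ k)) x‖ₑ ^ 2 ∂unitVol < ∞

variable {Ω : Type*} {mΩ : MeasurableSpace Ω}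

/-- `(Ω, P, F, W)` is a stochastic basis: `W = (W^k)_k` is a sequence of independent standard
one-dimensional Brownian motions relative to the filtration `F`. -/
structure IsStochasticBasis (P : Measure Ω) (F : Filtration ℝ≥0 mΩ) (W : ℕ → ℝ≥0 → Ω → ℝ) :
    Prop where
  prob : IsProbabilityMeasure P
  brownian : ∀ k, IsBrownianReal (W k) P
  indep : iIndepFun (fun k ω t => W k t ω) P
  adapted : ∀ k, Adapted F (W k)
  indep_increments : ∀ s : ℝ≥0, Indep (F s)
    (MeasurableSpace.comap (fun ω (p : ℕ × ℝ≥0) => W p.1 (s + p.2) ω - W p.1 s ω) inferInstance) P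

/-- `I = ∫₀ᵗ X dB` in the sense of Itô, for an integrand `X` with continuous paths: `I` is the
limit in probability of the left-endpoint sums over the uniform partitions of `[0,t]`. -/
def IsItoIntegral (P : Measure Ω) (B X : ℝ≥0 → Ω → ℝ) (t : ℝ≥0) (I : Ω → ℝ) : Prop :=
  TendstoInMeasure P
    (fun (n : ℕ) ω => ∑ i ∈ Finset.range n,
      X (t * i / n) ω * (B (t * (i + 1) / n) ω - B (t * i / n) ω))
    atTop I

/-- `I = ∑_k ∫₀ᵗ X^k dW^k`, the series converging in probability. -/
def IsItoSeries (P : Measure Ω) (W X : ℕ → ℝ≥0 → Ω → ℝ) (t : ℝ≥0) (I : Ω → ℝ) : Prop :=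
  ∃ J : ℕ → Ω → ℝ, (∀ k, IsItoIntegral P (W k) (X k) t (J k)) ∧
    TendstoInMeasure P (fun (K : ℕ) ω => ∑ k ∈ Finset.range K, J k ω) atTop I

/-! ### Solutions -/

/-- `(ρ,u)`, written `ρ t ω x` and `u t ω x`, is a (strong) solution of
`ρ_t + (ρu)_x = 0`, `d(ρu) + (ρu² + A²ρ)_x dt = u_xx dt + ρ σ dW`, `u(t,0) = u(t,1) = 0`,
with initial datum `(ρ₀,u₀)`, in the time-integrated sense, on the stochastic basis
`(Ω, P, F, W)`. -/
structure IsSolution (P : Measure Ω) (F : Filtration ℝ≥0 mΩ) (W : ℕ → ℝ≥0 → Ω → ℝ)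
    (A : ℝ) (σ : ℕ → ℝ → ℝ) (ρ₀ u₀ : ℝ → ℝ) (ρ u : ℝ≥0 → Ω → ℝ → ℝ) : Prop where
  /-- `ρ` is adapted (to the `P`-completion of the filtration). -/
  adapted_density : ∀ t, ∀ x ∈ Icc (0 : ℝ) 1, AEStronglyMeasurable[F t] (fun ω => ρ t ω x) P
  /-- `u` is adapted (to the `P`-completion of the filtration). -/
  adapted_velocity : ∀ t, ∀ x ∈ Icc (0 : ℝ) 1, AEStronglyMeasurable[F t] (fun ω => u t ω x) P
  /-- The initial conditions. -/
  initial : ∀ᵐ ω ∂P, ∀ x ∈ Icc (0 : ℝ) 1, ρ 0 ω x = ρ₀ x ∧ u 0 ω x = u₀ x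
  /-- The paths are continuous in `L²(0,1)`. -/
  continuous : ∀ᵐ ω ∂P, ∀ t : ℝ≥0,
    TendstoL2 (𝓝 t) (fun s => ρ s ω) (ρ t ω) ∧ TendstoL2 (𝓝 t) (fun s => u s ω) (u t ω)
  /-- `ρ ∈ L^∞_loc(H¹)`. -/
  density_H1 : ∀ᵐ ω ∂P, (∀ t, MemH1 (ρ t ω)) ∧ ∀ T : ℝ≥0, ∃ C : ℝ≥0, ∀ t ≤ T,
    eLpNorm (ρ t ω) 2 unitVol + eLpNorm (deriv (ρ t ω)) 2 unitVol ≤ C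
  /-- `u ∈ L^∞_loc(H¹₀)`. -/
  velocity_H1 : ∀ᵐ ω ∂P, (∀ t, MemH10 (u t ω)) ∧ ∀ T : ℝ≥0, ∃ C : ℝ≥0, ∀ t ≤ T,
    eLpNorm (u t ω) 2 unitVol + eLpNorm (deriv (u t ω)) 2 unitVol ≤ C
  /-- `u ∈ L²_loc(H²)`. -/
  velocity_H2 : ∀ᵐ ω ∂P,
    (∀ᵐ s ∂(volume.restrict (Ici (0 : ℝ))), MemH2 (u s.toNNReal ω)) ∧
    ∀ T : ℝ≥0, ∫⁻ s in Icc (0 : ℝ) T,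
      eLpNorm (deriv (deriv (u s.toNNReal ω))) 2 unitVol ^ 2 < ∞
  /-- The continuity equation, integrated in time and tested in space. -/
  continuity_eq : ∀ φ, IsTestFunction φ → ∀ t : ℝ≥0, ∀ᵐ ω ∂P,
    (∫ x in (0 : ℝ)..1, ρ t ω x * φ x) - (∫ x in (0 : ℝ)..1, ρ 0 ω x * φ x)
      - (∫ s in (0 : ℝ)..t, ∫ x in (0 : ℝ)..1,
          ρ s.toNNReal ω x * u s.toNNReal ω x * deriv φ x) = 0
  /-- The momentum equation, integrated in time and tested in space. -/
  momentum_eq : ∀ φ, IsTestFunction φ → ∀ t : ℝ≥0,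
    IsItoSeries P W (fun k s ω => ∫ x in (0 : ℝ)..1, ρ s ω x * σ k x * φ x) t
      (fun ω =>
        (∫ x in (0 : ℝ)..1, ρ t ω x * u t ω x * φ x)
          - (∫ x in (0 : ℝ)..1, ρ 0 ω x * u 0 ω x * φ x)
          - (∫ s in (0 : ℝ)..t, ∫ x in (0 : ℝ)..1,
              (ρ s.toNNReal ω x * u s.toNNReal ω x ^ 2 + A ^ 2 * ρ s.toNNReal ω x) * deriv φ x)
          + (∫ s in (0 : ℝ)..t, ∫ x in (0 : ℝ)..1,
              deriv (u s.toNNReal ω) x * deriv φ x))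

end

end CNSE

/-! The argument is pathwise. Divided by the density, the momentum equation reads du + (u u_x + A²
ρ_x/ρ − u_xx/ρ) dt = dζ with ζ = ∑ W^k σ_k, and ζ does not depend on the solution. For two solutions
on the same basis the noise cancels: for almost every x the difference of the velocities is
absolutely continuous in time, with derivative the difference of the two expressions `acc`
(`SameNoise`, proved in `sameNoise`). From there on the problem is deterministic.

Let (r,v) be an approximating solution, (R,U) the limit solution and w = v − U. The relative energy
∫ ½ r w² + ½ (r − R)² satisfies a Grönwall inequality (`stability_estimate`, `relEnergy_le`). All
derivatives in the error terms fall on (R,U), except for w_x, which the viscosity absorbs. The rate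
is integrable in time because U lies in L²(H²), but it contains a bound M for |r − R|, which has to
be uniform along the sequence.

This bound comes from the effective viscous flux. With Ψ the mean-zero primitive of r w, the
material derivative of log r + Ψ no longer contains v_x: it equals −A² r up to terms controlled by
(R,U), as long as the relative energy is at most one (`flux_estimate`, `exists_momentum_potential`).
A maximum principle for transport by v bounds log r from above, and then from below
(`log_density_le`). A continuity argument in time closes the loop (`exists_stability_constants`): if
the initial relative energy is small, it stays below one on [0,T] and is bounded by a constant times
its initial value, while r stays bounded below. Convergence of densities and velocities follows
(`IsStripPath.tendsto_nrm_sub`).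

The uniform bound on ℰ enters only at time zero. Completing the square shows that ℰ controls ∫
ρ_x²/ρ³, and then Cauchy–Schwarz with unit mass bounds the oscillation of log ρ, hence |log ρ₀ⁿ|,
uniformly in n (`abs_log_density_le`).

It remains to pass from the weak Itô formulation to the cancellation of the noise. Tested against a
smooth function, the density is absolutely continuous in time by the continuity equation, so each
Itô integral equals, by summation by parts, the pathwise expression X_t B_t − ∫ B X'
(`tendsto_leftSum`). The series for ζ is summed along a fixed subsequence, at all rational times and
at almost every time, by first-moment estimates alone (`exists_noiseLimit`). Testing with a
countable family of bumps then gives the equation for almost every x (`exists_velocity_acPair`), and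
the noise drops out on subtraction. -/

namespace CNSE

noncomputable section

/-! ### Absolutely continuous functions with a prescribed derivative -/

/-- `f` is absolutely continuous on `[0,b]` with (almost everywhere) derivative `f'`. -/
structure ACPair (b : ℝ) (f f' : ℝ → ℝ) : Prop where
  integrable : IntervalIntegrable f' volume 0 b
  eq : ∀ x ∈ Icc 0 b, f x = f 0 + ∫ t in (0 : ℝ)..x, f' t

lemma absolutelyContinuousOnInterval_congr {f g : ℝ → ℝ} {a b : ℝ}
    (hf : AbsolutelyContinuousOnInterval f a b) (h : ∀ x ∈ uIcc a b, f x = g x) :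
    AbsolutelyContinuousOnInterval g a b := by
  rw [absolutelyContinuousOnInterval_iff] at hf ⊢
  intro ε hε
  obtain ⟨δ, hδ, H⟩ := hf ε hε
  refine ⟨δ, hδ, fun E hE hl => ?_⟩
  refine lt_of_eq_of_lt (Finset.sum_congr rfl fun i hi => ?_) (H E hE hl)
  have := hE.1 i hi
  rw [h _ this.1, h _ this.2]

lemma absolutelyContinuousOnInterval_comp {f G : ℝ → ℝ} {a b : ℝ} {K : ℝ≥0}
    {s : Set ℝ} (hG : LipschitzOnWith K G s) (hs : ∀ x ∈ uIcc a b, f x ∈ s)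
    (hf : AbsolutelyContinuousOnInterval f a b) :
    AbsolutelyContinuousOnInterval (fun x => G (f x)) a b := by
  rw [absolutelyContinuousOnInterval_iff] at hf ⊢
  intro ε hε
  obtain ⟨δ, hδ, H⟩ := hf (ε / (K + 1)) (by positivity)
  refine ⟨δ, hδ, fun E hE hl => ?_⟩
  have h1 := H E hE hl
  calc _ ≤ ∑ i ∈ Finset.range E.1, (K + 1 : ℝ) * dist (f (E.2 i).1) (f (E.2 i).2) := by
        refine Finset.sum_le_sum fun i hi => ?_
        have := hE.1 i hi
        refine (hG.dist_le_mul _ (hs _ this.1) _ (hs _ this.2)).trans ?_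
        gcongr
        simp
    _ < ε := by
        rw [← Finset.mul_sum]
        rwa [lt_div_iff₀' (by positivity)] at h1

namespace ACPair

variable {b : ℝ} {f f' g g' : ℝ → ℝ}

lemma ac (hb : 0 ≤ b) (h : ACPair b f f') : AbsolutelyContinuousOnInterval f 0 b := by
  have h1 := h.integrable.absolutelyContinuousOnInterval_intervalIntegral (c := 0) (by simp)
  have h2 : AbsolutelyContinuousOnInterval (fun _ : ℝ => f 0) 0 b :=
    (LipschitzWith.const (f 0)).lipschitzOnWith.absolutelyContinuousOnInterval
  refine absolutelyContinuousOnInterval_congr (h2.add h1) fun x hx => ?_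
  rw [uIcc_of_le hb] at hx
  simpa using (h.eq x hx).symm

lemma hasDerivAt (hb : 0 ≤ b) (h : ACPair b f f') :
    ∀ᵐ x, x ∈ Ioo 0 b → HasDerivAt f (f' x) x := by
  filter_upwards [h.integrable.ae_hasDerivAt_integral] with x hx hxb
  have := (hx (by rw [uIcc_of_le hb]; exact Ioo_subset_Icc_self hxb) 0 (by simp)).const_add (f 0)
  refine this.congr_of_eventuallyEq ?_
  filter_upwards [isOpen_Ioo.mem_nhds hxb] with y hy using h.eq y (Ioo_subset_Icc_self hy)

/-- This is Lebesgue's fundamental theorem of calculus. It reduces each closure rule below (sums,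
products, chain rule) to the stability of absolute continuity and a pointwise derivative rule. -/
lemma of_ac (hb : 0 ≤ b) (h : AbsolutelyContinuousOnInterval f 0 b)
    (hd : ∀ᵐ x, x ∈ Ioo 0 b → HasDerivAt f (f' x) x) : ACPair b f f' := by
  have key : ∀ᵐ x, x ∈ Ioc 0 b → deriv f x = f' x := by
    have : ∀ᵐ x : ℝ, x ≠ b := by simp [ae_iff]
    filter_upwards [hd, this] with x hx hxb hxm
    exact (hx ⟨hxm.1, lt_of_le_of_ne hxm.2 hxb⟩).deriv
  refine ⟨?_, fun x hx => ?_⟩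
  · refine h.intervalIntegrable_deriv.congr_ae ?_
    rw [uIoc_of_le hb]
    exact (ae_restrict_iff' measurableSet_Ioc).2 key
  · have h1 := (h.mono (c := 0) (d := x) (by
      rw [uIcc_of_le hb, uIcc_of_le hx.1]; exact Icc_subset_Icc_right hx.2)).integral_deriv_eq_sub
    have : ∫ t in (0 : ℝ)..x, f' t = ∫ t in (0 : ℝ)..x, deriv f t := by
      refine intervalIntegral.integral_congr_ae ?_
      filter_upwards [key] with t ht htx
      rw [uIoc_of_le hx.1] at htx
      exact (ht ⟨htx.1, htx.2.trans hx.2⟩).symm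
    rw [this, h1]; ring

lemma continuousOn (hb : 0 ≤ b) (h : ACPair b f f') : ContinuousOn f (Icc 0 b) := by
  simpa [uIcc_of_le hb] using (h.ac hb).continuousOn

lemma mono (h : ACPair b f f') {c : ℝ} (hc : 0 ≤ c) (hcb : c ≤ b) : ACPair c f f' :=
  ⟨h.integrable.mono_set (by
    rw [uIcc_of_le hc, uIcc_of_le (hc.trans hcb)]; exact Icc_subset_Icc_right hcb),
    fun x hx => h.eq x ⟨hx.1, hx.2.trans hcb⟩⟩

lemma sub_eq (h : ACPair b f f') {x y : ℝ} (hx : x ∈ Icc 0 b) (hy : y ∈ Icc 0 b) :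
    f y - f x = ∫ t in x..y, f' t := by
  have hi : ∀ z ∈ Icc 0 b, IntervalIntegrable f' volume 0 z := fun z hz =>
    (h.mono hz.1 hz.2).integrable
  rw [h.eq x hx, h.eq y hy, ← intervalIntegral.integral_interval_sub_left (hi y hy) (hi x hx)]
  ring

lemma congr (hb : 0 ≤ b) (h : ACPair b f f') (hg : ∀ x ∈ Icc 0 b, f x = g x)
    (hg' : ∀ᵐ x ∂volume.restrict (Ioc 0 b), f' x = g' x) : ACPair b g g' := by
  refine ⟨h.integrable.congr_ae (by rwa [uIoc_of_le hb]), fun x hx => ?_⟩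
  rw [← hg x hx, ← hg 0 (by simp [hb]), h.eq x hx]
  congr 1
  refine intervalIntegral.integral_congr_ae ?_
  filter_upwards [(ae_restrict_iff' measurableSet_Ioc).1 hg'] with t ht htx
  rw [uIoc_of_le hx.1] at htx
  exact ht ⟨htx.1, htx.2.trans hx.2⟩

lemma add (hb : 0 ≤ b) (hf : ACPair b f f') (hg : ACPair b g g') :
    ACPair b (fun x => f x + g x) (fun x => f' x + g' x) := by
  refine of_ac hb ((hf.ac hb).add (hg.ac hb)) ?_
  filter_upwards [hf.hasDerivAt hb, hg.hasDerivAt hb] with x h1 h2 hx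
  exact (h1 hx).add (h2 hx)

lemma sub (hb : 0 ≤ b) (hf : ACPair b f f') (hg : ACPair b g g') :
    ACPair b (fun x => f x - g x) (fun x => f' x - g' x) := by
  refine of_ac hb ((hf.ac hb).sub (hg.ac hb)) ?_
  filter_upwards [hf.hasDerivAt hb, hg.hasDerivAt hb] with x h1 h2 hx
  exact (h1 hx).sub (h2 hx)

lemma mul (hb : 0 ≤ b) (hf : ACPair b f f') (hg : ACPair b g g') :
    ACPair b (fun x => f x * g x) (fun x => f' x * g x + f x * g' x) := by
  refine of_ac hb ((hf.ac hb).mul (hg.ac hb)) ?_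
  filter_upwards [hf.hasDerivAt hb, hg.hasDerivAt hb] with x h1 h2 hx
  exact (h1 hx).mul (h2 hx)

lemma const_mul (hb : 0 ≤ b) (c : ℝ) (hf : ACPair b f f') :
    ACPair b (fun x => c * f x) (fun x => c * f' x) := by
  refine of_ac hb ((hf.ac hb).const_mul c) ?_
  filter_upwards [hf.hasDerivAt hb] with x h1 hx
  exact (h1 hx).const_mul c

lemma const (c : ℝ) : ACPair b (fun _ => c) (fun _ => 0) := ⟨by simp, by simp⟩

lemma primitive (hf : IntervalIntegrable f volume 0 b) :
    ACPair b (fun x => ∫ t in (0 : ℝ)..x, f t) f := ⟨hf, by simp⟩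

/-- Chain rule. -/
lemma comp (hb : 0 ≤ b) (hf : ACPair b f f') {G G' : ℝ → ℝ} {m M : ℝ}
    (hm : ∀ x ∈ Icc 0 b, f x ∈ Icc m M) (hG : ∀ y ∈ Icc m M, HasDerivAt G (G' y) y)
    (hG' : ContinuousOn G' (Icc m M)) :
    ACPair b (fun x => G (f x)) (fun x => G' (f x) * f' x) := by
  obtain ⟨C, hC⟩ := isCompact_Icc.exists_bound_of_continuousOn hG'
  have hL : LipschitzOnWith C.toNNReal G (Icc m M) :=
    (convex_Icc m M).lipschitzOnWith_of_nnnorm_hasDerivWithin_le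
      (fun y hy => (hG y hy).hasDerivWithinAt) fun y hy => by
        rw [← NNReal.coe_le_coe, coe_nnnorm]
        exact (hC y hy).trans (Real.le_coe_toNNReal C)
  refine of_ac hb (absolutelyContinuousOnInterval_comp hL (by rwa [uIcc_of_le hb]) (hf.ac hb)) ?_
  filter_upwards [hf.hasDerivAt hb] with x h1 hx
  exact (hG _ (hm x (Ioo_subset_Icc_self hx))).comp x (h1 hx)

lemma comp_of_forall (hb : 0 ≤ b) (hf : ACPair b f f') {G G' : ℝ → ℝ}
    (hG : ∀ y, HasDerivAt G (G' y) y) (hG' : Continuous G') :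
    ACPair b (fun x => G (f x)) (fun x => G' (f x) * f' x) := by
  obtain ⟨C, hC⟩ := isCompact_Icc.exists_bound_of_continuousOn (hf.continuousOn hb)
  exact hf.comp hb (m := -C) (M := C) (fun x hx => abs_le.1 (hC x hx)) (fun y _ => hG y)
    hG'.continuousOn

lemma integral_eq (hb : 0 ≤ b) (hf : ACPair b f f') : ∫ x in (0 : ℝ)..b, f' x = f b - f 0 := by
  rw [hf.eq b (by simp [hb])]; ring

lemma le_of_deriv_nonpos (hf : ACPair b f f') 
    (h : ∀ᵐ x ∂volume.restrict (Ioc 0 b), f' x ≤ 0) {x : ℝ} (hx : x ∈ Icc 0 b) : f x ≤ f 0 := by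
  rw [hf.eq x hx]
  have : ∫ t in (0 : ℝ)..x, f' t ≤ 0 := by
    rw [intervalIntegral.integral_of_le hx.1]
    exact integral_nonpos_of_ae (ae_mono (Measure.restrict_mono (Ioc_subset_Ioc_right hx.2) le_rfl) h)
  linarith

/-- Grönwall's inequality with an integrable coefficient. -/
lemma gronwall (hb : 0 ≤ b) (hf : ACPair b f f') {a : ℝ → ℝ} (ha : IntervalIntegrable a volume 0 b)
    (h : ∀ᵐ x ∂volume.restrict (Ioc 0 b), f' x ≤ a x * f x) {x : ℝ} (hx : x ∈ Icc 0 b) :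
    f x ≤ f 0 * Real.exp (∫ t in (0 : ℝ)..x, a t) := by
  have h1 := ((primitive ha).const_mul hb (-1)).comp_of_forall hb
    (G := Real.exp) (G' := Real.exp) Real.hasDerivAt_exp Real.continuous_exp
  have h2 := (hf.mul hb h1).le_of_deriv_nonpos (by
    filter_upwards [h] with t ht
    have := Real.exp_pos (-1 * ∫ t in (0 : ℝ)..t, a t)
    nlinarith) hx
  simp only [intervalIntegral.integral_same, mul_zero, Real.exp_zero, mul_one] at h2
  calc f x = f x * Real.exp (-1 * ∫ t in (0 : ℝ)..x, a t) * Real.exp (∫ t in (0 : ℝ)..x, a t) := by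
        rw [mul_assoc, ← Real.exp_add]; simp
    _ ≤ _ := by gcongr

end ACPair

end

end CNSE

namespace CNSE

noncomputable section

/-! ### Time derivatives of functions on a space-time strip -/

/-- Lebesgue measure on the strip `(0,T) × (0,1)`. -/
def stripVol (T : ℝ) : Measure (ℝ × ℝ) :=
  (volume.restrict (Ioc 0 T)).prod (volume.restrict (Ioc 0 1))

/-- For almost every `x ∈ (0,1)` the function `t ↦ f t x` is absolutely continuous on `[0,T]` with
derivative `g`, and `g` is integrable on the strip. -/
structure TimeDeriv (T : ℝ) (f g : ℝ → ℝ → ℝ) : Prop where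
  integrable : Integrable (fun p : ℝ × ℝ => g p.1 p.2) (stripVol T)
  ac : ∀ᵐ x ∂volume.restrict (Ioc (0 : ℝ) 1), ACPair T (fun t => f t x) (fun t => g t x)

lemma ae_strip {T : ℝ} {p : ℝ → ℝ → Prop} (h : ∀ᵐ z ∂stripVol T, p z.1 z.2) :
    ∀ᵐ t ∂volume.restrict (Ioc 0 T), ∀ᵐ x ∂volume.restrict (Ioc (0 : ℝ) 1), p t x :=
  Measure.ae_ae_of_ae_prod h

lemma ae_strip_swap {T : ℝ} {p : ℝ → ℝ → Prop} (h : ∀ᵐ z ∂stripVol T, p z.1 z.2) :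
    ∀ᵐ x ∂volume.restrict (Ioc (0 : ℝ) 1), ∀ᵐ t ∂volume.restrict (Ioc 0 T), p t x := by
  refine Measure.ae_ae_of_ae_prod (p := fun z : ℝ × ℝ => p z.2 z.1) ?_
  exact Measure.measurePreserving_swap.quasiMeasurePreserving.ae h

/-- Fubini for null sets requires a measurable set, and the coincidence set of two almost everywhere
measurable functions need not be one. The equality is therefore proved for measurable
representatives and transported back. -/
lemma ae_strip_of_ae_ae {T : ℝ} {f g : ℝ → ℝ → ℝ}
    (hf : AEMeasurable (fun p : ℝ × ℝ => f p.1 p.2) (stripVol T))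
    (hg : AEMeasurable (fun p : ℝ × ℝ => g p.1 p.2) (stripVol T))
    (h : ∀ᵐ t ∂volume.restrict (Ioc 0 T), ∀ᵐ x ∂volume.restrict (Ioc (0 : ℝ) 1), f t x = g t x) :
    ∀ᵐ z ∂stripVol T, f z.1 z.2 = g z.1 z.2 := by
  have hm : MeasurableSet {z | hf.mk _ z = hg.mk _ z} :=
    measurableSet_eq_fun hf.measurable_mk hg.measurable_mk
  have h1 : ∀ᵐ z ∂stripVol T, hf.mk _ z = hg.mk _ z := by
    refine (Measure.ae_prod_iff_ae_ae hm).2 ?_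
    filter_upwards [h, ae_strip (p := fun t x => f t x = hf.mk _ (t, x)) hf.ae_eq_mk,
      ae_strip (p := fun t x => g t x = hg.mk _ (t, x)) hg.ae_eq_mk] with t h1 h2 h3
    filter_upwards [h1, h2, h3] with x h1 h2 h3
    rw [← h2, ← h3, h1]
  filter_upwards [h1, hf.ae_eq_mk, hg.ae_eq_mk] with z h1 h2 h3
  rw [h2, h3, h1]

lemma integrable_strip_iff {T : ℝ} (hT : 0 ≤ T) {g : ℝ → ℝ → ℝ} 
    (h : Integrable (fun p : ℝ × ℝ => g p.1 p.2) (stripVol T)) :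
    IntervalIntegrable (fun t => ∫ x in (0 : ℝ)..1, g t x) volume 0 T := by
  rw [intervalIntegrable_iff_integrableOn_Ioc_of_le hT]
  simp only [intervalIntegral.integral_of_le zero_le_one]
  exact h.integral_prod_left

lemma stripVol_mono {T t : ℝ} (h : t ≤ T) : stripVol t ≤ stripVol T :=
  Measure.prod_mono (Measure.restrict_mono (Ioc_subset_Ioc_right h) le_rfl) le_rfl

lemma ae_stripVol_mem (T : ℝ) : ∀ᵐ z ∂stripVol T, z.1 ∈ Ioc 0 T ∧ z.2 ∈ Ioc (0 : ℝ) 1 := by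
  have : stripVol T = (volume : Measure (ℝ × ℝ)).restrict (Ioc 0 T ×ˢ Ioc (0:ℝ) 1) := by
    rw [stripVol, Measure.prod_restrict]; rfl
  rw [this]
  exact ae_restrict_mem (measurableSet_Ioc.prod measurableSet_Ioc)

lemma exists_bound_strip {f : ℝ → ℝ → ℝ} (hf : Continuous fun p : ℝ × ℝ => f p.1 p.2) (T : ℝ) :
    ∃ C, 0 < C ∧ ∀ t ∈ Icc 0 T, ∀ x ∈ Icc (0 : ℝ) 1, |f t x| ≤ C := by
  obtain ⟨C, hC⟩ := (isCompact_Icc.prod isCompact_Icc :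
    IsCompact (Icc 0 T ×ˢ Icc (0 : ℝ) 1)).exists_bound_of_continuousOn hf.continuousOn
  exact ⟨max C 1, by positivity, fun t ht x hx => (hC (t, x) ⟨ht, hx⟩).trans (le_max_left _ _)⟩

lemma Integrable.strip_mul_continuous {f g : ℝ → ℝ → ℝ} {T : ℝ}
    (hf : Continuous fun p : ℝ × ℝ => f p.1 p.2)
    (hg : Integrable (fun p : ℝ × ℝ => g p.1 p.2) (stripVol T)) :
    Integrable (fun p : ℝ × ℝ => f p.1 p.2 * g p.1 p.2) (stripVol T) := by
  obtain ⟨C, -, hC⟩ := exists_bound_strip hf T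
  refine hg.bdd_mul (c := C) hf.aestronglyMeasurable ?_
  filter_upwards [ae_stripVol_mem T] with z hz
  exact hC _ (Ioc_subset_Icc_self hz.1) _ (Ioc_subset_Icc_self hz.2)

namespace TimeDeriv

variable {T : ℝ} {f g h k : ℝ → ℝ → ℝ}

/-- Differentiation under the integral sign. -/
lemma integral (hT : 0 ≤ T) (H : TimeDeriv T f g)
    (h0 : IntervalIntegrable (f 0) volume 0 1) :
    ACPair T (fun t => ∫ x in (0 : ℝ)..1, f t x) (fun t => ∫ x in (0 : ℝ)..1, g t x) := by
  refine ⟨integrable_strip_iff hT H.integrable, fun t ht => ?_⟩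
  have hi : Integrable (fun p : ℝ × ℝ => g p.1 p.2) (stripVol t) :=
    H.integrable.mono_measure (stripVol_mono ht.2)
  have h1 : ∫ x in (0 : ℝ)..1, f t x
      = ∫ x in (0 : ℝ)..1, (f 0 x + ∫ s in (0 : ℝ)..t, g s x) := by
    refine intervalIntegral.integral_congr_ae ?_
    filter_upwards [(ae_restrict_iff' measurableSet_Ioc).1 H.ac] with x hx hx1
    rw [uIoc_of_le zero_le_one] at hx1
    exact (hx hx1).eq t ht
  have h2 : IntervalIntegrable (fun x => ∫ s in (0 : ℝ)..t, g s x) volume 0 1 := by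
    rw [intervalIntegrable_iff_integrableOn_Ioc_of_le zero_le_one]
    simp only [intervalIntegral.integral_of_le ht.1]
    exact hi.integral_prod_right
  rw [h1, intervalIntegral.integral_add h0 h2]
  congr 1
  simp only [intervalIntegral.integral_of_le ht.1, intervalIntegral.integral_of_le zero_le_one]
  exact (integral_integral_swap hi).symm

lemma congr (hT : 0 ≤ T) (H : TimeDeriv T f g)
    (hf : ∀ t ∈ Icc 0 T, ∀ x ∈ Icc (0 : ℝ) 1, f t x = h t x)
    (hg : ∀ᵐ z ∂stripVol T, g z.1 z.2 = k z.1 z.2) : TimeDeriv T h k := by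
  refine ⟨H.integrable.congr hg, ?_⟩
  filter_upwards [H.ac, ae_strip_swap (p := fun t x => g t x = k t x) hg,
    ae_restrict_mem measurableSet_Ioc] with x h1 h2 hx
  exact h1.congr hT (fun t ht => hf t ht x (Ioc_subset_Icc_self hx)) h2

lemma add (hT : 0 ≤ T) (H : TimeDeriv T f g) (K : TimeDeriv T h k) :
    TimeDeriv T (fun t x => f t x + h t x) (fun t x => g t x + k t x) := by
  refine ⟨H.integrable.add K.integrable, ?_⟩
  filter_upwards [H.ac, K.ac] with x h1 h2 using h1.add hT h2

lemma sub (hT : 0 ≤ T) (H : TimeDeriv T f g) (K : TimeDeriv T h k) :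
    TimeDeriv T (fun t x => f t x - h t x) (fun t x => g t x - k t x) := by
  refine ⟨H.integrable.sub K.integrable, ?_⟩
  filter_upwards [H.ac, K.ac] with x h1 h2 using h1.sub hT h2

lemma const_mul (hT : 0 ≤ T) (c : ℝ) (H : TimeDeriv T f g) :
    TimeDeriv T (fun t x => c * f t x) (fun t x => c * g t x) := by
  refine ⟨H.integrable.const_mul c, ?_⟩
  filter_upwards [H.ac] with x h1 using h1.const_mul hT c

lemma mul (hT : 0 ≤ T) (H : TimeDeriv T f g) (K : TimeDeriv T h k)
    (hf : Continuous fun p : ℝ × ℝ => f p.1 p.2) (hh : Continuous fun p : ℝ × ℝ => h p.1 p.2) :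
    TimeDeriv T (fun t x => f t x * h t x) (fun t x => g t x * h t x + f t x * k t x) := by
  refine ⟨?_, ?_⟩
  · refine Integrable.add ?_ (Integrable.strip_mul_continuous hf K.integrable)
    simpa only [mul_comm] using Integrable.strip_mul_continuous hh H.integrable
  · filter_upwards [H.ac, K.ac] with x h1 h2 using h1.mul hT h2

/-- A function of time only. -/
lemma of_acPair (hT : 0 ≤ T) {φ φ' : ℝ → ℝ} (H : ACPair T φ φ') :
    TimeDeriv T (fun t _ => φ t) (fun t _ => φ' t) := by
  refine ⟨?_, by simpa using Eventually.of_forall fun _ => H⟩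
  have := (intervalIntegrable_iff_integrableOn_Ioc_of_le hT).1 H.integrable
  exact Integrable.comp_fst this _

/-- Chain rule. -/
lemma comp (hT : 0 ≤ T) (H : TimeDeriv T f g) (hf : Continuous fun p : ℝ × ℝ => f p.1 p.2)
    {G G' : ℝ → ℝ} {m M : ℝ}
    (hm : ∀ t ∈ Icc 0 T, ∀ x ∈ Icc (0 : ℝ) 1, f t x ∈ Icc m M)
    (hG : ∀ y ∈ Icc m M, HasDerivAt G (G' y) y) (hG' : ContinuousOn G' (Icc m M)) :
    TimeDeriv T (fun t x => G (f t x)) (fun t x => G' (f t x) * g t x) := by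
  obtain ⟨C, hC⟩ := isCompact_Icc.exists_bound_of_continuousOn hG'
  refine ⟨?_, ?_⟩
  · refine H.integrable.bdd_mul (c := C) ?_ ?_
    · have h1 : Measurable ((Icc m M).indicator G') := by
        rw [← piecewise_eq_indicator]
        exact hG'.measurable_piecewise continuousOn_const measurableSet_Icc
      have h2 : AEStronglyMeasurable (fun p : ℝ × ℝ => (Icc m M).indicator G' (f p.1 p.2))
          (stripVol T) := (h1.comp hf.measurable).aestronglyMeasurable
      refine h2.congr ?_
      filter_upwards [ae_stripVol_mem T] with z hz
      exact indicator_of_mem (hm _ (Ioc_subset_Icc_self hz.1) _ (Ioc_subset_Icc_self hz.2)) _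
    · filter_upwards [ae_stripVol_mem T] with z hz
      exact hC _ (hm _ (Ioc_subset_Icc_self hz.1) _ (Ioc_subset_Icc_self hz.2))
  · filter_upwards [H.ac, ae_restrict_mem measurableSet_Ioc] with x h1 hx
    exact h1.comp hT (fun t ht => hm t ht x (Ioc_subset_Icc_self hx)) hG hG'

lemma comp_of_forall (hT : 0 ≤ T) (H : TimeDeriv T f g)
    (hf : Continuous fun p : ℝ × ℝ => f p.1 p.2) {G G' : ℝ → ℝ}
    (hG : ∀ y, HasDerivAt G (G' y) y) (hG' : Continuous G') :
    TimeDeriv T (fun t x => G (f t x)) (fun t x => G' (f t x) * g t x) := by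
  obtain ⟨C, -, hC⟩ := exists_bound_strip hf T
  exact H.comp hT hf (m := -C) (M := C) (fun t ht x hx => abs_le.1 (hC t ht x hx))
    (fun y _ => hG y) hG'.continuousOn

lemma mono (H : TimeDeriv T f g) {t : ℝ} (ht : 0 ≤ t) (htT : t ≤ T) : TimeDeriv t f g :=
  ⟨H.integrable.mono_measure (stripVol_mono htT), H.ac.mono fun _ h => h.mono ht htT⟩

/-- Integration against a bounded kernel. -/
lemma integral_kernel (hT : 0 ≤ T) (H : TimeDeriv T f g)
    (h0 : IntervalIntegrable (f 0) volume 0 1) {κ : ℝ → ℝ} (hκ : Measurable κ)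
    (hb : ∀ x, |κ x| ≤ 1) :
    ACPair T (fun t => ∫ x in (0 : ℝ)..1, κ x * f t x)
      (fun t => ∫ x in (0 : ℝ)..1, κ x * g t x) := by
  have hκ1 : ∀ᵐ x ∂volume.restrict (Ioc (0 : ℝ) 1), ‖κ x‖ ≤ 1 := Eventually.of_forall hb
  refine integral (f := fun t x => κ x * f t x) (g := fun t x => κ x * g t x) hT ⟨?_, ?_⟩ ?_
  · exact H.integrable.bdd_mul (c := 1) (hκ.comp measurable_snd).aestronglyMeasurable
      (Eventually.of_forall fun z => hb z.2)
  · filter_upwards [H.ac] with x hx using hx.const_mul hT _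
  · rw [intervalIntegrable_iff_integrableOn_Ioc_of_le zero_le_one] at h0 ⊢
    exact h0.bdd_mul (c := 1) hκ.aestronglyMeasurable hκ1

end TimeDeriv

end

end CNSE

namespace CNSE

noncomputable section

/-! ### Estimates on the unit interval -/

/-- `f ∈ L²(0,1)`. -/
abbrev MemL2 (f : ℝ → ℝ) : Prop := MemLp f 2 (volume.restrict (Ioc (0 : ℝ) 1))

/-- The `L²(0,1)` norm. -/
def nrm (f : ℝ → ℝ) : ℝ := √(∫ x in (0 : ℝ)..1, f x ^ 2)

lemma nrm_nonneg (f : ℝ → ℝ) : 0 ≤ nrm f := Real.sqrt_nonneg _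

lemma nrm_sq (f : ℝ → ℝ) : nrm f ^ 2 = ∫ x in (0 : ℝ)..1, f x ^ 2 :=
  Real.sq_sqrt (intervalIntegral.integral_nonneg zero_le_one fun _ _ => sq_nonneg _)

lemma ContinuousOn.memL2 {f : ℝ → ℝ} (hf : ContinuousOn f (Icc 0 1)) : MemL2 f := by
  obtain ⟨C, hC⟩ := isCompact_Icc.exists_bound_of_continuousOn hf
  refine MemLp.of_bound
    ((hf.mono Ioc_subset_Icc_self).aestronglyMeasurable measurableSet_Ioc) C ?_
  filter_upwards [ae_restrict_mem measurableSet_Ioc] with x hx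
  exact hC x (Ioc_subset_Icc_self hx)

lemma MemL2.mul_integrable {f g : ℝ → ℝ} (hf : MemL2 f) (hg : MemL2 g) :
    IntervalIntegrable (fun x => f x * g x) volume 0 1 := by
  rw [intervalIntegrable_iff_integrableOn_Ioc_of_le zero_le_one]
  exact hf.integrable_mul hg

lemma MemL2.sq_integrable {f : ℝ → ℝ} (hf : MemL2 f) :
    IntervalIntegrable (fun x => f x ^ 2) volume 0 1 := by
  simpa only [sq] using hf.mul_integrable hf

lemma MemL2.integrable' {f : ℝ → ℝ} (hf : MemL2 f) : IntervalIntegrable f volume 0 1 := by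
  rw [intervalIntegrable_iff_integrableOn_Ioc_of_le zero_le_one]
  exact hf.integrable (by norm_num)

lemma MemL2.fun_abs {f : ℝ → ℝ} (hf : MemL2 f) : MemL2 (fun x => |f x|) := hf.abs

/-- The Cauchy–Schwarz inequality. -/
lemma integral_abs_mul_abs_le {f g : ℝ → ℝ} (hf : MemL2 f) (hg : MemL2 g) :
    ∫ x in (0 : ℝ)..1, |f x| * |g x| ≤ nrm f * nrm g := by
  have h := integral_mul_norm_le_Lp_mul_Lq (μ := volume.restrict (Ioc (0 : ℝ) 1)) (f := f) (g := g)
    (p := 2) (q := 2) (by constructor <;> norm_num) (by simpa using hf) (by simpa using hg)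
  simp only [nrm, intervalIntegral.integral_of_le zero_le_one, Real.sqrt_eq_rpow]
  simpa using h

lemma integral_abs_le_nrm {f : ℝ → ℝ} (hf : MemL2 f) : ∫ x in (0 : ℝ)..1, |f x| ≤ nrm f := by
  have := integral_abs_mul_abs_le hf (g := fun _ => 1) (memLp_const 1)
  simpa [nrm] using this

lemma abs_integral_le_of_subset {f : ℝ → ℝ} (hf : IntervalIntegrable f volume 0 1) {x y : ℝ}
    (hx : x ∈ Icc (0 : ℝ) 1) (hy : y ∈ Icc (0 : ℝ) 1) :
    |∫ t in x..y, f t| ≤ ∫ t in (0 : ℝ)..1, |f t| := by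
  rw [← Real.norm_eq_abs]
  refine (intervalIntegral.norm_integral_le_integral_norm_uIoc).trans ?_
  rw [intervalIntegral.integral_of_le zero_le_one]
  refine setIntegral_mono_set ?_ (Eventually.of_forall fun t => abs_nonneg _)
    (Eventually.of_forall (uIoc_subset_uIoc_of_mem hx hy))
  exact ((intervalIntegrable_iff_integrableOn_Ioc_of_le zero_le_one).1 hf).abs
where
  uIoc_subset_uIoc_of_mem {x y : ℝ} (hx : x ∈ Icc (0 : ℝ) 1) (hy : y ∈ Icc (0 : ℝ) 1) :
      uIoc x y ⊆ Ioc 0 1 := by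
    intro z hz
    rw [mem_uIoc] at hz
    rcases hz with h | h
    · exact ⟨hx.1.trans_lt h.1, h.2.trans hy.2⟩
    · exact ⟨hy.1.trans_lt h.1, h.2.trans hx.2⟩

namespace ACPair

variable {f f' : ℝ → ℝ}

lemma abs_sub_le (hf : ACPair 1 f f') (hf' : MemL2 f') {x y : ℝ}
    (hx : x ∈ Icc (0 : ℝ) 1) (hy : y ∈ Icc (0 : ℝ) 1) : |f y - f x| ≤ nrm f' := by
  rw [hf.sub_eq hx hy]
  exact (abs_integral_le_of_subset hf'.integrable' hx hy).trans (integral_abs_le_nrm hf')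

lemma abs_le_of_zero (hf : ACPair 1 f f') (hf' : MemL2 f') {x y : ℝ}
    (hx : x ∈ Icc (0 : ℝ) 1) (h0 : f x = 0) (hy : y ∈ Icc (0 : ℝ) 1) : |f y| ≤ nrm f' := by
  simpa [h0] using hf.abs_sub_le hf' hx hy

/-- A function of mean zero is bounded by the `L²` norm of its derivative. -/
lemma abs_le_of_integral_eq_zero (hf : ACPair 1 f f') (hf' : MemL2 f')
    (h0 : ∫ x in (0 : ℝ)..1, f x = 0) {y : ℝ} (hy : y ∈ Icc (0 : ℝ) 1) : |f y| ≤ nrm f' := by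
  have hc := hf.continuousOn zero_le_one
  have hi : IntervalIntegrable f volume 0 1 :=
    ContinuousOn.intervalIntegrable (by rwa [uIcc_of_le zero_le_one])
  have e1 : f y = ∫ x in (0 : ℝ)..1, (f y - f x) := by
    rw [intervalIntegral.integral_sub (by simp) hi, h0]; simp
  rw [e1]
  have := intervalIntegral.norm_integral_le_of_norm_le_const (a := (0 : ℝ)) (b := 1)
    (f := fun x => f y - f x) (C := nrm f') (fun x hx => by
      rw [uIoc_of_le zero_le_one] at hx
      exact hf.abs_sub_le hf' (Ioc_subset_Icc_self hx) hy)
  simpa using this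

lemma memL2 (hf : ACPair 1 f f') : MemL2 f := ContinuousOn.memL2 (hf.continuousOn zero_le_one)

end ACPair

/-- The exact part of the energy balance for the difference of two solutions vanishes. -/
lemma energy_balance {A : ℝ} {r r' v v' v'' R R' U U' U'' : ℝ → ℝ}
    (hr : ACPair 1 r r') (hv : ACPair 1 v v') (hv' : ACPair 1 v' v'')
    (hR : ACPair 1 R R') (hU : ACPair 1 U U') (hU' : ACPair 1 U' U'')
    (hv0 : v 0 = 0) (hv1 : v 1 = 0) (hU0 : U 0 = 0) (hU1 : U 1 = 0)
    (hRp : ∀ x ∈ Icc (0 : ℝ) 1, R x ≠ 0) {rest : ℝ → ℝ} (hi : IntervalIntegrable rest volume 0 1)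
    (hrest : ∀ x, rest x = - (r x * (v x - U x) ^ 2 * U' x) - (v' x - U' x) ^ 2
      + A ^ 2 * ((r x - R x) * (v' x - U' x)) + A ^ 2 * ((r x - R x) * R' x * (v x - U x) / R x)
      - (r x - R x) * U'' x * (v x - U x) / R x - 1 / 2 * ((r x - R x) ^ 2 * v' x)
      - (r x - R x) * (R' x * (v x - U x) + R x * (v' x - U' x))) :
    ∫ x in (0 : ℝ)..1, (1 / 2 * (-(r' x * v x + r x * v' x) * (v x - U x) ^ 2)
      + (v x - U x) * (-(r x * (v x * v' x - U x * U' x)) - A ^ 2 * r' x + v'' x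
          + r x / R x * (A ^ 2 * R' x - U'' x))
      + (r x - R x) * (-(r' x * v x + r x * v' x) + (R' x * U x + R x * U' x)))
      = ∫ x in (0 : ℝ)..1, rest x := by
  have h01 := zero_le_one (α := ℝ)
  have hw := hv.sub h01 hU
  have hd := hr.sub h01 hR
  -- With w = v − U, the integrand differs from `rest` by the derivative of −½ r v w² + w w_x − A²
  -- (r − R) w − ½ (r − R)² v. Every summand contains v or w and so vanishes at both endpoints.
  have E1 := ((hr.mul h01 hv).mul h01 (hw.mul h01 hw)).const_mul h01 (-(1 / 2))
  have E2 := hw.mul h01 (hv'.sub h01 hU')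
  have E3 := (hd.mul h01 hw).const_mul h01 (-A ^ 2)
  have E4 := ((hd.mul h01 hd).mul h01 hv).const_mul h01 (-(1 / 2))
  have E := ((E1.add h01 E2).add h01 E3).add h01 E4
  have h0 := E.integral_eq h01
  simp only [hv0, hv1, hU0, hU1, sub_self, mul_zero, zero_mul, add_zero] at h0
  refine Eq.trans ?_ (add_zero (∫ x in (0 : ℝ)..1, rest x))
  refine Eq.trans ?_ (congrArg _ h0)
  rw [← intervalIntegral.integral_add hi E.integrable]
  refine intervalIntegral.integral_congr fun x hx => ?_
  rw [uIcc_of_le h01] at hx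
  have := hRp x hx
  simp only [hrest]
  field_simp
  ring

/-- Here b and B stand for v_x and U_x, while `r'` and q stand for R_x and U_xx. The term (r − R)² b
is split through b = B + (b − B), so that the unknown velocity gradient appears only in b − B, where
−(b − B)² is available to absorb it. The other factors are controlled by the reference solution, by
D or by M. -/
lemma stability_pointwise {A m M C D e r R v V b B r' q : ℝ} (hm : 0 < m) (hr : 0 ≤ r)
    (hRm : m ≤ R) (hRC : R ≤ C) (hM : |r - R| ≤ M) (bw : |v - V| ≤ D) (bU : |B| ≤ e) :
    - (r * (v - V) ^ 2 * B) - (b - B) ^ 2 + A ^ 2 * ((r - R) * (b - B))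
      + A ^ 2 * ((r - R) * r' * (v - V) / R) - (r - R) * q * (v - V) / R
      - 1 / 2 * ((r - R) ^ 2 * b) - (r - R) * (r' * (v - V) + R * (b - B))
      ≤ e * (r * (v - V) ^ 2) - (b - B) ^ 2 + (A ^ 2 + M / 2 + C) * (|r - R| * |b - B|)
        + (A ^ 2 * D / m + D) * (|r - R| * |r'|) + D / m * (|r - R| * |q|)
        + 1 / 2 * e * (r - R) ^ 2 := by
  have hR := hm.trans_le hRm
  have hD : 0 ≤ D := (abs_nonneg _).trans bw
  have h1 := (abs_le.1 bU).1
  have t1 : - (r * (v - V) ^ 2 * B) ≤ e * (r * (v - V) ^ 2) := by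
    linarith [mul_nonneg (mul_nonneg hr (sq_nonneg (v - V))) (neg_le_iff_add_nonneg.1 h1)]
  have t2 : A ^ 2 * ((r - R) * (b - B)) ≤ A ^ 2 * (|r - R| * |b - B|) := by
    rw [← abs_mul]; gcongr; exact le_abs_self _
  have Q : ∀ y : ℝ, |(r - R) * y * (v - V) / R| ≤ D / m * (|r - R| * |y|) := by
    intro y
    rw [abs_div, abs_mul, abs_mul, abs_of_pos hR,
      show D / m * (|r - R| * |y|) = |r - R| * |y| * D / m by ring]
    gcongr
  have t3 : A ^ 2 * ((r - R) * r' * (v - V) / R) ≤ A ^ 2 * (D / m * (|r - R| * |r'|)) := by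
    gcongr
    exact (le_abs_self _).trans (Q _)
  have t4 : -((r - R) * q * (v - V) / R) ≤ D / m * (|r - R| * |q|) := (neg_le_abs _).trans (Q _)
  have t5 : -((r - R) ^ 2 * (b - B)) ≤ M * (|r - R| * |b - B|) := by
    refine (neg_le_abs _).trans ?_
    rw [abs_mul, abs_pow, sq, mul_assoc]
    gcongr
  have t5' := mul_nonneg (sq_nonneg (r - R)) (neg_le_iff_add_nonneg.1 h1)
  have t6 : -((r - R) * (r' * (v - V) + R * (b - B)))
      ≤ |r - R| * (|r'| * D + C * |b - B|) := by
    refine (neg_le_abs _).trans ?_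
    rw [abs_mul]
    gcongr
    refine (abs_add_le _ _).trans ?_
    rw [abs_mul, abs_mul, abs_of_pos hR]
    gcongr
  have e1 : (A ^ 2 + M / 2 + C) * (|r - R| * |b - B|)
        + (A ^ 2 * D / m + D) * (|r - R| * |r'|)
      = A ^ 2 * (|r - R| * |b - B|) + M * (|r - R| * |b - B|) / 2
        + A ^ 2 * (D / m * (|r - R| * |r'|)) + |r - R| * (|r'| * D + C * |b - B|) := by ring
  have e2 : 1 / 2 * ((r - R) ^ 2 * b) = 1 / 2 * ((r - R) ^ 2 * (b - B))
      + 1 / 2 * ((r - R) ^ 2 * (B + e)) - 1 / 2 * e * (r - R) ^ 2 := by ring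
  linarith

/-- The differential inequality behind the `L²` stability of solutions, at a fixed time. -/
lemma stability_estimate {A m M C : ℝ} (hm : 0 < m)
    {r r' v v' v'' R R' U U' U'' : ℝ → ℝ}
    (hr : ACPair 1 r r') (hv : ACPair 1 v v') (hv' : ACPair 1 v' v'')
    (hR : ACPair 1 R R') (hU : ACPair 1 U U') (hU' : ACPair 1 U' U'')
    (hR2 : MemL2 R') (hU2 : MemL2 U'') (hRC : nrm R' ≤ C)
    (hv0 : v 0 = 0) (hv1 : v 1 = 0) (hU0 : U 0 = 0) (hU1 : U 1 = 0)
    (hr0 : ∀ x ∈ Icc (0 : ℝ) 1, 0 ≤ r x) (hRm : ∀ x ∈ Icc (0 : ℝ) 1, m ≤ R x)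
    (hRM : ∀ x ∈ Icc (0 : ℝ) 1, R x ≤ C) (hM : ∀ x ∈ Icc (0 : ℝ) 1, |r x - R x| ≤ M) :
    ∫ x in (0 : ℝ)..1, (1 / 2 * (-(r' x * v x + r x * v' x) * (v x - U x) ^ 2)
      + (v x - U x) * (-(r x * (v x * v' x - U x * U' x)) - A ^ 2 * r' x + v'' x
          + r x / R x * (A ^ 2 * R' x - U'' x))
      + (r x - R x) * (-(r' x * v x + r x * v' x) + (R' x * U x + R x * U' x)))
      ≤ (3 * nrm U'' + 1 / 2 * (A ^ 2 + A ^ 2 * C / m + M / 2 + C + C + nrm U'' / m) ^ 2)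
        * ∫ x in (0 : ℝ)..1, (1 / 2 * (r x * (v x - U x) ^ 2) + 1 / 2 * (r x - R x) ^ 2) := by
  have h01 := zero_le_one (α := ℝ)
  have h0m : (0 : ℝ) ∈ Icc (0 : ℝ) 1 := by simp
  have hw := hv.sub h01 hU
  have hd := hr.sub h01 hR
  have hw' := hv'.sub h01 hU'
  set e := nrm U'' with he
  set D := nrm (fun x => v' x - U' x) with hD
  set d := nrm (fun x => r x - R x) with hd'
  have he0 : 0 ≤ e := nrm_nonneg _
  have hD0 : 0 ≤ D := nrm_nonneg _
  have hd0 : 0 ≤ d := nrm_nonneg _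
  have hC0 : 0 ≤ C := (nrm_nonneg _).trans hRC
  have hM0 : 0 ≤ M := (abs_nonneg _).trans (hM 0 h0m)
  -- w vanishes at the boundary, so its supremum is at most the L² norm D of w_x. Likewise U_x has
  -- mean zero because U vanishes at both ends, which bounds it by e, the L² norm of U_xx.
  have bw : ∀ x ∈ Icc (0 : ℝ) 1, |v x - U x| ≤ D := fun x hx =>
    hw.abs_le_of_zero hw'.memL2 h0m (by simp [hv0, hU0]) hx
  have bU : ∀ x ∈ Icc (0 : ℝ) 1, |U' x| ≤ e := fun x hx =>
    hU'.abs_le_of_integral_eq_zero hU2 (by rw [hU.integral_eq h01, hU0, hU1, sub_zero]) hx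
  have c1 := integral_abs_mul_abs_le hd.memL2 hw'.memL2
  have c2 := integral_abs_mul_abs_le hd.memL2 hR2
  have c3 := integral_abs_mul_abs_le hd.memL2 hU2
  have i0 : IntervalIntegrable (fun x => r x * (v x - U x) ^ 2) volume 0 1 := by
    refine ContinuousOn.intervalIntegrable ?_
    rw [uIcc_of_le h01]
    exact (hr.continuousOn h01).mul ((hw.continuousOn h01).pow 2)
  have i1 := (hd.memL2.fun_abs).mul_integrable (hw'.memL2.fun_abs)
  have i2 := (hd.memL2.fun_abs).mul_integrable (hR2.fun_abs)
  have i3 := (hd.memL2.fun_abs).mul_integrable (hU2.fun_abs)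
  have i4 := hd.memL2.sq_integrable
  have i5 := hw'.memL2.sq_integrable
  have hrest : IntervalIntegrable (fun x => - (r x * (v x - U x) ^ 2 * U' x) - (v' x - U' x) ^ 2
      + A ^ 2 * ((r x - R x) * (v' x - U' x)) + A ^ 2 * ((r x - R x) * R' x * (v x - U x) / R x)
      - (r x - R x) * U'' x * (v x - U x) / R x - 1 / 2 * ((r x - R x) ^ 2 * v' x)
      - (r x - R x) * (R' x * (v x - U x) + R x * (v' x - U' x))) volume 0 1 := by
    have cd := hd.continuousOn h01
    have cw := hw.continuousOn h01
    have cw' := hw'.continuousOn h01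
    have cR := hR.continuousOn h01
    have cU' := hU'.continuousOn h01
    have cr := hr.continuousOn h01
    have cv' := hv'.continuousOn h01
    have hne : ∀ x ∈ Icc (0 : ℝ) 1, R x ≠ 0 := fun x hx => (hm.trans_le (hRm x hx)).ne'
    rw [← uIcc_of_le h01] at cd cw cw' cR cU' cr cv' hne
    have j1 := hR2.integrable'.continuousOn_mul (((cd.mul cw).div cR hne).const_mul (A ^ 2))
    have j2 := hU2.integrable'.continuousOn_mul ((cd.mul cw).div cR hne)
    have j3 := hR2.integrable'.continuousOn_mul (cd.mul cw)
    have j4 : IntervalIntegrable (fun x => - (r x * (v x - U x) ^ 2 * U' x) - (v' x - U' x) ^ 2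
      + A ^ 2 * ((r x - R x) * (v' x - U' x)) - 1 / 2 * ((r x - R x) ^ 2 * v' x)
      - (r x - R x) * (R x * (v' x - U' x))) volume 0 1 := by
      refine ContinuousOn.intervalIntegrable ?_
      fun_prop
    refine (((j4.add j1).sub j2).sub j3).congr fun x _ => ?_
    simp only [Pi.mul_apply, Pi.div_apply]
    ring
  rw [energy_balance hr hv hv' hR hU hU' hv0 hv1 hU0 hU1
    (fun x hx => (hm.trans_le (hRm x hx)).ne') hrest fun _ => rfl]
  have key := fun x (hx : x ∈ Icc (0 : ℝ) 1) => stability_pointwise (A := A) (r' := R' x)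
    (q := U'' x) (b := v' x) (B := U' x) hm (hr0 x hx)
    (hRm x hx) (hRM x hx) (hM x hx) (bw x hx) (bU x hx)
  have hbi := (((((i0.const_mul e).sub i5).add (i1.const_mul (A ^ 2 + M / 2 + C))).add
    (i2.const_mul (A ^ 2 * D / m + D))).add (i3.const_mul (D / m))).add (i4.const_mul (1 / 2 * e))
  refine (intervalIntegral.integral_mono_on h01 hrest hbi key).trans ?_
  rw [intervalIntegral.integral_add (((((i0.const_mul e).sub i5).add (i1.const_mul _)).add
      (i2.const_mul _)).add (i3.const_mul _)) (i4.const_mul _),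
    intervalIntegral.integral_add ((((i0.const_mul e).sub i5).add (i1.const_mul _)).add
      (i2.const_mul _)) (i3.const_mul _),
    intervalIntegral.integral_add (((i0.const_mul e).sub i5).add (i1.const_mul _))
      (i2.const_mul _),
    intervalIntegral.integral_add ((i0.const_mul e).sub i5) (i1.const_mul _),
    intervalIntegral.integral_sub (i0.const_mul e) i5,
    intervalIntegral.integral_add (i0.const_mul _) (i4.const_mul _)]
  simp only [intervalIntegral.integral_const_mul]
  rw [← nrm_sq, ← nrm_sq (fun x => r x - R x), ← hD, ← hd']
  have hS : 0 ≤ ∫ x in (0 : ℝ)..1, r x * (v x - U x) ^ 2 :=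
    intervalIntegral.integral_nonneg h01 fun x hx => mul_nonneg (hr0 x hx) (sq_nonneg _)
  set S := ∫ x in (0 : ℝ)..1, r x * (v x - U x) ^ 2
  set L := A ^ 2 + A ^ 2 * C / m + M / 2 + C + C + e / m with hL
  have c1' : (A ^ 2 + M / 2 + C) * (∫ x in (0 : ℝ)..1, |r x - R x| * |v' x - U' x|)
      ≤ (A ^ 2 + M / 2 + C) * (d * D) := by gcongr
  have c2' : (A ^ 2 * D / m + D) * (∫ x in (0 : ℝ)..1, |r x - R x| * |R' x|)
      ≤ (A ^ 2 * D / m + D) * (d * C) := by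
    gcongr
    exact c2.trans (by gcongr)
  have c3' : D / m * (∫ x in (0 : ℝ)..1, |r x - R x| * |U'' x|) ≤ D / m * (d * e) := by
    gcongr
  have hsum : (A ^ 2 + M / 2 + C) * (d * D) + (A ^ 2 * D / m + D) * (d * C) + D / m * (d * e)
      = L * (d * D) := by rw [hL]; ring
  -- Young's inequality with the weight for which D² is exactly the viscous dissipation −D² in the
  -- estimate. The remainder ¼ L² d² is ½ L² times the density part ½ d² of the relative energy.
  have hy : L * (d * D) ≤ D ^ 2 + 1 / 4 * L ^ 2 * d ^ 2 := by
    linarith [sq_nonneg (D - 1 / 2 * L * d)]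
  have hS' : 0 ≤ L ^ 2 * S := by positivity
  have hS2 : 0 ≤ e * S := by positivity
  have hS3 : 0 ≤ e * d ^ 2 := by positivity
  linarith

/-- The transport term in the maximum principle. -/
lemma transport_posPart {f f' v v' : ℝ → ℝ} (hf : ACPair 1 f f') (hv : ACPair 1 v v')
    (hv0 : v 0 = 0) (hv1 : v 1 = 0) :
    ∫ x in (0 : ℝ)..1, (2 * max (f x) 0 * (v x * f' x) + max (f x) 0 ^ 2 * v' x) = 0 := by
  have h01 := zero_le_one (α := ℝ)
  -- The integrand is the derivative of (f⁺)² v, which vanishes at both ends. The squared positive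
  -- part is continuously differentiable, so the ordinary chain rule applies across the corner.
  have h := ((hf.comp_of_forall h01 hasDerivAt_posPart_sq (by fun_prop)).mul h01 hv).integral_eq h01
  simp only [hv0, hv1, mul_zero, sub_zero] at h
  refine Eq.trans ?_ h
  refine intervalIntegral.integral_congr fun x _ => ?_
  ring
where
  hasDerivAt_posPart_sq (y : ℝ) : HasDerivAt (fun y : ℝ => max y 0 ^ 2) (2 * max y 0) y := by
    rcases lt_trichotomy y 0 with h | h | h
    · have : (fun y : ℝ => max y 0 ^ 2) =ᶠ[𝓝 y] fun _ => 0 := by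
        filter_upwards [Iio_mem_nhds h] with z hz
        simp [max_eq_right (le_of_lt (mem_Iio.1 hz))]
      rw [max_eq_right h.le, mul_zero]
      exact (hasDerivAt_const y (0 : ℝ)).congr_of_eventuallyEq this
    · subst h
      rw [hasDerivAt_iff_isLittleO]
      simp only [max_self, mul_zero, smul_zero, sub_zero, ne_eq, OfNat.ofNat_ne_zero,
        not_false_eq_true, zero_pow]
      have : (fun z : ℝ => z ^ 2) =o[𝓝 0] fun z : ℝ => z := by
        simpa using Asymptotics.isLittleO_pow_pow (𝕜 := ℝ) (show 1 < 2 by norm_num)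
      refine (Asymptotics.isBigO_of_le _ fun z => ?_).trans_isLittleO this
      simp only [norm_pow]
      gcongr
      simp only [Real.norm_eq_abs]
      rcases le_total z 0 with h | h
      · simp [max_eq_right h]
      · simp [max_eq_left h]
    · have : (fun y : ℝ => max y 0 ^ 2) =ᶠ[𝓝 y] fun y => y ^ 2 := by
        filter_upwards [Ioi_mem_nhds h] with z hz
        rw [max_eq_left (le_of_lt (mem_Ioi.1 hz))]
      rw [max_eq_left h.le]
      simpa using (hasDerivAt_pow 2 y).congr_of_eventuallyEq this

/-- The kernel recovering a function of mean zero from its derivative. -/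
def meanKernel (x y : ℝ) : ℝ := (Iic x).indicator (fun _ => 1) y - max 0 (min (1 - y) 1)

lemma measurable_meanKernel (x : ℝ) : Measurable (meanKernel x) := by
  unfold meanKernel
  exact (measurable_const.indicator measurableSet_Iic).sub (by fun_prop)

lemma abs_meanKernel_le (x y : ℝ) : |meanKernel x y| ≤ 1 := by
  unfold meanKernel
  have h1 : 0 ≤ max 0 (min (1 - y) 1) := le_max_left _ _
  have h2 : max 0 (min (1 - y) 1) ≤ 1 := by simp
  by_cases h : y ∈ Iic x
  · rw [indicator_of_mem h, abs_le]; constructor <;> linarith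
  · rw [indicator_of_notMem h, abs_le]; constructor <;> linarith

/-- On [0,1] the truncations in `meanKernel` are inactive, and the kernel is the indicator of y ≤ x
minus 1 − y. The truncations only serve to keep the kernel bounded on the whole line. -/
lemma integral_meanKernel_mul {q : ℝ → ℝ} (hq : IntervalIntegrable q volume 0 1) {x : ℝ}
    (hx : x ∈ Icc (0 : ℝ) 1) :
    ∫ y in (0 : ℝ)..1, meanKernel x y * q y
      = (∫ y in (0 : ℝ)..x, q y) - ∫ y in (0 : ℝ)..1, (1 - y) * q y := by
  have h01 := zero_le_one (α := ℝ)
  have e : ∀ y ∈ uIcc (0 : ℝ) 1, meanKernel x y * q y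
      = (Iic x).indicator q y - (1 - y) * q y := by
    intro y hy
    rw [uIcc_of_le h01] at hy
    rw [meanKernel, min_eq_left (by linarith [hy.1]), max_eq_right (by linarith [hy.2])]
    by_cases h : y ∈ Iic x <;> simp [h] <;> ring
  have i1 : IntervalIntegrable ((Iic x).indicator q) volume 0 1 := by
    rw [intervalIntegrable_iff_integrableOn_Ioc_of_le h01] at hq ⊢
    exact hq.indicator measurableSet_Iic
  have i2 : IntervalIntegrable (fun y => (1 - y) * q y) volume 0 1 :=
    hq.continuousOn_mul (by fun_prop)
  rw [intervalIntegral.integral_congr e, intervalIntegral.integral_sub i1 i2]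
  congr 1
  rw [intervalIntegral.integral_of_le h01, intervalIntegral.integral_of_le hx.1,
    setIntegral_indicator measurableSet_Iic]
  congr 2
  ext y; simp only [mem_inter_iff, mem_Ioc, mem_Iic]
  exact ⟨fun h => ⟨h.1.1, h.2⟩, fun h => ⟨⟨h.1, h.2.trans hx.2⟩, h.2⟩⟩

/-- Integrating (1 − y) q' by parts produces −q(0) + ∫ q, and the value q(0) cancels against the one
in the primitive of q'. The kernel thus inverts the derivative up to the mean, without a boundary
value. -/
lemma integral_meanKernel_deriv {q q' : ℝ → ℝ} (hq : ACPair 1 q q') {x : ℝ}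
    (hx : x ∈ Icc (0 : ℝ) 1) :
    ∫ y in (0 : ℝ)..1, meanKernel x y * q' y = q x - ∫ y in (0 : ℝ)..1, q y := by
  have h01 := zero_le_one (α := ℝ)
  have hl : ACPair 1 (fun y : ℝ => 1 - y) (fun _ => -1) :=
    ⟨by simp, fun x _ => by simp [sub_eq_add_neg]⟩
  have hqi : IntervalIntegrable q volume 0 1 := hq.memL2.integrable'
  have h := (hl.mul h01 hq).integral_eq h01
  rw [intervalIntegral.integral_add (by simpa using! hqi.neg)
    (hq.integrable.continuousOn_mul (by fun_prop))] at h
  simp only [neg_mul, one_mul, intervalIntegral.integral_neg] at h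
  rw [integral_meanKernel_mul hq.integrable hx, hq.eq x hx]
  linarith

end

end CNSE

namespace CNSE

noncomputable section

/-! ### Paths of solutions on a space-time strip -/

/-- Density and velocity as functions of time and space, with their spatial derivatives. -/
structure Path where
  /-- the density -/
  ρ : ℝ → ℝ → ℝ
  /-- the derivative of the density -/
  ρx : ℝ → ℝ → ℝ
  /-- the velocity -/
  u : ℝ → ℝ → ℝ
  /-- the derivative of the velocity -/
  ux : ℝ → ℝ → ℝ
  /-- the second derivative of the velocity -/
  uxx : ℝ → ℝ → ℝ

/-- The regularity of a solution on `[0,T]`. -/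
structure IsRegular (T : ℝ) (p : Path) : Prop where
  cont_ρ : Continuous fun z : ℝ × ℝ => p.ρ z.1 z.2
  cont_u : Continuous fun z : ℝ × ℝ => p.u z.1 z.2
  meas_ρx : Measurable fun z : ℝ × ℝ => p.ρx z.1 z.2
  meas_ux : Measurable fun z : ℝ × ℝ => p.ux z.1 z.2
  meas_uxx : Measurable fun z : ℝ × ℝ => p.uxx z.1 z.2
  ac_ρ : ∀ t ∈ Icc 0 T, ACPair 1 (p.ρ t) (p.ρx t)
  ac_u : ∀ t ∈ Icc 0 T, ACPair 1 (p.u t) (p.ux t)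
  bound : ∃ C, ∀ t ∈ Icc 0 T, MemL2 (p.ρx t) ∧ MemL2 (p.ux t) ∧
    nrm (p.ρx t) ≤ C ∧ nrm (p.ux t) ≤ C
  zero_left : ∀ t ∈ Icc 0 T, p.u t 0 = 0
  zero_right : ∀ t ∈ Icc 0 T, p.u t 1 = 0
  ac_ux : ∀ᵐ t ∂volume.restrict (Ioc 0 T), MemL2 (p.uxx t) ∧
    ∃ g, ACPair 1 g (p.uxx t) ∧ p.ux t =ᵐ[volume.restrict (Ioc (0 : ℝ) 1)] g
  uxx_int : IntervalIntegrable (fun t => nrm (p.uxx t) ^ 2) volume 0 T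

/-- The paths satisfying the continuity equation. -/
structure IsStripPath (T : ℝ) (p : Path) : Prop extends IsRegular T p where
  continuity : TimeDeriv T p.ρ (fun t x => -(p.ρx t x * p.u t x + p.ρ t x * p.ux t x))

lemma ae_Icc_of_ae {T : ℝ} {p : ℝ → Prop} (h : ∀ t ∈ Icc 0 T, p t) :
    ∀ᵐ t ∂volume.restrict (Ioc 0 T), p t := by
  filter_upwards [ae_restrict_mem measurableSet_Ioc] with t ht using h t (Ioc_subset_Icc_self ht)

namespace IsRegular

variable {T : ℝ} {p : Path}

lemma mono (h : IsRegular T p) {τ : ℝ} (hτ : 0 ≤ τ) (hτT : τ ≤ T) : IsRegular τ p where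
  cont_ρ := h.cont_ρ
  cont_u := h.cont_u
  meas_ρx := h.meas_ρx
  meas_ux := h.meas_ux
  meas_uxx := h.meas_uxx
  ac_ρ t ht := h.ac_ρ t ⟨ht.1, ht.2.trans hτT⟩
  ac_u t ht := h.ac_u t ⟨ht.1, ht.2.trans hτT⟩
  bound := let ⟨C, hC⟩ := h.bound; ⟨C, fun t ht => hC t ⟨ht.1, ht.2.trans hτT⟩⟩
  zero_left t ht := h.zero_left t ⟨ht.1, ht.2.trans hτT⟩
  zero_right t ht := h.zero_right t ⟨ht.1, ht.2.trans hτT⟩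
  ac_ux := ae_mono (Measure.restrict_mono (Ioc_subset_Ioc_right hτT) le_rfl) h.ac_ux
  uxx_int := h.uxx_int.mono_set (by
    rw [uIcc_of_le hτ, uIcc_of_le (hτ.trans hτT)]; exact Icc_subset_Icc_right hτT)

/-- The velocity gradient has mean zero and is therefore controlled by the second derivative. -/
lemma abs_ux_le (h : IsRegular T p) : ∀ᵐ t ∂volume.restrict (Ioc 0 T),
    ∃ g, ACPair 1 g (p.uxx t) ∧ p.ux t =ᵐ[volume.restrict (Ioc (0 : ℝ) 1)] g ∧
      (∫ x in (0 : ℝ)..1, g x = 0) ∧ ∀ x ∈ Icc (0 : ℝ) 1, |g x| ≤ nrm (p.uxx t) := by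
  filter_upwards [h.ac_ux, ae_restrict_mem measurableSet_Ioc] with t ⟨h2, g, hg, hug⟩ ht
  have ht' := Ioc_subset_Icc_self ht
  have h0 : ∫ x in (0 : ℝ)..1, g x = 0 := by
    have e1 := (h.ac_u t ht').integral_eq zero_le_one
    rw [h.zero_left t ht', h.zero_right t ht', sub_zero] at e1
    refine Eq.trans (intervalIntegral.integral_congr_ae ?_) e1
    filter_upwards [(ae_restrict_iff' measurableSet_Ioc).1 hug] with x hx hx1
    rw [uIoc_of_le zero_le_one] at hx1
    exact (hx hx1).symm
  exact ⟨g, hg, hug, h0, fun x hx => hg.abs_le_of_integral_eq_zero h2 h0 hx⟩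

end IsRegular

lemma IsStripPath.mono {T : ℝ} {p : Path} (h : IsStripPath T p) {τ : ℝ} (hτ : 0 ≤ τ)
    (hτT : τ ≤ T) : IsStripPath τ p :=
  ⟨h.toIsRegular.mono hτ hτT, h.continuity.mono hτ hτT⟩

/-- The maximum principle for transport equations with velocity `u`. -/
lemma maximum_principle {T : ℝ} (hT : 0 ≤ T) {p : Path} (hp : IsRegular T p)
    {f g fx : ℝ → ℝ → ℝ} {c : ℝ → ℝ} (hf : Continuous fun z : ℝ × ℝ => f z.1 z.2)
    (hfg : TimeDeriv T f g)
    (hfx : ∀ᵐ t ∂volume.restrict (Ioc 0 T), ACPair 1 (f t) (fx t))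
    (hc : IntervalIntegrable c volume 0 T)
    (h : ∀ᵐ t ∂volume.restrict (Ioc 0 T), ∀ᵐ x ∂volume.restrict (Ioc (0 : ℝ) 1),
      0 < f t x → g t x + p.u t x * fx t x ≤ c t * f t x)
    (h0 : ∀ x ∈ Icc (0 : ℝ) 1, f 0 x ≤ 0) :
    ∀ t ∈ Icc 0 T, ∀ x ∈ Icc (0 : ℝ) 1, f t x ≤ 0 := by
  have h01 := zero_le_one (α := ℝ)
  have hcf : ∀ t, Continuous (f t) := fun t => hf.comp (by fun_prop : Continuous fun x => (t, x))
  -- The quantity that is tracked is ∫ (f⁺)²: it vanishes initially and will satisfy a linear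
  -- differential inequality.
  have hQ := hfg.comp_of_forall hT hf transport_posPart.hasDerivAt_posPart_sq (by fun_prop)
  have hY := hQ.integral hT (Continuous.intervalIntegrable (by have := hcf 0; fun_prop) _ _)
  have hYle : ∀ᵐ t ∂volume.restrict (Ioc 0 T),
      ∫ x in (0 : ℝ)..1, 2 * max (f t x) 0 * g t x
        ≤ (2 * c t + (1 + nrm (p.uxx t) ^ 2)) * ∫ x in (0 : ℝ)..1, max (f t x) 0 ^ 2 := by
    filter_upwards [hfx, h, hp.abs_ux_le, ae_restrict_mem measurableSet_Ioc,
      hQ.integrable.prod_right_ae] with t hft ht ⟨v, hv, huv, hv0, hvb⟩ htT hint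
    have ht' := Ioc_subset_Icc_self htT
    have tr := transport_posPart hft (hp.ac_u t ht') (hp.zero_left t ht') (hp.zero_right t ht')
    have i1 : IntervalIntegrable (fun x => 2 * max (f t x) 0 * g t x) volume 0 1 := by
      rw [intervalIntegrable_iff_integrableOn_Ioc_of_le h01]; exact hint
    have cp : Continuous fun x => max (f t x) 0 := (hcf t).max continuous_const
    have cu : Continuous (p.u t) := hp.cont_u.comp (by fun_prop : Continuous fun x => (t, x))
    have i2 : IntervalIntegrable (fun x => 2 * max (f t x) 0 * (p.u t x * fx t x)
        + max (f t x) 0 ^ 2 * p.ux t x) volume 0 1 := by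
      refine IntervalIntegrable.add ?_ ?_
      · refine (hft.integrable.continuousOn_mul
          (g := fun x => 2 * max (f t x) 0 * p.u t x) (by fun_prop)).congr fun x _ => ?_
        ring
      · exact (hp.ac_u t ht').integrable.continuousOn_mul (by fun_prop)
    have i3 : IntervalIntegrable (fun x => max (f t x) 0 ^ 2) volume 0 1 :=
      (cp.pow 2).intervalIntegrable _ _
    -- Adding the vanishing integral `tr` turns g into the material derivative g + u f_x, at the
    -- price of the term u_x (f⁺)².
    refine le_of_eq_of_le ((add_zero _).symm.trans (congrArg _ tr.symm)) ?_
    rw [← intervalIntegral.integral_add i1 i2, ← intervalIntegral.integral_const_mul]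
    refine intervalIntegral.integral_mono_ae_restrict h01 (i1.add i2) (i3.const_mul _) ?_
    rw [Measure.restrict_congr_set Ioc_ae_eq_Icc.symm]
    filter_upwards [ht, huv, ae_restrict_mem measurableSet_Ioc] with x hx hux hx1
    have b := (abs_le.1 (hvb x (Ioc_subset_Icc_self hx1))).2
    rw [← hux] at b
    -- Only the square of the norm of u_xx is known to be integrable in time, so the norm itself is
    -- replaced by one plus its square.
    have b2 : p.ux t x ≤ 1 + nrm (p.uxx t) ^ 2 := by nlinarith [sq_nonneg (nrm (p.uxx t) - 1)]
    rcases le_or_gt (f t x) 0 with hn | hpos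
    · simp [max_eq_right hn]
    · have h3 := hx hpos
      simp only [max_eq_left hpos.le]
      have h4 := mul_le_mul_of_nonneg_left h3 (show 0 ≤ 2 * f t x by positivity)
      have h5 := mul_le_mul_of_nonneg_left b2 (sq_nonneg (f t x))
      nlinarith
  intro t ht x hx
  have hG := hY.gronwall hT ((hc.const_mul 2).add
    ((intervalIntegrable_const (c := (1 : ℝ))).add hp.uxx_int)) hYle ht
  have hz : ∫ x in (0 : ℝ)..1, max (f 0 x) 0 ^ 2 = 0 := by
    rw [intervalIntegral.integral_congr (g := fun _ => 0)]
    · simp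
    · intro x hx
      rw [uIcc_of_le h01] at hx
      simp [max_eq_right (h0 x hx)]
  rw [hz, zero_mul] at hG
  by_contra! hpos
  have : 0 < ∫ x in (0 : ℝ)..1, max (f t x) 0 ^ 2 := by
    refine intervalIntegral.integral_pos one_pos ?_ (fun _ _ => sq_nonneg _) ⟨x, hx, ?_⟩
    · have := hcf t; fun_prop
    · rw [max_eq_left hpos.le]; positivity
  linarith

/-- The density stays positive. -/
lemma IsStripPath.exists_pos_le {T : ℝ} (hT : 0 ≤ T) {p : Path} (hp : IsStripPath T p)
    (h0 : ∀ x ∈ Icc (0 : ℝ) 1, 0 < p.ρ 0 x) :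
    ∃ m, 0 < m ∧ ∀ t ∈ Icc 0 T, ∀ x ∈ Icc (0 : ℝ) 1, m ≤ p.ρ t x := by
  have h01 := zero_le_one (α := ℝ)
  obtain ⟨x₀, hx₀, hmin⟩ := isCompact_Icc.exists_isMinOn (nonempty_Icc.2 h01)
    (hp.ac_ρ 0 ⟨le_rfl, hT⟩ |>.continuousOn h01)
  set k := p.ρ 0 x₀ with hk
  have hk0 : 0 < k := h0 x₀ hx₀
  set α : ℝ → ℝ := fun t => 1 + nrm (p.uxx t) ^ 2 with hα
  have hαi : IntervalIntegrable α volume 0 T :=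
    (intervalIntegrable_const (c := (1 : ℝ))).add hp.uxx_int
  -- the exponential is continuous after freezing time outside `[0,T]`
  have hE := (ACPair.primitive hαi).comp_of_forall hT Real.hasDerivAt_exp Real.continuous_exp
  set E : ℝ → ℝ := fun t => Real.exp (∫ s in (0 : ℝ)..max 0 (min t T), α s) with hEdef
  have hcl : ∀ t ∈ Icc 0 T, max 0 (min t T) = t := fun t ht => by
    rw [min_eq_left ht.2, max_eq_right ht.1]
  have hE' : ACPair T E (fun t => E t * α t) := by
    refine hE.congr hT (fun t ht => by simp only [hEdef, hcl t ht]) ?_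
    exact ae_Icc_of_ae fun t ht => by simp only [hEdef, hcl t ht]
  have hEc : Continuous E := by
    have : ContinuousOn E (Icc 0 T) := hE'.continuousOn hT
    have h2 : E = fun t => E (max 0 (min t T)) := by
      funext t
      have : max 0 (min t T) ∈ Icc 0 T := ⟨le_max_left _ _, max_le hT (min_le_right _ _)⟩
      simp only [hEdef, hcl _ this]
    rw [h2]
    exact this.comp_continuous (by fun_prop)
      fun t => ⟨le_max_left _ _, max_le hT (min_le_right _ _)⟩
  have hEpos : ∀ t, 0 < E t := fun t => Real.exp_pos _
  -- Along the flow the density decreases at relative rate at most |u_x| ≤ α. Hence E ρ with E = exp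
  -- ∫ α should not drop below the initial minimum k, and the maximum principle is applied to k − E
  -- ρ.
  have hTD := (TimeDeriv.of_acPair hT (ACPair.const (b := T) k)).sub hT
    (hp.continuity.mul hT (TimeDeriv.of_acPair hT hE') hp.cont_ρ (by fun_prop))
  have hρ := hp.cont_ρ
  have key := maximum_principle hT hp.toIsRegular (fx := fun t x => -(E t * p.ρx t x))
    (c := fun t => 2 * α t)
    (by fun_prop) hTD (ae_Icc_of_ae fun t ht => ?_) (hαi.const_mul 2) ?_ ?_
  · refine ⟨k / E T, div_pos hk0 (hEpos T), fun t ht x hx => ?_⟩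
    have h1 := key t ht x hx
    have h2 : E t ≤ E T := by
      simp only [hEdef, hcl t ht, hcl T ⟨hT, le_rfl⟩]
      gcongr
      refine intervalIntegral.integral_mono_interval le_rfl ht.1 ht.2
        (Eventually.of_forall fun s => by simp only [hα]; positivity) hαi
    rw [div_le_iff₀ (hEpos T)]
    have h3 : k ≤ p.ρ t x * E t := by linarith
    have h4 : 0 < p.ρ t x := by
      by_contra! hc
      nlinarith [hEpos t, mul_nonpos_of_nonpos_of_nonneg hc (hEpos t).le]
    exact h3.trans (by gcongr)
  · have := (ACPair.const (b := 1) k).sub h01 ((hp.ac_ρ t ht).const_mul h01 (E t))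
    refine this.congr h01 (fun x _ => by ring) (Eventually.of_forall fun x => by ring)
  · filter_upwards [hp.abs_ux_le] with t ⟨v, hv, huv, hv0, hvb⟩
    filter_upwards [huv, ae_restrict_mem measurableSet_Ioc] with x hux hx1 hpos
    have b := hvb x (Ioc_subset_Icc_self hx1)
    rw [← hux] at b
    have b2 : nrm (p.uxx t) ≤ α t := by
      simp only [hα]; nlinarith [sq_nonneg (nrm (p.uxx t) - 1)]
    have b3 := abs_le.1 (b.trans b2)
    have e1 : 0 - (-(p.ρx t x * p.u t x + p.ρ t x * p.ux t x) * E t + p.ρ t x * (E t * α t))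
        + p.u t x * -(E t * p.ρx t x) = p.ρ t x * E t * (p.ux t x - α t) := by ring
    rw [e1]
    set F := p.ρ t x * E t
    -- The sign of ρ is not yet known. For F ≥ 0 the left side is nonpositive. For F < 0 it is at
    -- most 2α|F|, which explains the factor 2 in the coefficient c.
    rcases le_or_gt 0 F with hF | hF
    · have : F * (p.ux t x - α t) ≤ 0 := mul_nonpos_of_nonneg_of_nonpos hF (by linarith)
      have h6 : 0 ≤ α t := by simp only [hα]; positivity
      have : 0 ≤ 2 * α t * (k - F) := by positivity
      linarith
    · nlinarith
  · intro x hx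
    have hE0 : E 0 = 1 := by simp [hEdef]
    have := hmin hx
    simp only [hE0, mul_one, sub_nonpos]
    exact this

/-- Conservation of mass. -/
lemma IsStripPath.mass {T : ℝ} (hT : 0 ≤ T) {p : Path} (hp : IsStripPath T p)
    (h0 : ∫ x in (0 : ℝ)..1, p.ρ 0 x = 1) : ∀ t ∈ Icc 0 T, ∫ x in (0 : ℝ)..1, p.ρ t x = 1 := by
  have h01 := zero_le_one (α := ℝ)
  have h := hp.continuity.integral hT (hp.ac_ρ 0 ⟨le_rfl, hT⟩).memL2.integrable'
  intro t ht
  rw [h.eq t ht, h0, add_eq_left]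
  rw [intervalIntegral.integral_congr (g := fun _ => 0) ]
  · simp
  · intro s hs
    rw [uIcc_of_le ht.1] at hs
    have hs' : s ∈ Icc 0 T := ⟨hs.1, hs.2.trans ht.2⟩
    have := ((hp.ac_ρ s hs').mul h01 (hp.ac_u s hs')).integral_eq h01
    rw [hp.zero_left s hs', hp.zero_right s hs'] at this
    simp only [intervalIntegral.integral_neg, this]
    simp

end

end CNSE

namespace CNSE

noncomputable section

/-! ### Pointwise bounds on the density through the effective viscous flux -/

/-- An absolutely continuous function on `[0,T]` extends to a continuous function. -/
lemma ACPair.exists_continuous {T : ℝ} (hT : 0 ≤ T) {φ φ' : ℝ → ℝ} (h : ACPair T φ φ') :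
    ∃ ψ, Continuous ψ ∧ (∀ t ∈ Icc 0 T, ψ t = φ t) ∧ ACPair T ψ φ' := by
  have hcl : ∀ t ∈ Icc 0 T, max 0 (min t T) = t := fun t ht => by
    rw [min_eq_left ht.2, max_eq_right ht.1]
  refine ⟨fun t => φ (max 0 (min t T)), ?_, fun t ht => by simp only [hcl t ht], ?_⟩
  · exact (h.continuousOn hT).comp_continuous (by fun_prop)
      fun t => ⟨le_max_left _ _, max_le hT (min_le_right _ _)⟩
  · exact h.congr hT (fun t ht => by simp only [hcl t ht]) (Eventually.of_forall fun _ => rfl)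

/-- The material derivative of the velocity without the noise. -/
def acc (A : ℝ) (p : Path) (t x : ℝ) : ℝ :=
  -(p.u t x * p.ux t x) - A ^ 2 * p.ρx t x / p.ρ t x + p.uxx t x / p.ρ t x

/-- The relative energy of two paths. -/
def relEnergy (p q : Path) (t : ℝ) : ℝ :=
  ∫ x in (0 : ℝ)..1,
    (1 / 2 * (p.ρ t x * (p.u t x - q.u t x) ^ 2) + 1 / 2 * (p.ρ t x - q.ρ t x) ^ 2)

/-- The time derivative q of the relative momentum r w is the x-derivative of −r v w − A² r + v_x
plus the remainder r ((A² R_x − U_xx)/R − w U_x). The mean kernel returns the bracket minus its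
mean. The means of v_x and of r are 0 and 1, that of r v w is bounded by energy and mass, and the
remainder contains derivatives of the reference solution only. No derivative of r or v is left in
the bound. -/
lemma flux_estimate {A m C : ℝ} (hm : 0 < m) {r r' v v' v'' R R' U U' U'' : ℝ → ℝ}
    (hr : ACPair 1 r r') (hv : ACPair 1 v v') (hv' : ACPair 1 v' v'')
    (hR : ACPair 1 R R') (hU : ACPair 1 U U') (hU' : ACPair 1 U' U'')
    (hR2 : MemL2 R') (hU2 : MemL2 U'') (hRC : nrm R' ≤ C)
    (hv0 : v 0 = 0) (hv1 : v 1 = 0) (hU0 : U 0 = 0) (hU1 : U 1 = 0)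
    (hr0 : ∀ x ∈ Icc (0 : ℝ) 1, 0 < r x) (hRm : ∀ x ∈ Icc (0 : ℝ) 1, m ≤ R x)
    (hRM : ∀ x ∈ Icc (0 : ℝ) 1, R x ≤ C) (hUC : ∀ x ∈ Icc (0 : ℝ) 1, |U x| ≤ C)
    (hmass : ∫ x in (0 : ℝ)..1, r x = 1)
    (hE : ∫ x in (0 : ℝ)..1, (1 / 2 * (r x * (v x - U x) ^ 2) + 1 / 2 * (r x - R x) ^ 2) ≤ 1)
    {q : ℝ → ℝ} (hq : q =ᵐ[volume.restrict (Ioc (0 : ℝ) 1)] fun y =>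
      -(r' y * v y + r y * v' y) * (v y - U y)
      + r y * ((-(v y * v' y) - A ^ 2 * r' y / r y + v'' y / r y)
        - (-(U y * U' y) - A ^ 2 * R' y / R y + U'' y / R y))) {x : ℝ} (hx : x ∈ Icc (0 : ℝ) 1) :
    |(∫ y in (0 : ℝ)..1, meanKernel x y * q y) + r x * v x * (v x - U x) + A ^ 2 * r x - v' x|
      ≤ 2 + 2 * C + A ^ 2 + (2 * C + 2) * ((A ^ 2 * C + nrm U'') / m) + 2 * nrm U'' := by
  have h01 := zero_le_one (α := ℝ)
  have h0m : (0 : ℝ) ∈ Icc (0 : ℝ) 1 := by simp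
  have hw := hv.sub h01 hU
  have hd := hr.sub h01 hR
  have hC : 0 ≤ C := (nrm_nonneg _).trans hRC
  have he : 0 ≤ nrm U'' := nrm_nonneg _
  have bU : ∀ x ∈ Icc (0 : ℝ) 1, |U' x| ≤ nrm U'' := fun x hx =>
    hU'.abs_le_of_integral_eq_zero hU2 (by rw [hU.integral_eq h01, hU0, hU1, sub_zero]) hx
  have cr := hr.continuousOn h01
  have cw := hw.continuousOn h01
  have cv := hv.continuousOn h01
  have cd := hd.continuousOn h01
  have cU' := hU'.continuousOn h01
  have cR := hR.continuousOn h01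
  have hne : ∀ x ∈ Icc (0 : ℝ) 1, R x ≠ 0 := fun x hx => (hm.trans_le (hRm x hx)).ne'
  rw [← uIcc_of_le h01] at cr cw cd cU' cR cv hne
  have i1 : IntervalIntegrable (fun x => r x * (v x - U x) ^ 2) volume 0 1 :=
    ContinuousOn.intervalIntegrable (by fun_prop)
  have i2 : IntervalIntegrable (fun x => (r x - R x) ^ 2) volume 0 1 :=
    ContinuousOn.intervalIntegrable (by fun_prop)
  have ir : IntervalIntegrable r volume 0 1 := cr.intervalIntegrable
  rw [intervalIntegral.integral_add (i1.const_mul _) (i2.const_mul _)] at hE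
  simp only [intervalIntegral.integral_const_mul] at hE
  have p1 : 0 ≤ ∫ x in (0 : ℝ)..1, r x * (v x - U x) ^ 2 :=
    intervalIntegral.integral_nonneg h01 fun x hx => mul_nonneg (hr0 x hx).le (sq_nonneg _)
  have p2 : 0 ≤ ∫ x in (0 : ℝ)..1, (r x - R x) ^ 2 :=
    intervalIntegral.integral_nonneg h01 fun x hx => sq_nonneg _
  have hS : ∫ x in (0 : ℝ)..1, r x * (v x - U x) ^ 2 ≤ 2 := by linarith
  -- The L² bound on r is not assumed: it follows from r = R + (r − R), since the relative energy
  -- controls the second part.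
  have hrn : nrm r ≤ 2 * C + 2 := by
    refine Real.sqrt_le_iff.2 ⟨by positivity, ?_⟩
    have i3 : IntervalIntegrable (fun x => r x ^ 2) volume 0 1 := hr.memL2.sq_integrable
    have : ∫ x in (0 : ℝ)..1, r x ^ 2
        ≤ ∫ x in (0 : ℝ)..1, (2 * C ^ 2 + 2 * (r x - R x) ^ 2) := by
      refine intervalIntegral.integral_mono_on h01 i3 (intervalIntegrable_const.add
        (i2.const_mul 2)) fun x hx => ?_
      have a1 := hRM x hx
      have a2 := hm.trans_le (hRm x hx)
      have a3 : R x ^ 2 ≤ C ^ 2 := by gcongr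
      nlinarith [sq_nonneg (r x - R x - R x)]
    rw [intervalIntegral.integral_add intervalIntegrable_const (i2.const_mul 2)] at this
    simp only [intervalIntegral.integral_const_mul, intervalIntegral.integral_const, sub_zero,
      one_smul] at this
    nlinarith
  -- the total derivative
  have hQ := (((hr.mul h01 hv).mul h01 hw).const_mul h01 (-1)).add h01
    ((hr.const_mul h01 (-A ^ 2)).add h01 hv')
  -- This is what is left of q after removal of the total derivative: the transport terms −r v v_x +
  -- r U U_x combine with the r v w_x of that derivative to −r w U_x.
  set h : ℝ → ℝ := fun y => r y * ((A ^ 2 * R' y - U'' y) / R y - (v y - U y) * U' y) with hh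
  have ih : IntervalIntegrable h volume 0 1 := by
    have j1 := ((hR2.integrable'.const_mul (A ^ 2)).sub hU2.integrable').continuousOn_mul
      (cr.div cR hne)
    have j2 : IntervalIntegrable (fun y => r y * ((v y - U y) * U' y)) volume 0 1 :=
      ContinuousOn.intervalIntegrable (by fun_prop)
    refine (j1.sub j2).congr fun y _ => ?_
    simp only [hh, Pi.div_apply]
    ring
  have e1 : ∫ y in (0 : ℝ)..1, meanKernel x y * q y
      = (∫ y in (0 : ℝ)..1, meanKernel x y * (-1 * ((r' y * v y + r y * v' y) * (v y - U y)
          + r y * v y * (v' y - U' y)) + (-A ^ 2 * r' y + v'' y)))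
        + ∫ y in (0 : ℝ)..1, meanKernel x y * h y := by
    have hk : ∀ {g : ℝ → ℝ}, IntervalIntegrable g volume 0 1 →
        IntervalIntegrable (fun y => meanKernel x y * g y) volume 0 1 := by
      intro g hg
      rw [intervalIntegrable_iff_integrableOn_Ioc_of_le h01] at hg ⊢
      exact hg.bdd_mul (c := 1) (measurable_meanKernel x).aestronglyMeasurable
        (Eventually.of_forall fun y => abs_meanKernel_le x y)
    rw [← intervalIntegral.integral_add (hk hQ.integrable) (hk ih)]
    refine intervalIntegral.integral_congr_ae ?_
    filter_upwards [(ae_restrict_iff' measurableSet_Ioc).1 hq] with y hy hy1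
    rw [uIoc_of_le h01] at hy1
    rw [hy hy1, ← mul_add]
    have a1 := (hr0 y (Ioc_subset_Icc_self hy1)).ne'
    have a2 := (hm.trans_le (hRm y (Ioc_subset_Icc_self hy1))).ne'
    congr 1
    simp only [hh]
    field_simp
    ring
  have irv : IntervalIntegrable (fun y => r y * v y * (v y - U y)) volume 0 1 :=
    ContinuousOn.intervalIntegrable (by fun_prop)
  have e2 := integral_meanKernel_deriv hQ hx
  have e3 : ∫ y in (0 : ℝ)..1, (-1 * (r y * v y * (v y - U y)) + (-A ^ 2 * r y + v' y))
      = -(∫ y in (0 : ℝ)..1, r y * v y * (v y - U y)) - A ^ 2 := by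
    rw [intervalIntegral.integral_add (irv.const_mul _)
        ((ir.const_mul _).add hv'.memL2.integrable'),
      intervalIntegral.integral_add (ir.const_mul _) hv'.memL2.integrable',
      hv.integral_eq h01, hv0, hv1]
    simp only [intervalIntegral.integral_const_mul, hmass]
    ring
  rw [e1, e2, e3]
  -- Writing v w = w² + U w and using |w| ≤ ½ (1 + w²), the integral is bounded by the kinetic part
  -- of the relative energy and the mass.
  have b1 : |∫ y in (0 : ℝ)..1, r y * v y * (v y - U y)| ≤ 2 + 2 * C := by
    have hb : IntervalIntegrable (fun y => (1 + C / 2) * (r y * (v y - U y) ^ 2) + C / 2 * r y)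
      volume 0 1 := (i1.const_mul _).add (ir.const_mul _)
    have := intervalIntegral.norm_integral_le_of_norm_le h01
      (f := fun y => r y * v y * (v y - U y)) (Eventually.of_forall fun y hy => ?_) hb
    · rw [intervalIntegral.integral_add (i1.const_mul _) (ir.const_mul _)] at this
      simp only [intervalIntegral.integral_const_mul, hmass, Real.norm_eq_abs] at this
      nlinarith
    · have hy' := Ioc_subset_Icc_self hy
      have a1 := hr0 y hy'
      have a2 := hUC y hy'
      rw [Real.norm_eq_abs, show r y * v y * (v y - U y)
        = r y * ((v y - U y) ^ 2 + U y * (v y - U y)) by ring, abs_mul, abs_of_pos a1]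
      have a3 : |(v y - U y) ^ 2 + U y * (v y - U y)|
          ≤ (v y - U y) ^ 2 + C * ((1 + (v y - U y) ^ 2) / 2) := by
        refine (abs_add_le _ _).trans ?_
        rw [abs_of_nonneg (sq_nonneg _), abs_mul]
        gcongr
        rw [← sq_abs (v y - U y)]
        nlinarith [sq_nonneg (|v y - U y| - 1)]
      nlinarith [mul_le_mul_of_nonneg_left a3 a1.le]
  have b2 : |∫ y in (0 : ℝ)..1, meanKernel x y * h y|
      ≤ (2 * C + 2) * ((A ^ 2 * C + nrm U'') / m) + 2 * nrm U'' := by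
    have c1 := integral_abs_mul_abs_le hr.memL2 hR2
    have c2 := integral_abs_mul_abs_le hr.memL2 hU2
    have k1 := (hr.memL2.fun_abs).mul_integrable hR2.fun_abs
    have k2 := (hr.memL2.fun_abs).mul_integrable hU2.fun_abs
    have hb := ((k1.const_mul (A ^ 2 / m)).add (k2.const_mul (1 / m))).add
      ((ir.add i1).const_mul (nrm U'' / 2))
    have := intervalIntegral.norm_integral_le_of_norm_le h01
      (f := fun y => meanKernel x y * h y) (Eventually.of_forall fun y hy => ?_) hb
    · rw [intervalIntegral.integral_add ((k1.const_mul _).add (k2.const_mul _))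
        ((ir.add i1).const_mul _), intervalIntegral.integral_add (k1.const_mul _) (k2.const_mul _),
        intervalIntegral.integral_const_mul, intervalIntegral.integral_const_mul,
        intervalIntegral.integral_const_mul, intervalIntegral.integral_add ir i1, hmass,
        Real.norm_eq_abs] at this
      have d1 : A ^ 2 / m * (∫ y in (0 : ℝ)..1, |r y| * |R' y|)
          ≤ A ^ 2 / m * ((2 * C + 2) * C) := by
        gcongr
        exact c1.trans (by gcongr; exact nrm_nonneg _)
      have d2 : 1 / m * (∫ y in (0 : ℝ)..1, |r y| * |U'' y|)
          ≤ 1 / m * ((2 * C + 2) * nrm U'') := by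
        gcongr
        exact c2.trans (by gcongr)
      have d3 : nrm U'' / 2 * (1 + ∫ y in (0 : ℝ)..1, r y * (v y - U y) ^ 2)
          ≤ nrm U'' / 2 * (1 + 2) := by gcongr
      have d4 : (2 * C + 2) * ((A ^ 2 * C + nrm U'') / m)
        = A ^ 2 / m * ((2 * C + 2) * C) + 1 / m * ((2 * C + 2) * nrm U'') := by ring
      linarith
    · have hy' := Ioc_subset_Icc_self hy
      have a1 := hr0 y hy'
      have a2 := hm.trans_le (hRm y hy')
      have g1 : |(A ^ 2 * R' y - U'' y) / R y| ≤ (A ^ 2 * |R' y| + |U'' y|) / m := by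
        rw [abs_div, abs_of_pos a2]
        gcongr
        · refine (abs_sub _ _).trans_eq ?_
          rw [abs_mul, abs_of_nonneg (sq_nonneg A)]
        · exact hRm y hy'
      have g2 : |(v y - U y) * U' y| ≤ (1 + (v y - U y) ^ 2) / 2 * nrm U'' := by
        rw [abs_mul]
        gcongr
        · rw [← sq_abs (v y - U y)]
          nlinarith [sq_nonneg (|v y - U y| - 1)]
        · exact bU y hy'
      rw [Real.norm_eq_abs, abs_mul]
      calc |meanKernel x y| * |h y| ≤ 1 * |h y| := by gcongr; exact abs_meanKernel_le x y
        _ ≤ r y * ((A ^ 2 * |R' y| + |U'' y|) / m + (1 + (v y - U y) ^ 2) / 2 * nrm U'') := by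
          rw [one_mul, hh, abs_mul, abs_of_pos a1]
          gcongr
          exact (abs_sub _ _).trans (add_le_add g1 g2)
        _ = _ := by rw [abs_of_pos a1]; ring
  rw [show -1 * (r x * v x * (v x - U x)) + (-A ^ 2 * r x + v' x)
    - (-(∫ y in (0 : ℝ)..1, r y * v y * (v y - U y)) - A ^ 2)
    + (∫ y in (0 : ℝ)..1, meanKernel x y * h y) + r x * v x * (v x - U x) + A ^ 2 * r x - v' x
    = (∫ y in (0 : ℝ)..1, r y * v y * (v y - U y)) + A ^ 2
      + ∫ y in (0 : ℝ)..1, meanKernel x y * h y by ring]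
  refine (abs_add_le _ _).trans ?_
  have := abs_add_le (∫ y in (0 : ℝ)..1, r y * v y * (v y - U y)) (A ^ 2)
  rw [abs_of_nonneg (sq_nonneg A)] at this
  linarith

/-- At almost every time the velocity gradient may be replaced by its continuous version. -/
lemma IsRegular.ae_version {T : ℝ} {p : Path} (hp : IsRegular T p) :
    ∀ᵐ t ∂volume.restrict (Ioc 0 T), MemL2 (p.uxx t) ∧ ∃ g, ACPair 1 (p.u t) g ∧
      ACPair 1 g (p.uxx t) ∧ p.ux t =ᵐ[volume.restrict (Ioc (0 : ℝ) 1)] g := by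
  filter_upwards [hp.ac_ux, ae_restrict_mem measurableSet_Ioc] with t ⟨h2, g, hg, hug⟩ ht
  exact ⟨h2, g, (hp.ac_u t (Ioc_subset_Icc_self ht)).congr zero_le_one (fun _ _ => rfl) hug, hg, hug⟩

/-- The growth rate in the stability estimate. -/
def growthRate (A m M C : ℝ) (q : Path) (t : ℝ) : ℝ :=
  3 * (1 + nrm (q.uxx t) ^ 2)
    + ((A ^ 2 + A ^ 2 * C / m + M / 2 + C + C) ^ 2 + nrm (q.uxx t) ^ 2 / m ^ 2)

lemma intervalIntegrable_growthRate {T A m M C : ℝ} {q : Path} (hq : IsRegular T q) :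
    IntervalIntegrable (growthRate A m M C q) volume 0 T :=
  ((intervalIntegrable_const.add hq.uxx_int).const_mul 3).add
    (intervalIntegrable_const.add (hq.uxx_int.div_const _))

/-- Uniform bounds for the reference solution. -/
structure IsBounded (T m C : ℝ) (q : Path) : Prop where
  pos : 0 < m
  le : ∀ t ∈ Icc 0 T, ∀ x ∈ Icc (0 : ℝ) 1, m ≤ q.ρ t x
  ρ_le : ∀ t ∈ Icc 0 T, ∀ x ∈ Icc (0 : ℝ) 1, q.ρ t x ≤ C
  u_le : ∀ t ∈ Icc 0 T, ∀ x ∈ Icc (0 : ℝ) 1, |q.u t x| ≤ C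
  memL2 : ∀ t ∈ Icc 0 T, MemL2 (q.ρx t)
  ρx_le : ∀ t ∈ Icc 0 T, nrm (q.ρx t) ≤ C

lemma IsBounded.mono {T m C : ℝ} {q : Path} (h : IsBounded T m C q) {τ : ℝ} (hτT : τ ≤ T) :
    IsBounded τ m C q where
  pos := h.pos
  le t ht := h.le t ⟨ht.1, ht.2.trans hτT⟩
  ρ_le t ht := h.ρ_le t ⟨ht.1, ht.2.trans hτT⟩
  u_le t ht := h.u_le t ⟨ht.1, ht.2.trans hτT⟩
  memL2 t ht := h.memL2 t ⟨ht.1, ht.2.trans hτT⟩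
  ρx_le t ht := h.ρx_le t ⟨ht.1, ht.2.trans hτT⟩

/-- Two paths driven by the same noise. -/
def SameNoise (T A : ℝ) (p q : Path) : Prop :=
  TimeDeriv T (fun t x => p.u t x - q.u t x) (fun t x => acc A p t x - acc A q t x)

/-- Neither velocity is differentiable in time by itself. The relative energy contains them only
through their difference, which is, by `SameNoise`. -/
lemma relEnergy_acPair {T A : ℝ} (hT : 0 ≤ T) {p q : Path} (hp : IsStripPath T p)
    (hq : IsStripPath T q) (hpq : SameNoise T A p q) :
    ACPair T (relEnergy p q) (fun t => ∫ x in (0 : ℝ)..1,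
      (1 / 2 * (-(p.ρx t x * p.u t x + p.ρ t x * p.ux t x) * ((p.u t x - q.u t x) ^ 2)
        + p.ρ t x * (2 * (p.u t x - q.u t x) * (acc A p t x - acc A q t x)))
      + 1 / 2 * (2 * (p.ρ t x - q.ρ t x) * (-(p.ρx t x * p.u t x + p.ρ t x * p.ux t x)
        - -(q.ρx t x * q.u t x + q.ρ t x * q.ux t x))))) := by
  have c1 := hp.cont_ρ
  have c2 := hp.cont_u
  have c3 := hq.cont_ρ
  have c4 := hq.cont_u
  have hs : ∀ y : ℝ, HasDerivAt (fun y : ℝ => y ^ 2) (2 * y) y := fun y => by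
    simpa using hasDerivAt_pow 2 y
  have H1 := (hp.continuity.mul hT (hpq.comp_of_forall hT (by fun_prop) hs (by fun_prop))
    c1 (by fun_prop)).const_mul hT (1 / 2)
  have H2 := ((hp.continuity.sub hT hq.continuity).comp_of_forall hT (by fun_prop) hs
    (by fun_prop)).const_mul hT (1 / 2)
  have h1 : Continuous (p.ρ 0) := c1.comp (by fun_prop : Continuous fun x => ((0 : ℝ), x))
  have h2 : Continuous (p.u 0) := c2.comp (by fun_prop : Continuous fun x => ((0 : ℝ), x))
  have h3 : Continuous (q.ρ 0) := c3.comp (by fun_prop : Continuous fun x => ((0 : ℝ), x))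
  have h4 : Continuous (q.u 0) := c4.comp (by fun_prop : Continuous fun x => ((0 : ℝ), x))
  exact (H1.add hT H2).integral hT (Continuous.intervalIntegrable (by fun_prop) _ _)

/-- Stability of solutions as long as the densities stay within distance `M`. -/
lemma relEnergy_le {T A m M C : ℝ} (hT : 0 ≤ T) {p q : Path} (hp : IsStripPath T p)
    (hq : IsStripPath T q) (hpos : ∀ t ∈ Icc 0 T, ∀ x ∈ Icc (0 : ℝ) 1, 0 < p.ρ t x)
    (hb : IsBounded T m C q) (hpq : SameNoise T A p q)
    (hM : ∀ t ∈ Icc 0 T, ∀ x ∈ Icc (0 : ℝ) 1, |p.ρ t x - q.ρ t x| ≤ M) :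
    ∀ t ∈ Icc 0 T, relEnergy p q t
      ≤ relEnergy p q 0 * Real.exp (∫ s in (0 : ℝ)..t, growthRate A m M C q s) := by
  intro t ht
  refine (relEnergy_acPair hT hp hq hpq).gronwall hT (intervalIntegrable_growthRate hq.toIsRegular)
    ?_ ht
  filter_upwards [hp.ae_version, hq.ae_version, ae_restrict_mem measurableSet_Ioc]
    with t ⟨_, v', hv, hv', hpv⟩ ⟨hU2, U', hU, hU', hqU⟩ ht
  have ht' := Ioc_subset_Icc_self ht
  have h0 : 0 ≤ relEnergy p q t := intervalIntegral.integral_nonneg zero_le_one fun x hx => by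
    have := (hpos t ht' x hx).le
    positivity
  have key := stability_estimate (A := A) hb.pos (hp.ac_ρ t ht') hv hv' (hq.ac_ρ t ht') hU hU'
    (hb.memL2 t ht') hU2 (hb.ρx_le t ht') (hp.zero_left t ht') (hp.zero_right t ht')
    (hq.zero_left t ht') (hq.zero_right t ht') (fun x hx => (hpos t ht' x hx).le) (hb.le t ht')
    (hb.ρ_le t ht') (hM t ht')
  refine le_trans (le_of_eq ?_) (key.trans (mul_le_mul_of_nonneg_right ?_ h0))
  · refine intervalIntegral.integral_congr_ae ?_
    filter_upwards [(ae_restrict_iff' measurableSet_Ioc).1 hpv,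
      (ae_restrict_iff' measurableSet_Ioc).1 hqU] with x h1 h2 hx
    rw [uIoc_of_le zero_le_one] at hx
    have a1 := (hpos t ht' x (Ioc_subset_Icc_self hx)).ne'
    have a2 := (hb.pos.trans_le (hb.le t ht' x (Ioc_subset_Icc_self hx))).ne'
    simp only [acc, h1 hx, h2 hx]
    field_simp
    ring
  · simp only [growthRate]
    -- The rate given by the fixed-time estimate is quadratic in the norm of U_xx. It is rearranged
    -- so that only the square of that norm, which is integrable in time, appears.
    have e1 : nrm (q.uxx t) ≤ 1 + nrm (q.uxx t) ^ 2 := by nlinarith [sq_nonneg (nrm (q.uxx t) - 1)]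
    have e2 : ∀ a b : ℝ, 1 / 2 * (a + b) ^ 2 ≤ a ^ 2 + b ^ 2 := fun a b => by
      nlinarith [sq_nonneg (a - b)]
    have := e2 (A ^ 2 + A ^ 2 * C / m + M / 2 + C + C) (nrm (q.uxx t) / m)
    rw [div_pow] at this
    linarith

end

end CNSE

/-! ### Two-sided bounds on the density and the continuity argument in time. -/

namespace CNSE

noncomputable section

/-- The bound on the effective viscous flux. -/
def fluxBound (A m C : ℝ) (q : Path) (t : ℝ) : ℝ :=
  2 + 2 * C + A ^ 2 + (2 * C + 2) * ((A ^ 2 * C + (1 + nrm (q.uxx t) ^ 2)) / m)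
    + 2 * (1 + nrm (q.uxx t) ^ 2)

lemma intervalIntegrable_fluxBound {T A m C : ℝ} {q : Path} (hq : IsRegular T q) :
    IntervalIntegrable (fluxBound A m C q) volume 0 T := by
  have h := (intervalIntegrable_const (c := (1 : ℝ))).add hq.uxx_int
  exact (intervalIntegrable_const.add
    (((intervalIntegrable_const.add h).div_const m).const_mul _)).add (h.const_mul 2)

lemma fluxBound_nonneg {A m C : ℝ} (hm : 0 < m) (hC : 0 ≤ C) (q : Path) (t : ℝ) :
    0 ≤ fluxBound A m C q t := by
  unfold fluxBound; positivity

lemma IsBounded.nonneg {T m C : ℝ} (hT : 0 ≤ T) {q : Path} (h : IsBounded T m C q) : 0 ≤ C :=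
  (nrm_nonneg _).trans (h.ρx_le 0 ⟨le_rfl, hT⟩)

lemma measurable_momentum_rate {A : ℝ} {T : ℝ} {p q : Path} (hp : IsRegular T p)
    (hq : IsRegular T q) : Measurable fun z : ℝ × ℝ =>
      -(p.ρx z.1 z.2 * p.u z.1 z.2 + p.ρ z.1 z.2 * p.ux z.1 z.2) * (p.u z.1 z.2 - q.u z.1 z.2)
        + p.ρ z.1 z.2 * (acc A p z.1 z.2 - acc A q z.1 z.2) := by
  have a1 := hp.cont_ρ.measurable
  have a2 := hp.cont_u.measurable
  have a3 := hq.cont_ρ.measurable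
  have a4 := hq.cont_u.measurable
  have b1 := hp.meas_ρx
  have b2 := hp.meas_ux
  have b3 := hp.meas_uxx
  have c1 := hq.meas_ρx
  have c2 := hq.meas_ux
  have c3 := hq.meas_uxx
  unfold acc
  fun_prop

/-- Time derivative of an integral against the mean kernel. -/
lemma TimeDeriv.meanKernel {T : ℝ} (hT : 0 ≤ T) {P Q : ℝ → ℝ → ℝ} (H : TimeDeriv T P Q)
    (hP : Continuous (P 0)) (hQ : Measurable fun z : ℝ × ℝ => Q z.1 z.2) :
    TimeDeriv T (fun t x => ∫ y in (0 : ℝ)..1, meanKernel x y * P t y)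
      (fun t x => ∫ y in (0 : ℝ)..1, meanKernel x y * Q t y) := by
  have h01 := zero_le_one (α := ℝ)
  refine ⟨?_, Eventually.of_forall fun x => H.integral_kernel hT (hP.intervalIntegrable _ _)
    (measurable_meanKernel x) (abs_meanKernel_le x)⟩
  have hk : Measurable fun z : (ℝ × ℝ) × ℝ => CNSE.meanKernel z.1.2 z.2 * Q z.1.1 z.2 := by
    refine Measurable.mul ?_ (hQ.comp (by fun_prop : Measurable fun z : (ℝ × ℝ) × ℝ => (z.1.1, z.2)))
    have e : (fun z : (ℝ × ℝ) × ℝ => CNSE.meanKernel z.1.2 z.2)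
        = fun z => ({z : (ℝ × ℝ) × ℝ | z.2 ≤ z.1.2}).indicator (fun _ => (1 : ℝ)) z
          - max 0 (min (1 - z.2) 1) := by
      funext z
      simp only [CNSE.meanKernel, indicator, mem_Iic, mem_ofPred_eq]
    rw [e]
    exact (measurable_const.indicator (measurableSet_le (by fun_prop) (by fun_prop))).sub
      (by fun_prop)
  have hm : AEStronglyMeasurable
      (fun z : ℝ × ℝ => ∫ y in (0 : ℝ)..1, CNSE.meanKernel z.2 y * Q z.1 y) (stripVol T) := by
    simp only [intervalIntegral.integral_of_le h01]
    exact (hk.stronglyMeasurable.integral_prod_right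
      (ν := volume.restrict (Ioc (0 : ℝ) 1))).aestronglyMeasurable
  have hd : Integrable (fun z : ℝ × ℝ => ∫ y in (0 : ℝ)..1, ‖Q z.1 y‖) (stripVol T) := by
    simp only [intervalIntegral.integral_of_le h01]
    exact (H.integrable.integral_norm_prod_left).comp_fst _
  refine hd.mono' hm ?_
  have hi : ∀ᵐ z ∂stripVol T, Integrable (fun y => Q z.1 y) (volume.restrict (Ioc (0 : ℝ) 1)) :=
    Measure.quasiMeasurePreserving_fst.ae H.integrable.prod_right_ae
  filter_upwards [hi] with z hz
  refine intervalIntegral.norm_integral_le_of_norm_le h01 (Eventually.of_forall fun y _ => ?_) ?_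
  · rw [norm_mul]
    exact (mul_le_of_le_one_left (norm_nonneg _) (abs_meanKernel_le _ _))
  · rw [intervalIntegrable_iff_integrableOn_Ioc_of_le h01]
    exact hz.norm

lemma TimeDeriv.congr_left {T : ℝ} (hT : 0 ≤ T) {f g h : ℝ → ℝ → ℝ} (H : TimeDeriv T f g)
    (hf : ∀ t ∈ Icc 0 T, ∀ x ∈ Icc (0 : ℝ) 1, f t x = h t x) : TimeDeriv T h g :=
  H.congr hT hf (Eventually.of_forall fun _ => rfl)

variable {T A m C K : ℝ} {p q : Path}

/-- The potential of the relative momentum. -/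
lemma exists_momentum_potential (hT : 0 ≤ T) (hp : IsStripPath T p) (hq : IsStripPath T q)
    (hpos : ∀ t x, 0 < p.ρ t x) (hb : IsBounded T m C q) (hpq : SameNoise T A p q)
    (hmass : ∀ t ∈ Icc 0 T, ∫ x in (0 : ℝ)..1, p.ρ t x = 1)
    (hE : ∀ t ∈ Icc 0 T, relEnergy p q t ≤ 1) :
    ∃ Ψ γ : ℝ → ℝ → ℝ, (Continuous fun z : ℝ × ℝ => Ψ z.1 z.2) ∧ TimeDeriv T Ψ γ ∧
      (∀ t ∈ Icc 0 T, ACPair 1 (Ψ t) (fun x => p.ρ t x * (p.u t x - q.u t x))) ∧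
      (∀ t ∈ Icc 0 T, ∀ x ∈ Icc (0 : ℝ) 1, |Ψ t x| ≤ 2) ∧
      ∀ᵐ t ∂volume.restrict (Ioc 0 T), ∀ᵐ x ∂volume.restrict (Ioc (0 : ℝ) 1),
        |γ t x + p.ρ t x * p.u t x * (p.u t x - q.u t x) + A ^ 2 * p.ρ t x - p.ux t x|
          ≤ fluxBound A m C q t := by
  have h01 := zero_le_one (α := ℝ)
  have c1 := hp.cont_ρ
  have c2 := hp.cont_u
  have c3 := hq.cont_u
  set P : ℝ → ℝ → ℝ := fun t x => p.ρ t x * (p.u t x - q.u t x) with hP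
  have cP : Continuous fun z : ℝ × ℝ => P z.1 z.2 := by simp only [hP]; fun_prop
  have cPt : ∀ t, Continuous (P t) := fun t => cP.comp (by fun_prop : Continuous fun x => (t, x))
  -- Ψ is the mean kernel applied to the relative momentum. This explicit form shows its joint
  -- continuity and its x-derivative, whereas the kernel form gives its time derivative.
  set Ψ : ℝ → ℝ → ℝ := fun t x => (∫ y in (0 : ℝ)..x, P t y) - ∫ y in (0 : ℝ)..1, (1 - y) * P t y
    with hΨ
  have hΨk : ∀ t, ∀ x ∈ Icc (0 : ℝ) 1, ∫ y in (0 : ℝ)..1, meanKernel x y * P t y = Ψ t x :=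
    fun t x hx => integral_meanKernel_mul ((cPt t).intervalIntegrable _ _) hx
  have hTD := hp.continuity.mul hT hpq c1 (by fun_prop)
  refine ⟨Ψ, _, ?_, (hTD.meanKernel hT (cPt 0) (measurable_momentum_rate hp.toIsRegular
    hq.toIsRegular)).congr_left hT (fun t _ x hx => hΨk t x hx),
    fun t ht => ?_, fun t ht x hx => ?_, ?_⟩
  · refine Continuous.sub ?_ ?_
    · exact intervalIntegral.continuous_parametric_intervalIntegral_of_continuous
        (f := fun (z : ℝ × ℝ) y => P z.1 y)
        (cP.comp (by fun_prop : Continuous fun w : (ℝ × ℝ) × ℝ => (w.1.1, w.2))) continuous_snd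
    · exact intervalIntegral.continuous_parametric_intervalIntegral_of_continuous
        (f := fun (z : ℝ × ℝ) y => (1 - y) * P z.1 y)
        (((by fun_prop : Continuous fun w : (ℝ × ℝ) × ℝ => 1 - w.2)).mul
          (cP.comp (by fun_prop : Continuous fun w : (ℝ × ℝ) × ℝ => (w.1.1, w.2))))
        continuous_const
  · have := (ACPair.primitive ((cPt t).intervalIntegrable 0 1)).sub h01
      (ACPair.const (∫ y in (0 : ℝ)..1, (1 - y) * P t y))
    exact this.congr h01 (fun _ _ => rfl) (Eventually.of_forall fun _ => by simp [hP])
  · rw [← hΨk t x hx]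
    have cr : Continuous (p.ρ t) := c1.comp (by fun_prop : Continuous fun x => (t, x))
    have cv : Continuous (p.u t) := c2.comp (by fun_prop : Continuous fun x => (t, x))
    have cU : Continuous (q.u t) := c3.comp (by fun_prop : Continuous fun x => (t, x))
    have cR : Continuous (q.ρ t) := hq.cont_ρ.comp (by fun_prop : Continuous fun x => (t, x))
    have i1 : IntervalIntegrable (fun y => (1 / 2) * p.ρ t y) volume 0 1 :=
      Continuous.intervalIntegrable (by fun_prop) _ _
    have i2 : IntervalIntegrable (fun x => 1 / 2 * (p.ρ t x * (p.u t x - q.u t x) ^ 2)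
        + 1 / 2 * (p.ρ t x - q.ρ t x) ^ 2) volume 0 1 :=
      Continuous.intervalIntegrable (by fun_prop) _ _
    have := intervalIntegral.norm_integral_le_of_norm_le h01
      (f := fun y => meanKernel x y * P t y) (Eventually.of_forall fun y _ => ?_) (i1.add i2)
    · rw [intervalIntegral.integral_add i1 i2, intervalIntegral.integral_const_mul, hmass t ht]
        at this
      have h2 := hE t ht
      rw [relEnergy] at h2
      rw [← Real.norm_eq_abs]
      linarith
    · rw [norm_mul]
      refine (mul_le_of_le_one_left (norm_nonneg _) (abs_meanKernel_le _ _)).trans ?_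
      simp only [hP, Real.norm_eq_abs, abs_mul, abs_of_pos (hpos t y)]
      -- From ρ|w| ≤ ½ ρ + ½ ρ w², the potential is at most half the mass plus the relative energy,
      -- that is 3/2, which lies below the stated 2.
      have e : |p.u t y - q.u t y| ≤ 1 / 2 + 1 / 2 * (p.u t y - q.u t y) ^ 2 := by
        rw [← sq_abs (p.u t y - q.u t y)]
        nlinarith [sq_nonneg (|p.u t y - q.u t y| - 1)]
      nlinarith [mul_le_mul_of_nonneg_left e (hpos t y).le, sq_nonneg (p.ρ t y - q.ρ t y)]
  · filter_upwards [hp.ae_version, hq.ae_version, ae_restrict_mem measurableSet_Ioc]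
      with t ⟨_, v', hv, hv', hpv⟩ ⟨hU2, U', hU, hU', hqU⟩ ht
    have ht' := Ioc_subset_Icc_self ht
    filter_upwards [hpv, ae_restrict_mem measurableSet_Ioc] with x hxv hx
    have key := flux_estimate (A := A) hb.pos (hp.ac_ρ t ht') hv hv' (hq.ac_ρ t ht') hU hU'
      (hb.memL2 t ht') hU2 (hb.ρx_le t ht') (hp.zero_left t ht') (hp.zero_right t ht')
      (hq.zero_left t ht') (hq.zero_right t ht') (fun x _ => hpos t x) (hb.le t ht')
      (hb.ρ_le t ht') (hb.u_le t ht') (hmass t ht') (hE t ht')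
      (q := fun y => -(p.ρx t y * p.u t y + p.ρ t y * p.ux t y) * (p.u t y - q.u t y)
        + p.ρ t y * (acc A p t y - acc A q t y)) ?_ (Ioc_subset_Icc_self hx)
    · rw [← hxv] at key
      refine key.trans ?_
      have e1 : nrm (q.uxx t) ≤ 1 + nrm (q.uxx t) ^ 2 := by
        nlinarith [sq_nonneg (nrm (q.uxx t) - 1)]
      have := hb.pos
      have := hb.nonneg hT
      unfold fluxBound
      gcongr
    · filter_upwards [hpv, hqU] with y h1 h2
      simp only [acc, h1, h2]

/-- As long as the relative energy is at most one, the density is bounded from above and below in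
terms of the reference solution and of the initial density. -/
lemma log_density_le (hT : 0 ≤ T) (hp : IsStripPath T p) (hq : IsStripPath T q)
    (hpos : ∀ t x, 0 < p.ρ t x) (hb : IsBounded T m C q) (hpq : SameNoise T A p q)
    (hmass : ∀ t ∈ Icc 0 T, ∫ x in (0 : ℝ)..1, p.ρ t x = 1)
    (hE : ∀ t ∈ Icc 0 T, relEnergy p q t ≤ 1)
    (hK : ∀ x ∈ Icc (0 : ℝ) 1, |Real.log (p.ρ 0 x)| ≤ K) :
    (∀ t ∈ Icc 0 T, ∀ x ∈ Icc (0 : ℝ) 1,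
      Real.log (p.ρ t x) ≤ K + 4 + ∫ s in (0 : ℝ)..t, fluxBound A m C q s) ∧
    ∀ M, (∀ t ∈ Icc 0 T, ∀ x ∈ Icc (0 : ℝ) 1, p.ρ t x ≤ M) → ∀ t ∈ Icc 0 T,
      ∀ x ∈ Icc (0 : ℝ) 1,
      -Real.log (p.ρ t x) ≤ K + 4 + ∫ s in (0 : ℝ)..t, (fluxBound A m C q s + A ^ 2 * M) := by
  have h01 := zero_le_one (α := ℝ)
  obtain ⟨Ψ, γ, cΨ, hΨ, hΨx, hΨb, hγ⟩ := exists_momentum_potential hT hp hq hpos hb hpq hmass hE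
  have c1 := hp.cont_ρ
  obtain ⟨B, -, hB⟩ := exists_bound_strip (f := fun t x => Real.log (p.ρ t x)) (c1.log fun z => (hpos z.1 z.2).ne') T
  have hmem : ∀ t ∈ Icc 0 T, ∀ x ∈ Icc (0 : ℝ) 1,
      p.ρ t x ∈ Icc (Real.exp (-B)) (Real.exp B) := fun t ht x hx => by
    have := abs_le.1 (hB t ht x hx)
    rw [← Real.exp_log (hpos t x)]
    exact ⟨Real.exp_le_exp.2 this.1, Real.exp_le_exp.2 this.2⟩
  have hlog : ∀ y ∈ Icc (Real.exp (-B)) (Real.exp B), HasDerivAt Real.log y⁻¹ y := fun y hy =>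
    Real.hasDerivAt_log ((Real.exp_pos _).trans_le hy.1).ne'
  have hinv : ContinuousOn (fun y : ℝ => y⁻¹) (Icc (Real.exp (-B)) (Real.exp B)) :=
    continuousOn_id.inv₀ fun y hy => ((Real.exp_pos _).trans_le hy.1).ne'
  have hL := (hp.continuity.comp hT c1 hmem hlog hinv).add hT hΨ
  have cL : Continuous fun z : ℝ × ℝ => Real.log (p.ρ z.1 z.2) + Ψ z.1 z.2 :=
    (c1.log fun z => (hpos z.1 z.2).ne').add cΨ
  have hLx : ∀ t ∈ Icc 0 T, ACPair 1 (fun x => Real.log (p.ρ t x) + Ψ t x) (fun x =>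
      (p.ρ t x)⁻¹ * p.ρx t x + p.ρ t x * (p.u t x - q.u t x)) := fun t ht =>
    ((hp.ac_ρ t ht).comp h01 (hmem t ht) hlog hinv).add h01 (hΨx t ht)
  -- The material derivative of log ρ is −u_x, while γ contributes +u_x up to the flux bound. The
  -- two cancel, and what survives is −A² ρ plus an error that only sees the reference solution.
  have hflux : ∀ᵐ t ∂volume.restrict (Ioc 0 T), ∀ᵐ x ∂volume.restrict (Ioc (0 : ℝ) 1),
      |((p.ρ t x)⁻¹ * -(p.ρx t x * p.u t x + p.ρ t x * p.ux t x) + γ t x)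
        + p.u t x * ((p.ρ t x)⁻¹ * p.ρx t x + p.ρ t x * (p.u t x - q.u t x)) + A ^ 2 * p.ρ t x|
        ≤ fluxBound A m C q t := by
    filter_upwards [hγ] with t ht
    filter_upwards [ht] with x hx
    convert hx using 2
    have := (hpos t x).ne'
    field_simp
    ring
  have h0 : (0 : ℝ) ∈ Icc 0 T := ⟨le_rfl, hT⟩
  constructor
  -- For the upper bound the damping −A² ρ has the good sign and is dropped. The constant K + 2
  -- dominates log ρ + Ψ at time zero; removing Ψ at time t costs another 2.
  · obtain ⟨b, cb, hbe, hb'⟩ := (ACPair.primitive (intervalIntegrable_fluxBound (A := A) (m := m)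
      (C := C) hq.toIsRegular)).exists_continuous hT
    have key := maximum_principle hT hp.toIsRegular
      (f := fun t x => Real.log (p.ρ t x) + Ψ t x - (b t + (K + 2)))
      (fx := fun t x => (p.ρ t x)⁻¹ * p.ρx t x + p.ρ t x * (p.u t x - q.u t x)) (c := fun _ => 0)
      (by fun_prop) (hL.sub hT (TimeDeriv.of_acPair hT (hb'.add hT (ACPair.const (K + 2)))))
      (ae_Icc_of_ae fun t ht => ((hLx t ht).sub h01 (ACPair.const (b t + (K + 2)))).congr h01
        (fun _ _ => rfl) (Eventually.of_forall fun x => by simp)) (by simp) ?_ ?_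
    · intro t ht x hx
      have h1 := key t ht x hx
      have h2 := abs_le.1 (hΨb t ht x hx)
      rw [hbe t ht] at h1
      linarith
    · filter_upwards [hflux] with t ht
      filter_upwards [ht] with x hx _
      have h1 := (abs_le.1 hx).2
      have h2 : 0 ≤ A ^ 2 * p.ρ t x := mul_nonneg (sq_nonneg _) (hpos t x).le
      linarith
    · intro x hx
      have h1 := abs_le.1 (hK x hx)
      have h2 := abs_le.1 (hΨb 0 h0 x hx)
      rw [hbe 0 h0, intervalIntegral.integral_same]
      linarith
  · intro M hM
    -- For the lower bound the damping acts in the wrong direction, which is why an upper bound M on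
    -- the density must come first.
    obtain ⟨b, cb, hbe, hb'⟩ := (ACPair.primitive ((intervalIntegrable_fluxBound (A := A) (m := m)
      (C := C) hq.toIsRegular).add
        (intervalIntegrable_const (c := A ^ 2 * M)))).exists_continuous hT
    have key := maximum_principle hT hp.toIsRegular
      (f := fun t x => -1 * (Real.log (p.ρ t x) + Ψ t x) - (b t + (K + 2)))
      (fx := fun t x => -1 * ((p.ρ t x)⁻¹ * p.ρx t x + p.ρ t x * (p.u t x - q.u t x)))
      (c := fun _ => 0) (by fun_prop) ((hL.const_mul hT (-1)).sub hT
        (TimeDeriv.of_acPair hT (hb'.add hT (ACPair.const (K + 2)))))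
      (ae_Icc_of_ae fun t ht =>
        (((hLx t ht).const_mul h01 (-1)).sub h01 (ACPair.const (b t + (K + 2)))).congr h01
        (fun _ _ => rfl) (Eventually.of_forall fun x => by simp)) (by simp) ?_ ?_
    · intro t ht x hx
      have h1 := key t ht x hx
      have h2 := abs_le.1 (hΨb t ht x hx)
      rw [hbe t ht] at h1
      linarith
    · filter_upwards [hflux, ae_restrict_mem measurableSet_Ioc] with t ht htT
      filter_upwards [ht, ae_restrict_mem measurableSet_Ioc] with x hx hx1 _
      have h1 := (abs_le.1 hx).1
      have h2 : A ^ 2 * p.ρ t x ≤ A ^ 2 * M := by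
        gcongr
        exact hM t (Ioc_subset_Icc_self htT) x (Ioc_subset_Icc_self hx1)
      linarith
    · intro x hx
      have h1 := abs_le.1 (hK x hx)
      have h2 := abs_le.1 (hΨb 0 h0 x hx)
      rw [hbe 0 h0, intervalIntegral.integral_same]
      linarith

/-- Uniform stability with respect to a reference solution. -/
lemma exists_stability_constants (hT : 0 ≤ T) (hq : IsStripPath T q) (hb : IsBounded T m C q)
    (A K : ℝ) : ∃ η Λ κ : ℝ, 0 < η ∧ 0 < κ ∧ ∀ p : Path, IsStripPath T p → (∀ t x, 0 < p.ρ t x) →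
      SameNoise T A p q → (∀ t ∈ Icc 0 T, ∫ x in (0 : ℝ)..1, p.ρ t x = 1) →
      (∀ x ∈ Icc (0 : ℝ) 1, |Real.log (p.ρ 0 x)| ≤ K) → relEnergy p q 0 ≤ η →
      ∀ t ∈ Icc 0 T, relEnergy p q t ≤ Λ * relEnergy p q 0 ∧
        ∀ x ∈ Icc (0 : ℝ) 1, κ ≤ p.ρ t x := by
  have hC := hb.nonneg hT
  -- M is the upper bound on the density provided by the flux argument up to time T, so M + C bounds
  -- the distance of the two densities in the growth rate. The threshold 1/(2Λ) makes Λ times the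
  -- initial relative energy at most one half, strictly below the level one on which M depends.
  set M := Real.exp (K + 4 + ∫ s in (0 : ℝ)..T, fluxBound A m C q s) with hM
  set Λ := Real.exp (∫ s in (0 : ℝ)..T, growthRate A m (M + C) C q s) with hΛ
  have hgr : ∀ s, 0 ≤ growthRate A m (M + C) C q s := fun s => by unfold growthRate; positivity
  have mono_int : ∀ {a : ℝ → ℝ}, (∀ s, 0 ≤ a s) → IntervalIntegrable a volume 0 T →
      ∀ t ∈ Icc 0 T, ∫ s in (0 : ℝ)..t, a s ≤ ∫ s in (0 : ℝ)..T, a s := fun ha hai t ht =>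
    intervalIntegral.integral_mono_interval le_rfl ht.1 ht.2 (Eventually.of_forall ha) hai
  have hfb := fluxBound_nonneg (A := A) hb.pos hC q
  have hfi := intervalIntegrable_fluxBound (A := A) (m := m) (C := C) hq.toIsRegular
  refine ⟨1 / (2 * Λ), Λ, Real.exp (-(K + 4 + ∫ s in (0 : ℝ)..T, (fluxBound A m C q s + A ^ 2 * M))),
    by positivity, by positivity, fun p hp hpos hpq hmass hK h0 => ?_⟩
  have hΛ0 : 0 < Λ := Real.exp_pos _
  -- on every interval where the relative energy is at most one it is at most one half
  have step : ∀ τ ∈ Icc 0 T, (∀ t ∈ Icc 0 τ, relEnergy p q t ≤ 1) →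
      (∀ t ∈ Icc 0 τ, ∀ x ∈ Icc (0 : ℝ) 1, p.ρ t x ≤ M) ∧
      ∀ t ∈ Icc 0 τ, relEnergy p q t ≤ Λ * relEnergy p q 0 := by
    intro τ hτ hE
    have hsub : ∀ t ∈ Icc 0 τ, t ∈ Icc 0 T := fun t ht => ⟨ht.1, ht.2.trans hτ.2⟩
    have hup : ∀ t ∈ Icc 0 τ, ∀ x ∈ Icc (0 : ℝ) 1, p.ρ t x ≤ M := fun t ht x hx => by
      have := (log_density_le hτ.1 (hp.mono hτ.1 hτ.2) (hq.mono hτ.1 hτ.2) hpos (hb.mono hτ.2)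
        (TimeDeriv.mono hpq hτ.1 hτ.2) (fun t ht => hmass t (hsub t ht)) hE hK).1 t ht x hx
      rw [← Real.exp_log (hpos t x), hM]
      refine Real.exp_le_exp.2 (this.trans ?_)
      have := mono_int hfb hfi t (hsub t ht)
      linarith
    refine ⟨hup, fun t ht => ?_⟩
    have h1 := relEnergy_le hτ.1 (hp.mono hτ.1 hτ.2) (hq.mono hτ.1 hτ.2) (fun t _ x _ => hpos t x)
      (hb.mono hτ.2) (TimeDeriv.mono hpq hτ.1 hτ.2) (M := M + C) (fun t ht x hx => ?_) t ht
    · rw [mul_comm]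
      refine h1.trans ?_
      have : 0 ≤ relEnergy p q 0 := intervalIntegral.integral_nonneg zero_le_one fun x hx => by
        have := (hpos 0 x).le
        positivity
      gcongr
      exact Real.exp_le_exp.2 <| mono_int hgr (intervalIntegrable_growthRate hq.toIsRegular) t (hsub t ht)
    · have a1 := hup t ht x hx
      have a2 := hpos t x
      have a3 := hb.ρ_le t (hsub t ht) x hx
      have a4 := hb.pos.trans_le (hb.le t (hsub t ht) x hx)
      rw [abs_le]; constructor <;> linarith
  have hhalf : Λ * relEnergy p q 0 ≤ 1 / 2 := by
    calc Λ * relEnergy p q 0 ≤ Λ * (1 / (2 * Λ)) := by gcongr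
      _ = 1 / 2 := by field_simp
  have hcont := (relEnergy_acPair hT hp hq hpq).continuousOn hT
  -- Before the first time at which the relative energy reaches one, `step` improves the bound to
  -- one half. By continuity the bound one half persists at that time, a contradiction.
  have hall : ∀ t ∈ Icc 0 T, relEnergy p q t ≤ 1 := by
    by_contra! hcon
    obtain ⟨t₁, ht₁, hgt⟩ := hcon
    -- the first time at which the relative energy reaches one
    set S := Icc 0 t₁ ∩ {t | 1 ≤ relEnergy p q t} with hS
    have hc1 : ContinuousOn (relEnergy p q) (Icc 0 t₁) :=
      hcont.mono (Icc_subset_Icc_right ht₁.2)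
    have hScl : IsClosed S := hc1.preimage_isClosed_of_isClosed isClosed_Icc isClosed_Ici
    have hSne : S.Nonempty := ⟨t₁, ⟨ht₁.1, le_rfl⟩, hgt.le⟩
    have hSbd : BddBelow S := ⟨0, fun t ht => ht.1.1⟩
    have hmem := hScl.csInf_mem hSne hSbd
    set τ := sInf S
    have hτT : τ ∈ Icc 0 T := ⟨hmem.1.1, hmem.1.2.trans ht₁.2⟩
    have hlt : ∀ t ∈ Ico 0 τ, relEnergy p q t ≤ 1 := fun t ht => by
      by_contra! h
      exact absurd (csInf_le hSbd ⟨⟨ht.1, ht.2.le.trans hmem.1.2⟩, h.le⟩) (not_le.2 ht.2)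
    have h00 : relEnergy p q 0 ≤ 1 / 2 := by
      have : 1 ≤ Λ := Real.one_le_exp
        (intervalIntegral.integral_nonneg hT fun s _ => hgr s)
      have h2 : 1 / (2 * Λ) ≤ 1 / 2 := by
        rw [div_le_div_iff₀ (by positivity) (by norm_num)]; linarith
      linarith
    have hτ0 : 0 < τ := by
      rcases hτT.1.eq_or_lt with h | h
      · have := hmem.2
        simp only [mem_ofPred_eq, ← h] at this
        linarith
      · exact h
    have hlt2 : ∀ t ∈ Ico 0 τ, relEnergy p q t ≤ 1 / 2 := fun t ht =>
      ((step t ⟨ht.1, ht.2.le.trans hτT.2⟩ fun s hs => hlt s ⟨hs.1, hs.2.trans_lt ht.2⟩).2 t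
        ⟨ht.1, le_rfl⟩).trans hhalf
    have hlim : relEnergy p q τ ≤ 1 / 2 := by
      have hcl : τ ∈ closure (Ico 0 τ) := by rw [closure_Ico hτ0.ne]; exact ⟨hτ0.le, le_rfl⟩
      have hcw : ContinuousWithinAt (relEnergy p q) (Ico 0 τ) τ :=
        (hcont τ hτT).mono fun s hs => ⟨hs.1, hs.2.le.trans hτT.2⟩
      have := hcw.mem_closure_image hcl
      have h3 : closure (relEnergy p q '' Ico 0 τ) ⊆ Iic (1 / 2) :=
        closure_minimal (by rintro _ ⟨t, ht, rfl⟩; exact hlt2 t ht) isClosed_Iic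
      exact h3 this
    have := hmem.2
    simp only [mem_ofPred_eq] at this
    linarith
  have hfin := step T ⟨hT, le_rfl⟩ hall
  refine fun t ht => ⟨hfin.2 t ht, fun x hx => ?_⟩
  have h1 := (log_density_le hT hp hq hpos hb hpq hmass hall hK).2 M hfin.1 t ht x hx
  rw [← Real.exp_log (hpos t x)]
  refine Real.exp_le_exp.2 ?_
  have h2 := mono_int (a := fun s => fluxBound A m C q s + A ^ 2 * M)
    (fun s => add_nonneg (hfb s) (by positivity)) (hfi.add intervalIntegrable_const) t ht
  linarith

end

end CNSE

namespace CNSE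

noncomputable section

/-! ### Functions of class `H¹` and the initial data -/

lemma unitVol_eq : unitVol = volume.restrict (Ioc (0 : ℝ) 1) :=
  Measure.restrict_congr_set Ioo_ae_eq_Ioc

lemma MemH1.acPair {f : ℝ → ℝ} (h : MemH1 f) : ACPair 1 f (deriv f) := by
  refine ACPair.of_ac zero_le_one h.1 ?_
  filter_upwards [h.1.ae_differentiableAt] with x hx hx1
  exact (hx (by rw [uIcc_of_le zero_le_one]; exact Ioo_subset_Icc_self hx1)).hasDerivAt

lemma MemH1.memL2_deriv {f : ℝ → ℝ} (h : MemH1 f) : MemL2 (deriv f) := by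
  have := h.2
  rwa [unitVol_eq] at this

/-- The tangent at 1 lies below y log y. Integrated against a density of unit mass, the lower bound
has integral zero, so the entropy term of the energy can be discarded. -/
lemma sub_one_le_mul_log {y : ℝ} (hy : 0 < y) : y - 1 ≤ y * Real.log y := by
  have h := Real.one_sub_inv_le_log_of_pos hy
  calc y - 1 = y * (1 - y⁻¹) := by field_simp
    _ ≤ _ := by gcongr

/-- The modified energy controls the Fisher-type information of the density. -/
lemma integral_deriv_sq_div_le {A : ℝ} {ρ u : ℝ → ℝ} (h : (ρ, u) ∈ PhaseSpace) :
    ∫ x in (0 : ℝ)..1, deriv ρ x ^ 2 / ρ x ^ 3 ≤ 8 * modifiedEnergy A ρ u := by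
  have h01 := zero_le_one (α := ℝ)
  obtain ⟨hρ, ⟨hu, -⟩, hm, hpos⟩ := h
  have cρ := hρ.acPair.continuousOn h01
  have cu := hu.acPair.continuousOn h01
  have hd := hρ.memL2_deriv
  rw [← uIcc_of_le h01] at cρ cu
  have hne : ∀ x ∈ uIcc (0 : ℝ) 1, ρ x ≠ 0 := fun x hx =>
    (hpos x (by rwa [uIcc_of_le h01] at hx)).ne'
  have i1 : IntervalIntegrable (fun x => deriv ρ x ^ 2 / ρ x ^ 3) volume 0 1 := by
    refine (hd.sq_integrable.continuousOn_mul (g := fun x => (ρ x ^ 3)⁻¹)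
      ((cρ.pow 3).inv₀ fun x hx => pow_ne_zero 3 (hne x hx))).congr fun x _ => ?_
    ring
  have i2 : IntervalIntegrable (fun x => deriv ρ x * u x / ρ x) volume 0 1 := by
    refine (hd.integrable'.continuousOn_mul (g := fun x => u x / ρ x)
      (cu.div cρ hne)).congr fun x _ => ?_
    ring
  have i3 : IntervalIntegrable (fun x => 1 / 2 * ρ x * u x ^ 2 + A ^ 2 * (ρ x * Real.log (ρ x)))
      volume 0 1 := by
    have := cρ.log hne
    exact ContinuousOn.intervalIntegrable (by fun_prop)
  have iρ : IntervalIntegrable ρ volume 0 1 := cρ.intervalIntegrable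
  have e1 : modifiedEnergy A ρ u = ∫ x in (0 : ℝ)..1,
      ((1 / 2 * ρ x * u x ^ 2 + A ^ 2 * (ρ x * Real.log (ρ x)))
        + 1 / 2 * (deriv ρ x * u x / ρ x + 1 / 2 * (deriv ρ x ^ 2 / ρ x ^ 3))) := by
    rw [intervalIntegral.integral_add i3 ((i2.add (i1.const_mul _)).const_mul _),
      intervalIntegral.integral_const_mul]
    rfl
  have e2 : ∫ x in (0 : ℝ)..1, (1 / 8 * (deriv ρ x ^ 2 / ρ x ^ 3) + A ^ 2 * (ρ x - 1))
      = 1 / 8 * ∫ x in (0 : ℝ)..1, deriv ρ x ^ 2 / ρ x ^ 3 := by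
    rw [intervalIntegral.integral_add (i1.const_mul _)
      ((iρ.sub intervalIntegrable_const).const_mul _), intervalIntegral.integral_const_mul,
      intervalIntegral.integral_const_mul, intervalIntegral.integral_sub iρ
      intervalIntegrable_const, hm]
    simp
  have key : ∫ x in (0 : ℝ)..1, (1 / 8 * (deriv ρ x ^ 2 / ρ x ^ 3) + A ^ 2 * (ρ x - 1))
      ≤ modifiedEnergy A ρ u := by
    rw [e1]
    refine intervalIntegral.integral_mono_on h01
      ((i1.const_mul _).add ((iρ.sub intervalIntegrable_const).const_mul _))
      (i3.add ((i2.add (i1.const_mul _)).const_mul _)) fun x hx => ?_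
    have hp := hpos x hx
    have a1 := mul_le_mul_of_nonneg_left (sub_one_le_mul_log hp) (sq_nonneg A)
    -- Completing the square uses up the kinetic energy, the cross term and an eighth of ρ_x²/ρ³.
    -- The modified energy contains a quarter, so an eighth remains.
    have a2 : 0 ≤ ρ x / 2 * (u x + deriv ρ x / (2 * ρ x ^ 2)) ^ 2 := by positivity
    have a3 : ρ x / 2 * (u x + deriv ρ x / (2 * ρ x ^ 2)) ^ 2 = 1 / 2 * ρ x * u x ^ 2
        + 1 / 2 * (deriv ρ x * u x / ρ x) + 1 / 8 * (deriv ρ x ^ 2 / ρ x ^ 3) := by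
      field_simp
      ring
    linarith
  rw [e2] at key
  linarith

/-- The modified energy bounds the logarithm of the density. -/
lemma abs_log_density_le {A : ℝ} {ρ u : ℝ → ℝ} (h : (ρ, u) ∈ PhaseSpace) {x : ℝ}
    (hx : x ∈ Icc (0 : ℝ) 1) : |Real.log (ρ x)| ≤ √(8 * modifiedEnergy A ρ u) := by
  have h01 := zero_le_one (α := ℝ)
  have hI := integral_deriv_sq_div_le (A := A) h
  obtain ⟨hρ, -, hm, hpos⟩ := h
  have cρ := hρ.acPair.continuousOn h01
  have hd := hρ.memL2_deriv
  have iρ : IntervalIntegrable ρ volume 0 1 := hρ.acPair.memL2.integrable'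
  -- Since the mass is one, the minimum of ρ is at most 1 and the maximum at least 1. Hence log ρ
  -- takes values of both signs, and its oscillation bounds its absolute value.
  obtain ⟨x₀, hx₀, hmin⟩ := isCompact_Icc.exists_isMinOn (nonempty_Icc.2 h01) cρ
  obtain ⟨x₁, hx₁, hmax⟩ := isCompact_Icc.exists_isMaxOn (nonempty_Icc.2 h01) cρ
  have h1 : ρ x₀ ≤ 1 := by
    rw [← hm]
    have := intervalIntegral.integral_mono_on h01 (f := fun _ => ρ x₀) (by simp) iρ
      fun x hx => hmin hx
    simpa using this
  have h2 : 1 ≤ ρ x₁ := by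
    refine hm.symm.le.trans ?_
    have := intervalIntegral.integral_mono_on h01 (g := fun _ => ρ x₁) iρ (by simp)
      fun x hx => hmax hx
    simpa using this
  have hlog : ACPair 1 (fun x => Real.log (ρ x)) (fun x => (ρ x)⁻¹ * deriv ρ x) := by
    refine hρ.acPair.comp h01 (m := ρ x₀) (M := ρ x₁) (fun x hx => ⟨hmin hx, hmax hx⟩)
      (fun y hy => Real.hasDerivAt_log ((hpos _ hx₀).trans_le hy.1).ne')
      (continuousOn_id.inv₀ fun y hy => ((hpos _ hx₀).trans_le hy.1).ne')
  have hvar : ∀ y ∈ Icc (0 : ℝ) 1, ∀ z ∈ Icc (0 : ℝ) 1,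
      Real.log (ρ z) - Real.log (ρ y) ≤ √(8 * modifiedEnergy A ρ u) := by
    intro y hy z hz
    rw [hlog.sub_eq hy hz]
    refine (le_abs_self _).trans ((abs_integral_le_of_subset hlog.integrable hy hz).trans ?_)
    have hne : ∀ x ∈ Icc (0 : ℝ) 1, ρ x ≠ 0 := fun x hx => (hpos x hx).ne'
    -- Cauchy–Schwarz for ρ_x/ρ = ρ^{1/2} · ρ_x ρ^{-3/2}: the first factor has norm one by the mass
    -- constraint, and the square of the second is the integrand controlled by the energy.
    have m1 : MemL2 (fun x => √(ρ x)) := ContinuousOn.memL2 cρ.sqrt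
    have m2 : MemL2 (fun x => deriv ρ x * (ρ x * √(ρ x))⁻¹) := by
      have cc : ContinuousOn (fun x => (ρ x * √(ρ x))⁻¹) (Icc 0 1) :=
        (cρ.mul cρ.sqrt).inv₀ fun x hx =>
          mul_ne_zero (hne x hx) (Real.sqrt_ne_zero'.2 (hpos x hx))
      obtain ⟨B, hB⟩ := isCompact_Icc.exists_bound_of_continuousOn cc
      refine MemLp.of_le_mul (c := B) hd (hd.1.mul
        ((cc.mono Ioc_subset_Icc_self).aestronglyMeasurable measurableSet_Ioc)) ?_
      filter_upwards [ae_restrict_mem measurableSet_Ioc] with x hx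
      rw [norm_mul, mul_comm]
      gcongr
      exact hB x (Ioc_subset_Icc_self hx)
    have cs := integral_abs_mul_abs_le m1 m2
    have e1 : nrm (fun x => √(ρ x)) = 1 := by
      rw [nrm, intervalIntegral.integral_congr (g := ρ) fun x hx => ?_, hm, Real.sqrt_one]
      rw [uIcc_of_le h01] at hx
      exact Real.sq_sqrt (hpos x hx).le
    have e2 : nrm (fun x => deriv ρ x * (ρ x * √(ρ x))⁻¹) ≤ √(8 * modifiedEnergy A ρ u) := by
      refine Real.sqrt_le_sqrt (le_trans (le_of_eq ?_) hI)
      refine intervalIntegral.integral_congr fun x hx => ?_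
      rw [uIcc_of_le h01] at hx
      have := hpos x hx
      simp only [mul_pow, inv_pow, Real.sq_sqrt this.le]
      field_simp
    rw [e1, one_mul] at cs
    refine le_trans (le_of_eq ?_) (cs.trans e2)
    refine intervalIntegral.integral_congr fun x hx => ?_
    rw [uIcc_of_le h01] at hx
    have hp := hpos x hx
    have hs : 0 < √(ρ x) := Real.sqrt_pos.2 hp
    simp only [abs_mul, abs_inv, abs_of_pos hp, abs_of_pos hs]
    field_simp
  have l0 : Real.log (ρ x₀) ≤ 0 := Real.log_nonpos (hpos _ hx₀).le h1
  have l1 : 0 ≤ Real.log (ρ x₁) := Real.log_nonneg h2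
  have v1 := hvar x₀ hx₀ x hx
  have v2 := hvar x hx x₁ hx₁
  rw [abs_le]
  constructor <;> linarith

end

end CNSE

namespace CNSE

noncomputable section

/-! ### From a trajectory to a regular path -/

lemma eLpNorm_eq_nrm {f : ℝ → ℝ} (hf : MemL2 f) : eLpNorm f 2 unitVol = ENNReal.ofReal (nrm f) := by
  rw [unitVol_eq, hf.eLpNorm_eq_integral_rpow_norm (by norm_num) (by norm_num), nrm,
    Real.sqrt_eq_rpow, intervalIntegral.integral_of_le zero_le_one]
  simp

lemma nrm_congr {f g : ℝ → ℝ} (h : f =ᵐ[volume.restrict (Ioc (0 : ℝ) 1)] g) : nrm f = nrm g := by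
  rw [nrm, nrm, intervalIntegral.integral_of_le zero_le_one,
    intervalIntegral.integral_of_le zero_le_one]
  congr 1
  exact integral_congr_ae (h.mono fun x hx => by simp only [hx])

lemma tendstoL2_iff {ι : Type*} {l : Filter ι} {f : ι → ℝ → ℝ} {g : ℝ → ℝ}
    (h : ∀ i, MemL2 fun x => f i x - g x) :
    TendstoL2 l f g ↔ Tendsto (fun i => nrm fun x => f i x - g x) l (𝓝 0) := by
  simp only [TendstoL2, eLpNorm_eq_nrm (h _)]
  rw [← ENNReal.tendsto_toReal_zero_iff (fun i => ENNReal.ofReal_ne_top)]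
  simp only [ENNReal.toReal_ofReal (nrm_nonneg _)]

/-- Interpolation of the supremum between `L²` and `H¹`. -/
lemma ACPair.sq_le {f f' : ℝ → ℝ} (hf : ACPair 1 f f') (hf' : MemL2 f') {x : ℝ}
    (hx : x ∈ Icc (0 : ℝ) 1) : f x ^ 2 ≤ nrm f ^ 2 + 2 * (nrm f * nrm f') := by
  have h01 := zero_le_one (α := ℝ)
  have hs := hf.mul h01 hf
  have key : ∀ y ∈ Icc (0 : ℝ) 1, f x * f x - 2 * (nrm f * nrm f') ≤ f y ^ 2 := by
    intro y hy
    have h1 := hs.sub_eq hy hx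
    have h2 := abs_integral_le_of_subset hs.integrable hy hx
    rw [← h1] at h2
    have h3 : ∫ t in (0 : ℝ)..1, |f' t * f t + f t * f' t| ≤ 2 * (nrm f * nrm f') := by
      refine le_trans (le_of_eq ?_) (mul_le_mul_of_nonneg_left
        (integral_abs_mul_abs_le hf.memL2 hf') zero_le_two)
      rw [← intervalIntegral.integral_const_mul]
      refine intervalIntegral.integral_congr fun t _ => ?_
      simp only [← abs_mul, mul_comm (f' t), ← two_mul]
      simp
    have h4 := le_abs_self (f x * f x - f y * f y)
    nlinarith
  have := intervalIntegral.integral_mono_on h01 (f := fun _ => f x * f x - 2 * (nrm f * nrm f'))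
    (by simp) hf.memL2.sq_integrable key
  rw [← nrm_sq] at this
  simp only [intervalIntegral.integral_const, sub_zero, one_smul] at this
  linarith

/-- The projection onto `[0,1]`. -/
def clamp (x : ℝ) : ℝ := max 0 (min x 1)

lemma continuous_clamp : Continuous clamp := by unfold clamp; fun_prop

lemma clamp_mem (x : ℝ) : clamp x ∈ Icc (0 : ℝ) 1 :=
  ⟨le_max_left _ _, max_le zero_le_one (min_le_right _ _)⟩

lemma clamp_eq {x : ℝ} (hx : x ∈ Icc (0 : ℝ) 1) : clamp x = x := by
  rw [clamp, min_eq_left hx.2, max_eq_right hx.1]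

lemma deriv_comp_clamp (f : ℝ → ℝ) {x : ℝ} (hx : x ∈ Ioo (0 : ℝ) 1) :
    deriv (fun x => f (clamp x)) x = deriv f x := by
  refine Filter.EventuallyEq.deriv_eq ?_
  filter_upwards [isOpen_Ioo.mem_nhds hx] with y hy
  rw [clamp_eq (Ioo_subset_Icc_self hy)]

lemma ae_Ioo_of_forall {p : ℝ → Prop} (h : ∀ x ∈ Ioo (0 : ℝ) 1, p x) :
    ∀ᵐ x ∂volume.restrict (Ioc (0 : ℝ) 1), p x := by
  rw [← unitVol_eq, unitVol]
  filter_upwards [ae_restrict_mem measurableSet_Ioo] with x hx using h x hx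

lemma deriv_comp_clamp_ae (f : ℝ → ℝ) :
    deriv f =ᵐ[volume.restrict (Ioc (0 : ℝ) 1)] deriv (fun x => f (clamp x)) :=
  ae_Ioo_of_forall fun _ hx => (deriv_comp_clamp f hx).symm

/-- A trajectory which is bounded in `H¹` and continuous in `L²` is jointly continuous. -/
lemma continuous_of_tendstoL2 {f : ℝ≥0 → ℝ → ℝ} (hH : ∀ t, MemH1 (f t))
    (hb : ∀ T : ℝ≥0, ∃ C : ℝ, ∀ t ≤ T, nrm (deriv (f t)) ≤ C)
    (hc : ∀ t, TendstoL2 (𝓝 t) f (f t)) :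
    Continuous fun z : ℝ × ℝ => f z.1.toNNReal (clamp z.2) := by
  have h01 := zero_le_one (α := ℝ)
  have hd : ∀ s t, ACPair 1 (fun x => f s x - f t x) (fun x => deriv (f s) x - deriv (f t) x) :=
    fun s t => (hH s).acPair.sub h01 (hH t).acPair
  have hd2 : ∀ s t, MemL2 (fun x => deriv (f s) x - deriv (f t) x) := fun s t =>
    (hH s).memL2_deriv.sub (hH t).memL2_deriv
  -- By the interpolation inequality, continuity in L² together with local H¹ bounds gives
  -- continuity in time uniformly in x. Joint continuity follows from this and continuity in x at a
  -- fixed time.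
  have hunif : ∀ t, Tendsto (fun s => √(nrm (fun x => f s x - f t x) ^ 2
      + 2 * (nrm (fun x => f s x - f t x) * nrm (fun x => deriv (f s) x - deriv (f t) x))))
      (𝓝 t) (𝓝 0) := by
    intro t
    obtain ⟨C, hC⟩ := hb (t + 1)
    have h1 := (tendstoL2_iff (fun s => (hd s t).memL2)).1 (hc t)
    have hbd : ∀ᶠ s in 𝓝 t, nrm (fun x => deriv (f s) x - deriv (f t) x) ≤ 2 * C := by
      filter_upwards [Iio_mem_nhds (show t < t + 1 by simp)] with s hs
      have hs1 := hC s (mem_Iio.1 hs).le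
      have hs2 := hC t (by simp)
      have hC0 := (nrm_nonneg _).trans hs1
      refine Real.sqrt_le_iff.2 ⟨by positivity, ?_⟩
      have m1 := (hH s).memL2_deriv.sq_integrable
      have m2 := (hH t).memL2_deriv.sq_integrable
      have := intervalIntegral.integral_mono_on h01 (hd2 s t).sq_integrable
        ((m1.const_mul 2).add (m2.const_mul 2)) (fun x _ => show _ ≤ 2 * deriv (f s) x ^ 2 + 2 * deriv (f t) x ^ 2 by
          nlinarith [sq_nonneg (deriv (f s) x + deriv (f t) x)])
      rw [intervalIntegral.integral_add (m1.const_mul 2) (m2.const_mul 2),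
        intervalIntegral.integral_const_mul, intervalIntegral.integral_const_mul,
        ← nrm_sq (deriv (f s)), ← nrm_sq (deriv (f t))] at this
      have q1 : nrm (deriv (f s)) ^ 2 ≤ C ^ 2 := by gcongr; exact nrm_nonneg _
      have q2 : nrm (deriv (f t)) ^ 2 ≤ C ^ 2 := by gcongr; exact nrm_nonneg _
      linarith
    have h2 : Tendsto (fun s => √(nrm (fun x => f s x - f t x) ^ 2
        + 2 * (nrm (fun x => f s x - f t x) * (2 * C)))) (𝓝 t) (𝓝 0) := by
      have := ((h1.pow 2).add ((h1.mul_const (2 * C)).const_mul 2)).sqrt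
      simpa using this
    refine tendsto_of_tendsto_of_tendsto_of_le_of_le' tendsto_const_nhds h2
      (Eventually.of_forall fun _ => Real.sqrt_nonneg _) ?_
    filter_upwards [hbd] with s hs
    refine Real.sqrt_le_sqrt ?_
    have := nrm_nonneg (fun x => f s x - f t x)
    gcongr
  rw [continuous_iff_continuousAt]
  rintro ⟨t, x⟩
  have cx : Continuous fun y => f t.toNNReal (clamp y) :=
    ((hH t.toNNReal).acPair.continuousOn h01).comp_continuous continuous_clamp clamp_mem
  have e1 : Tendsto (fun z : ℝ × ℝ => f t.toNNReal (clamp z.2)) (𝓝 (t, x))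
      (𝓝 (f t.toNNReal (clamp x))) := (cx.comp continuous_snd).tendsto (t, x)
  have e2 : Tendsto (fun z : ℝ × ℝ => f z.1.toNNReal (clamp z.2) - f t.toNNReal (clamp z.2))
      (𝓝 (t, x)) (𝓝 0) := by
    have hz : Tendsto (fun z : ℝ × ℝ => z.1.toNNReal) (𝓝 (t, x)) (𝓝 t.toNNReal) :=
      (continuous_real_toNNReal.comp continuous_fst).tendsto (t, x)
    refine squeeze_zero_norm (fun z => ?_) ((hunif t.toNNReal).comp hz)
    exact Real.abs_le_sqrt ((hd z.1.toNNReal t.toNNReal).sq_le (hd2 _ _) (clamp_mem z.2))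
  have := e1.add e2
  simp only [add_zero] at this
  exact this.congr fun z => by ring

/-- The path associated with a trajectory. -/
def toPath (ρ u : ℝ≥0 → ℝ → ℝ) : Path where
  ρ t x := ρ t.toNNReal (clamp x)
  ρx t x := deriv (fun x => ρ t.toNNReal (clamp x)) x
  u t x := u t.toNNReal (clamp x)
  ux t x := deriv (fun x => u t.toNNReal (clamp x)) x
  -- The velocity gradient is jointly measurable but need not be continuous. A limit of difference
  -- quotients along one fixed sequence keeps the joint measurability in time and space.
  uxx t x := limUnder atTop fun n : ℕ => (1 / ((n : ℝ) + 1))⁻¹ •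
    (deriv (fun x => u t.toNNReal (clamp x)) (x + 1 / ((n : ℝ) + 1))
      - deriv (fun x => u t.toNNReal (clamp x)) x)

/-- The conditions on a trajectory which hold almost surely for a solution. -/
structure IsTrajectory (ρ u : ℝ≥0 → ℝ → ℝ) : Prop where
  continuous : ∀ t : ℝ≥0, TendstoL2 (𝓝 t) (fun s => ρ s) (ρ t) ∧ TendstoL2 (𝓝 t) (fun s => u s) (u t)
  density_H1 : (∀ t, MemH1 (ρ t)) ∧ ∀ T : ℝ≥0, ∃ C : ℝ≥0, ∀ t ≤ T,
    eLpNorm (ρ t) 2 unitVol + eLpNorm (deriv (ρ t)) 2 unitVol ≤ C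
  velocity_H1 : (∀ t, MemH10 (u t)) ∧ ∀ T : ℝ≥0, ∃ C : ℝ≥0, ∀ t ≤ T,
    eLpNorm (u t) 2 unitVol + eLpNorm (deriv (u t)) 2 unitVol ≤ C
  velocity_H2 : (∀ᵐ s ∂(volume.restrict (Ici (0 : ℝ))), MemH2 (u s.toNNReal)) ∧
    ∀ T : ℝ≥0, ∫⁻ s in Icc (0 : ℝ) T, eLpNorm (deriv (deriv (u s.toNNReal))) 2 unitVol ^ 2 < ∞

lemma nrm_deriv_le_of_eLpNorm {f : ℝ≥0 → ℝ → ℝ} (hf : ∀ t, MemH1 (f t))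
    (h : ∀ T : ℝ≥0, ∃ C : ℝ≥0, ∀ t ≤ T,
      eLpNorm (f t) 2 unitVol + eLpNorm (deriv (f t)) 2 unitVol ≤ C) (T : ℝ≥0) :
    ∃ C : ℝ, ∀ t ≤ T, nrm (deriv (f t)) ≤ C := by
  obtain ⟨C, hC⟩ := h T
  refine ⟨C, fun t ht => ?_⟩
  have h1 := le_add_self.trans (hC t ht)
  rw [eLpNorm_eq_nrm (hf t).memL2_deriv] at h1
  have := (ENNReal.ofReal_le_iff_le_toReal ENNReal.coe_ne_top).1 h1
  simpa using this

/-- A function in `H²` is continuously differentiable, with absolutely continuous derivative. -/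
lemma MemH2.exists_version {f : ℝ → ℝ} (hf : MemH2 f) : ∃ g, MemH1 g ∧
    (∀ x ∈ Ioo (0 : ℝ) 1, deriv f x = g x) ∧ ∀ x ∈ Ioo (0 : ℝ) 1, deriv (deriv f) x = deriv g x := by
  have h01 := zero_le_one (α := ℝ)
  obtain ⟨hf1, g, hg, hfg⟩ := hf
  rw [unitVol_eq] at hfg
  have hac := hf1.acPair.congr h01 (fun _ _ => rfl) hfg
  have cg := hg.acPair.continuousOn h01
  have hd : ∀ x ∈ Ioo (0 : ℝ) 1, deriv f x = g x := by
    intro x hx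
    have h1 : HasDerivAt (fun y => ∫ t in (0 : ℝ)..y, g t) (g x) x := by
      refine intervalIntegral.integral_hasDerivAt_right (hac.mono hx.1.le hx.2.le).integrable ?_
        (cg.continuousAt (Icc_mem_nhds hx.1 hx.2))
      exact ContinuousOn.stronglyMeasurableAtFilter isOpen_Ioo (cg.mono Ioo_subset_Icc_self) x hx
    refine ((h1.const_add (f 0)).congr_of_eventuallyEq ?_).deriv
    filter_upwards [isOpen_Ioo.mem_nhds hx] with y hy using hac.eq y (Ioo_subset_Icc_self hy)
  refine ⟨g, hg, hd, fun x hx => Filter.EventuallyEq.deriv_eq ?_⟩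
  filter_upwards [isOpen_Ioo.mem_nhds hx] with y hy using hd y hy

lemma tendsto_one_div_nhdsNE : Tendsto (fun n : ℕ => 1 / ((n : ℝ) + 1)) atTop (𝓝[≠] 0) :=
  tendsto_nhdsWithin_iff.2 ⟨tendsto_one_div_add_atTop_nhds_zero_nat,
    Eventually.of_forall fun _ => (Nat.one_div_pos_of_nat (α := ℝ)).ne'⟩

/-- On the open interval the velocity gradient equals an absolutely continuous function g. For x
inside, the points x + 1/(n+1) eventually stay inside, so the difference quotients defining `uxx`
are those of g and converge wherever g is differentiable. -/
lemma toPath_uxx_ae {ρ u : ℝ≥0 → ℝ → ℝ} {t : ℝ} (ht : MemH2 (u t.toNNReal)) :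
    ∃ g, MemH1 g ∧ (∀ x ∈ Ioo (0 : ℝ) 1, (toPath ρ u).ux t x = g x) ∧
      deriv g =ᵐ[volume.restrict (Ioc (0 : ℝ) 1)] (toPath ρ u).uxx t ∧
      deriv (deriv (u t.toNNReal)) =ᵐ[volume.restrict (Ioc (0 : ℝ) 1)] (toPath ρ u).uxx t := by
  obtain ⟨g, hg, h1, h2⟩ := ht.exists_version
  have hux : ∀ x ∈ Ioo (0 : ℝ) 1, (toPath ρ u).ux t x = g x := fun x hx =>
    (deriv_comp_clamp _ hx).trans (h1 x hx)
  have h3 : deriv g =ᵐ[volume.restrict (Ioc (0 : ℝ) 1)] (toPath ρ u).uxx t := by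
    rw [← unitVol_eq, unitVol]
    filter_upwards [ae_restrict_mem measurableSet_Ioo,
      ae_restrict_of_ae (hg.acPair.hasDerivAt zero_le_one)] with x hx hd
    refine (Tendsto.limUnder_eq ?_).symm
    have h4 := (hasDerivAt_iff_tendsto_slope_zero.1 (hd hx)).comp tendsto_one_div_nhdsNE
    refine h4.congr' ?_
    have h5 : Tendsto (fun n : ℕ => x + 1 / ((n : ℝ) + 1)) atTop (𝓝 (x + 0)) :=
      tendsto_const_nhds.add tendsto_one_div_add_atTop_nhds_zero_nat
    rw [add_zero] at h5
    filter_upwards [h5.eventually (isOpen_Ioo.mem_nhds hx)] with n hn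
    have e1 := hux x hx
    have e2 := hux _ hn
    simp only [toPath] at e1 e2
    simp only [Function.comp_apply, e1, e2]
  exact ⟨g, hg, hux, h3, EventuallyEq.trans (ae_Ioo_of_forall h2) h3⟩

lemma measurable_nrm_sq {f : ℝ → ℝ → ℝ} (hf : Measurable fun z : ℝ × ℝ => f z.1 z.2) :
    StronglyMeasurable fun t => nrm (f t) ^ 2 := by
  simp only [nrm_sq, intervalIntegral.integral_of_le zero_le_one]
  exact (hf.pow_const 2).stronglyMeasurable.integral_prod_right
    (ν := volume.restrict (Ioc (0 : ℝ) 1))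

/-- The path associated with a trajectory is regular. -/
lemma IsTrajectory.isRegular {ρ u : ℝ≥0 → ℝ → ℝ} (h : IsTrajectory ρ u) {T : ℝ} (hT : 0 ≤ T) :
    IsRegular T (toPath ρ u) := by
  have h01 := zero_le_one (α := ℝ)
  have hu1 : ∀ t, MemH1 (u t) := fun t => (h.velocity_H1.1 t).1
  have cρ := continuous_of_tendstoL2 h.density_H1.1
    (nrm_deriv_le_of_eLpNorm h.density_H1.1 h.density_H1.2) fun t => (h.continuous t).1
  have cu := continuous_of_tendstoL2 hu1
    (nrm_deriv_le_of_eLpNorm hu1 h.velocity_H1.2) fun t => (h.continuous t).2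
  have mux := measurable_deriv_with_param (f := fun (t : ℝ) x => u t.toNNReal (clamp x)) cu
  have muxx : Measurable fun z : ℝ × ℝ => (toPath ρ u).uxx z.1 z.2 := by
    refine (StronglyMeasurable.limUnder fun n => ?_).measurable
    have h1 := mux.comp
      (by fun_prop : Measurable fun z : ℝ × ℝ => (z.1, z.2 + 1 / ((n : ℝ) + 1)))
    exact ((h1.sub mux).const_smul ((1 / ((n : ℝ) + 1))⁻¹)).stronglyMeasurable
  have hH2 : ∀ᵐ t ∂volume.restrict (Ioc 0 T), MemH2 (u t.toNNReal) :=
    ae_mono (Measure.restrict_mono (fun t ht => ht.1.le) le_rfl) h.velocity_H2.1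
  have hac : ∀ {f : ℝ → ℝ}, MemH1 f →
      ACPair 1 (fun x => f (clamp x)) (deriv fun x => f (clamp x)) := fun hf =>
    hf.acPair.congr h01 (fun x hx => by rw [clamp_eq hx]) (deriv_comp_clamp_ae _)
  refine ⟨cρ, cu, measurable_deriv_with_param (f := fun (t : ℝ) x => ρ t.toNNReal (clamp x)) cρ,
    mux, muxx, fun t _ => hac (h.density_H1.1 _), fun t _ => hac (hu1 _), ?_, fun t _ => ?_,
    fun t _ => ?_, ?_, ?_⟩
  · obtain ⟨C₁, hC₁⟩ := nrm_deriv_le_of_eLpNorm h.density_H1.1 h.density_H1.2 T.toNNReal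
    obtain ⟨C₂, hC₂⟩ := nrm_deriv_le_of_eLpNorm hu1 h.velocity_H1.2 T.toNNReal
    refine ⟨max C₁ C₂, fun t ht => ?_⟩
    have hle : t.toNNReal ≤ T.toNNReal := Real.toNNReal_le_toNNReal ht.2
    refine ⟨(h.density_H1.1 _).memL2_deriv.ae_eq (deriv_comp_clamp_ae _),
      (hu1 _).memL2_deriv.ae_eq (deriv_comp_clamp_ae _), ?_, ?_⟩
    · exact (nrm_congr (deriv_comp_clamp_ae _)).symm.le.trans ((hC₁ _ hle).trans (le_max_left _ _))
    · exact (nrm_congr (deriv_comp_clamp_ae _)).symm.le.trans ((hC₂ _ hle).trans (le_max_right _ _))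
  · simp only [toPath]
    rw [clamp_eq (by simp)]
    exact (h.velocity_H1.1 _).2.1
  · simp only [toPath]
    rw [clamp_eq (by simp)]
    exact (h.velocity_H1.1 _).2.2
  · filter_upwards [hH2] with t ht
    obtain ⟨g, hg, h1, h2, -⟩ := toPath_uxx_ae (ρ := ρ) ht
    exact ⟨hg.memL2_deriv.ae_eq h2, g, hg.acPair.congr h01 (fun _ _ => rfl) h2,
      ae_Ioo_of_forall h1⟩
  · rw [intervalIntegrable_iff_integrableOn_Ioc_of_le hT]
    refine ⟨(measurable_nrm_sq muxx).aestronglyMeasurable, ?_⟩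
    refine lt_of_le_of_lt ?_ (h.velocity_H2.2 T.toNNReal)
    rw [Real.coe_toNNReal T hT]
    refine (le_of_eq (lintegral_congr_ae ?_)).trans
      (lintegral_mono_set (Ioc_subset_Icc_self (a := (0 : ℝ)) (b := T)))
    filter_upwards [hH2] with t ht
    obtain ⟨g, hg, h1, h2, h3⟩ := toPath_uxx_ae (ρ := ρ) ht
    have hm : MemL2 ((toPath ρ u).uxx t) := hg.memL2_deriv.ae_eq h2
    rw [← unitVol_eq] at h3
    rw [eLpNorm_congr_ae h3, eLpNorm_eq_nrm hm, enorm_pow,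
      Real.enorm_of_nonneg (nrm_nonneg _)]

end

end CNSE

namespace CNSE

noncomputable section

/-! ### From the weak formulation to pointwise equations -/

open Classical in
/-- A countable family of test functions. -/
def bumpTest (i : ℚ × ℚ × ℚ) : ℝ → ℝ :=
  if h : (0 : ℝ) < i.2.1 ∧ (i.2.1 : ℝ) < i.2.2 ∧ (0 : ℝ) < i.1 - i.2.2 ∧ (i.1 + i.2.2 : ℝ) < 1 then
    (⟨i.2.1, i.2.2, h.1, h.2.1⟩ : ContDiffBump (i.1 : ℝ))
  else 0

lemma isTestFunction_bumpTest (i : ℚ × ℚ × ℚ) : IsTestFunction (bumpTest i) := by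
  unfold bumpTest
  split_ifs with h
  · refine ⟨ContDiffBump.contDiff _, ContDiffBump.hasCompactSupport _, ?_⟩
    rw [ContDiffBump.tsupport_eq, Real.closedBall_eq_Icc]
    exact Icc_subset_Ioo h.2.2.1 h.2.2.2
  · exact ⟨contDiff_const, HasCompactSupport.zero, by
      rw [show tsupport (0 : ℝ → ℝ) = ∅ by simp [tsupport]]; exact empty_subset _⟩

namespace IsTestFunction

variable {φ : ℝ → ℝ}

lemma continuous (h : IsTestFunction φ) : Continuous φ := h.1.continuous

lemma zero_of_notMem (h : IsTestFunction φ) {x : ℝ} (hx : x ∉ Ioo (0 : ℝ) 1) : φ x = 0 := by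
  by_contra hne
  exact hx (h.2.2 (subset_tsupport φ hne))

lemma acPair (h : IsTestFunction φ) : ACPair 1 φ (deriv φ) := by
  refine ACPair.of_ac zero_le_one (h.1.of_le (by simp)).contDiffOn.absolutelyContinuousOnInterval ?_
  exact Eventually.of_forall fun x _ => ((h.1.differentiable (by simp)) x).hasDerivAt

/-- Integration by parts against a test function. -/
lemma integral_mul_deriv (h : IsTestFunction φ) {f f' : ℝ → ℝ} (hf : ACPair 1 f f') :
    ∫ x in (0 : ℝ)..1, f x * deriv φ x = -∫ x in (0 : ℝ)..1, f' x * φ x := by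
  have h01 := zero_le_one (α := ℝ)
  have h1 := (hf.mul h01 h.acPair).integral_eq h01
  have cf := hf.continuousOn h01
  rw [← uIcc_of_le h01] at cf
  rw [intervalIntegral.integral_add (hf.integrable.mul_continuousOn h.continuous.continuousOn)
    (h.acPair.integrable.continuousOn_mul cf), h.zero_of_notMem (x := 0) (by simp),
    h.zero_of_notMem (x := 1) (by simp)] at h1
  linarith

end IsTestFunction

lemma continuous_bumpTest (i : ℚ × ℚ × ℚ) : Continuous (bumpTest i) :=
  (isTestFunction_bumpTest i).continuous

lemma abs_bumpTest_le (i : ℚ × ℚ × ℚ) (x : ℝ) : |bumpTest i x| ≤ 1 := by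
  unfold bumpTest
  split_ifs with h
  · rw [abs_of_nonneg (ContDiffBump.nonneg _)]
    exact ContDiffBump.le_one _
  · simp

lemma bumpTest_eq {i : ℚ × ℚ × ℚ} (h : (0 : ℝ) < i.2.1 ∧ (i.2.1 : ℝ) < i.2.2 ∧
    (0 : ℝ) < i.1 - i.2.2 ∧ (i.1 + i.2.2 : ℝ) < 1) {c : ℝ} (f : ContDiffBump c) (hc : c = i.1)
    (h1 : f.rIn = i.2.1) (h2 : f.rOut = i.2.2) (x : ℝ) : bumpTest i x = f x := by
  subst hc
  obtain ⟨r, R, hr, hR⟩ := f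
  dsimp only at h1 h2
  subst h1 h2
  rw [bumpTest, dif_pos h]

/-- The test functions separate integrable functions. -/
lemma ae_eq_zero_of_integral_bumpTest {h : ℝ → ℝ} (hh : IntervalIntegrable h volume 0 1)
    (H : ∀ i, ∫ x in (0 : ℝ)..1, h x * bumpTest i x = 0) :
    ∀ᵐ x ∂volume.restrict (Ioc (0 : ℝ) 1), h x = 0 := by
  have h01 := zero_le_one (α := ℝ)
  -- integrals over rational intervals vanish
  have h1 : ∀ a b : ℚ, (0 : ℝ) < a → (a : ℝ) < b → (b : ℝ) < 1 → ∫ x in (a : ℝ)..b, h x = 0 := by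
    intro a b ha hab hb
    obtain ⟨ε, hε, hεa, hεb⟩ : ∃ ε : ℚ, 0 < ε ∧ ε < a ∧ ε < 1 - b := by
      have ha' : (0 : ℚ) < a := by exact_mod_cast ha
      have hb' : (0 : ℚ) < 1 - b := by have : b < 1 := by exact_mod_cast hb
                                       linarith
      exact ⟨min a (1 - b) / 2, by positivity, by linarith [min_le_left a (1 - b)],
        by linarith [min_le_right a (1 - b)]⟩
    -- These bumps equal 1 on [a,b] and vanish at distance ε/(n+1) from it, so they converge
    -- pointwise to the indicator of [a,b]. The choice of ε keeps all supports inside (0,1).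
    set idx : ℕ → ℚ × ℚ × ℚ := fun n => ((a + b) / 2, (b - a) / 2, (b - a) / 2 + ε / (n + 1))
      with hidx
    have hε' : (0 : ℝ) < ε := by exact_mod_cast hε
    have hεa' : (ε : ℝ) < a := by exact_mod_cast hεa
    have hεb' : (ε : ℝ) < 1 - b := by exact_mod_cast hεb
    have hle : ∀ n : ℕ, (ε : ℝ) / (n + 1) ≤ ε := fun n => div_le_self hε'.le (by simp)
    have hval : ∀ n : ℕ, ∃ f : ContDiffBump (((a : ℝ) + b) / 2), f.rIn = ((b : ℝ) - a) / 2 ∧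
        f.rOut = ((b : ℝ) - a) / 2 + ε / (n + 1) ∧ ∀ x, bumpTest (idx n) x = f x := by
      intro n
      have hc : ((((a + b) / 2 : ℚ)) : ℝ) = ((a : ℝ) + b) / 2 := by push_cast; ring
      have hcond : (0 : ℝ) < ((idx n).2.1 : ℝ) ∧ ((idx n).2.1 : ℝ) < (idx n).2.2 ∧
          (0 : ℝ) < (idx n).1 - (idx n).2.2 ∧ ((idx n).1 + (idx n).2.2 : ℝ) < 1 := by
        have := hle n
        have : (0 : ℝ) < ε / (n + 1) := by positivity
        simp only [hidx]
        push_cast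
        refine ⟨by linarith, by linarith, by linarith, by linarith⟩
      refine ⟨⟨((b : ℝ) - a) / 2, ((b : ℝ) - a) / 2 + ε / (n + 1), by linarith, by
        have : (0 : ℝ) < ε / (n + 1) := by positivity
        linarith⟩, rfl, rfl, fun x => ?_⟩
      exact bumpTest_eq hcond _ hc.symm (by simp [hidx]) (by simp [hidx]) x
    have hlim : Tendsto (fun n => ∫ x in (0 : ℝ)..1, h x * bumpTest (idx n) x) atTop
        (𝓝 (∫ x in (0 : ℝ)..1, (Icc (a : ℝ) b).indicator h x)) := by
      refine intervalIntegral.tendsto_integral_filter_of_dominated_convergence (fun x => |h x|)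
        (Eventually.of_forall fun n => ?_) (Eventually.of_forall fun n => ?_) hh.abs ?_
      · rw [uIoc_of_le h01]
        rw [intervalIntegrable_iff_integrableOn_Ioc_of_le h01] at hh
        exact hh.aestronglyMeasurable.mul (continuous_bumpTest _).aestronglyMeasurable
      · refine Eventually.of_forall fun x _ => ?_
        rw [norm_mul]
        exact mul_le_of_le_one_right (abs_nonneg _) (abs_bumpTest_le _ x)
      · refine Eventually.of_forall fun x _ => ?_
        by_cases hx : x ∈ Icc (a : ℝ) b
        · rw [indicator_of_mem hx]
          refine tendsto_const_nhds.congr fun n => ?_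
          obtain ⟨f, hf1, hf2, hf3⟩ := hval n
          rw [hf3, f.one_of_mem_closedBall, mul_one]
          rw [hf1, Real.closedBall_eq_Icc]
          constructor <;> linarith [hx.1, hx.2]
        · rw [indicator_of_notMem hx]
          refine tendsto_const_nhds.congr' ?_
          have hd : ((b : ℝ) - a) / 2 < |x - ((a : ℝ) + b) / 2| := by
            by_contra! hcon
            rw [abs_le] at hcon
            exact hx ⟨by linarith, by linarith⟩
          have ht : Tendsto (fun n : ℕ => ((b : ℝ) - a) / 2 + ε / ((n : ℝ) + 1)) atTop
              (𝓝 (((b : ℝ) - a) / 2 + 0)) := by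
            refine tendsto_const_nhds.add ?_
            have := tendsto_one_div_add_atTop_nhds_zero_nat.const_mul (ε : ℝ)
            simpa [div_eq_mul_inv] using this
          rw [add_zero] at ht
          filter_upwards [ht.eventually (Iio_mem_nhds hd)] with n hn
          obtain ⟨f, hf1, hf2, hf3⟩ := hval n
          rw [hf3, f.zero_of_le_dist, mul_zero]
          rw [hf2, Real.dist_eq]
          exact (mem_Iio.1 hn).le
    have hz : ∫ x in (0 : ℝ)..1, (Icc (a : ℝ) b).indicator h x = 0 :=
      tendsto_nhds_unique hlim (by simp only [H]; exact tendsto_const_nhds)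
    rw [intervalIntegral.integral_of_le h01, setIntegral_indicator measurableSet_Icc] at hz
    rw [intervalIntegral.integral_of_le hab.le, ← integral_Icc_eq_integral_Ioc, ← hz]
    congr 2
    ext x
    simp only [mem_inter_iff, mem_Ioc, mem_Icc]
    exact ⟨fun h => ⟨⟨ha.trans_le h.1, h.2.trans hb.le⟩, h⟩, fun h => h.2⟩
  -- hence the primitive is constant
  have hp := ACPair.primitive hh
  have hcont := hp.continuousOn h01
  obtain ⟨q₀, hq₀, hq₀'⟩ := exists_rat_btwn (zero_lt_one (α := ℝ))
  have hconst : ∀ x ∈ Ioo (0 : ℝ) 1, ∫ t in (0 : ℝ)..x, h t = ∫ t in (0 : ℝ)..q₀, h t := by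
    have hrat : ∀ a : ℚ, (a : ℝ) ∈ Ioo (0 : ℝ) 1 →
        ∫ t in (0 : ℝ)..a, h t = ∫ t in (0 : ℝ)..q₀, h t := by
      intro a ha
      have hs : ∀ b c : ℚ, (b : ℝ) ∈ Ioo (0 : ℝ) 1 → (c : ℝ) ∈ Ioo (0 : ℝ) 1 → (b : ℝ) < c →
          ∫ t in (0 : ℝ)..c, h t = ∫ t in (0 : ℝ)..b, h t := fun b c hb hc hbc => by
        have := hp.sub_eq (Ioo_subset_Icc_self hb) (Ioo_subset_Icc_self hc)
        rw [h1 b c hb.1 hbc hc.2] at this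
        linarith
      rcases lt_trichotomy (a : ℝ) q₀ with h | h | h
      · exact (hs a q₀ ha ⟨hq₀, hq₀'⟩ h).symm
      · rw [h]
      · exact hs q₀ a ⟨hq₀, hq₀'⟩ ha h
    intro x hx
    by_contra hne
    have hca : ContinuousAt (fun x => ∫ t in (0 : ℝ)..x, h t) x :=
      hcont.continuousAt (Icc_mem_nhds hx.1 hx.2)
    have hev : ∀ᶠ y in 𝓝 x, y ∈ Ioo (0 : ℝ) 1 ∧ ∫ t in (0 : ℝ)..y, h t ≠ ∫ t in (0 : ℝ)..q₀, h t :=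
      Filter.Eventually.and (isOpen_Ioo.mem_nhds hx : ∀ᶠ y in 𝓝 x, y ∈ Ioo (0 : ℝ) 1) (hca.eventually_ne hne)
    obtain ⟨_, ⟨a, rfl⟩, hy⟩ := Rat.denseRange_cast.inter_nhds_nonempty hev
    exact hy.2 (hrat a hy.1)
  rw [← unitVol_eq, unitVol]
  filter_upwards [ae_restrict_mem measurableSet_Ioo, ae_restrict_of_ae (hp.hasDerivAt h01)]
    with x hx hd
  have h2 : HasDerivAt (fun x => ∫ t in (0 : ℝ)..x, h t) 0 x := by
    refine (hasDerivAt_const x (∫ t in (0 : ℝ)..q₀, h t)).congr_of_eventuallyEq ?_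
    filter_upwards [isOpen_Ioo.mem_nhds hx] with y hy using hconst y hy
  exact (hd hx).unique h2

/-- A weak identity with a time integral holds pointwise. -/
lemma ae_eq_zero_of_weak {t : ℝ} (ht : 0 ≤ t) {a : ℝ → ℝ} {g : ℝ → ℝ → ℝ}
    (ha : IntervalIntegrable a volume 0 1)
    (hg : Integrable (fun z : ℝ × ℝ => g z.1 z.2) (stripVol t))
    (H : ∀ i, (∫ x in (0 : ℝ)..1, a x * bumpTest i x)
      + ∫ s in (0 : ℝ)..t, ∫ x in (0 : ℝ)..1, g s x * bumpTest i x = 0) :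
    ∀ᵐ x ∂volume.restrict (Ioc (0 : ℝ) 1), a x + ∫ s in (0 : ℝ)..t, g s x = 0 := by
  have h01 := zero_le_one (α := ℝ)
  have hi : IntervalIntegrable (fun x => ∫ s in (0 : ℝ)..t, g s x) volume 0 1 := by
    rw [intervalIntegrable_iff_integrableOn_Ioc_of_le h01]
    simp only [intervalIntegral.integral_of_le ht]
    exact hg.integral_prod_right
  refine ae_eq_zero_of_integral_bumpTest (ha.add hi) fun i => ?_
  have hgφ : Integrable (fun z : ℝ × ℝ => g z.1 z.2 * bumpTest i z.2) (stripVol t) :=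
    hg.mul_bdd (c := 1) ((continuous_bumpTest i).comp continuous_snd).aestronglyMeasurable
      (Eventually.of_forall fun z => abs_bumpTest_le i z.2)
  refine Eq.trans ?_ (H i)
  have e1 : ∫ s in (0 : ℝ)..t, ∫ x in (0 : ℝ)..1, g s x * bumpTest i x
      = ∫ x in (0 : ℝ)..1, (∫ s in (0 : ℝ)..t, g s x) * bumpTest i x := by
    simp only [intervalIntegral.integral_of_le ht, intervalIntegral.integral_of_le h01,
      ← integral_mul_const]
    exact integral_integral_swap hgφ
  rw [e1, ← intervalIntegral.integral_add (ha.mul_continuousOn (continuous_bumpTest i).continuousOn)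
    (hi.mul_continuousOn (continuous_bumpTest i).continuousOn)]
  simp only [add_mul]

lemma eq_zero_of_rat {T : ℕ} {f : ℝ → ℝ} (hf : ContinuousOn f (Icc 0 T))
    (h : ∀ q : ℚ, (q : ℝ) ∈ Icc (0 : ℝ) T → f q = 0) : ∀ t ∈ Icc (0 : ℝ) T, f t = 0 := by
  have hT : (0 : ℝ) ≤ T := T.cast_nonneg
  have hc : Continuous fun t => f (max 0 (min t T)) := hf.comp_continuous (by fun_prop)
    fun t => ⟨le_max_left _ _, max_le hT (min_le_right _ _)⟩
  have := hc.ext_on Rat.denseRange_cast (continuous_const (y := (0 : ℝ))) (by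
    rintro _ ⟨q, rfl⟩
    have e : max 0 (min (q : ℝ) T) = ((max 0 (min q T) : ℚ) : ℝ) := by push_cast; rfl
    simp only [e]
    exact h _ (by rw [← e]; exact ⟨le_max_left _ _, max_le hT (min_le_right _ _)⟩))
  intro t ht
  have := congrFun this t
  simpa [min_eq_left ht.2, max_eq_right ht.1] using this

lemma integrable_strip_of_nrm_le {T : ℝ} (hT : 0 ≤ T) {f : ℝ → ℝ → ℝ} {c : ℝ → ℝ}
    (hf : Measurable fun z : ℝ × ℝ => f z.1 z.2) (hc : IntervalIntegrable c volume 0 T)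
    (h : ∀ᵐ t ∂volume.restrict (Ioc 0 T), MemL2 (f t) ∧ nrm (f t) ≤ c t) :
    Integrable (fun z : ℝ × ℝ => f z.1 z.2) (stripVol T) := by
  refine (integrable_prod_iff hf.aestronglyMeasurable).2 ⟨?_, ?_⟩
  · filter_upwards [h] with t ht
    have := ht.1.integrable'
    rwa [intervalIntegrable_iff_integrableOn_Ioc_of_le zero_le_one] at this
  · rw [intervalIntegrable_iff_integrableOn_Ioc_of_le hT] at hc
    refine hc.mono' (hf.norm.stronglyMeasurable.integral_prod_right
      (ν := volume.restrict (Ioc (0 : ℝ) 1))).aestronglyMeasurable ?_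
    filter_upwards [h] with t ht
    rw [Real.norm_of_nonneg (integral_nonneg fun _ => norm_nonneg _)]
    have := (integral_abs_le_nrm ht.1).trans ht.2
    rwa [intervalIntegral.integral_of_le zero_le_one] at this

namespace IsRegular

variable {T : ℝ} {p : Path}

lemma integrable_ρx (hT : 0 ≤ T) (h : IsRegular T p) :
    Integrable (fun z : ℝ × ℝ => p.ρx z.1 z.2) (stripVol T) := by
  obtain ⟨C, hC⟩ := h.bound
  exact integrable_strip_of_nrm_le hT h.meas_ρx (intervalIntegrable_const (c := C))
    (ae_Icc_of_ae fun t ht => ⟨(hC t ht).1, (hC t ht).2.2.1⟩)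

lemma integrable_ux (hT : 0 ≤ T) (h : IsRegular T p) :
    Integrable (fun z : ℝ × ℝ => p.ux z.1 z.2) (stripVol T) := by
  obtain ⟨C, hC⟩ := h.bound
  exact integrable_strip_of_nrm_le hT h.meas_ux (intervalIntegrable_const (c := C))
    (ae_Icc_of_ae fun t ht => ⟨(hC t ht).2.1, (hC t ht).2.2.2⟩)

lemma integrable_uxx (hT : 0 ≤ T) (h : IsRegular T p) :
    Integrable (fun z : ℝ × ℝ => p.uxx z.1 z.2) (stripVol T) := by
  refine integrable_strip_of_nrm_le hT h.meas_uxx ((intervalIntegrable_const (c := 1)).add h.uxx_int) ?_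
  filter_upwards [h.ac_ux] with t ht
  exact ⟨ht.1, by nlinarith [sq_nonneg (nrm (p.uxx t) - 1)]⟩

lemma integrable_flux (hT : 0 ≤ T) (h : IsRegular T p) : Integrable (fun z : ℝ × ℝ =>
    p.ρx z.1 z.2 * p.u z.1 z.2 + p.ρ z.1 z.2 * p.ux z.1 z.2) (stripVol T) := by
  refine Integrable.add ?_ (Integrable.strip_mul_continuous h.cont_ρ (h.integrable_ux hT))
  simpa only [mul_comm] using Integrable.strip_mul_continuous h.cont_u (h.integrable_ρx hT)

lemma continuous_ρ (h : IsRegular T p) (t : ℝ) : Continuous (p.ρ t) :=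
  h.cont_ρ.comp (by fun_prop : Continuous fun x => (t, x))

lemma continuous_u (h : IsRegular T p) (t : ℝ) : Continuous (p.u t) :=
  h.cont_u.comp (by fun_prop : Continuous fun x => (t, x))

end IsRegular

lemma ae_strip_integrable {T : ℝ} {g : ℝ → ℝ → ℝ} (hT : 0 ≤ T)
    (hg : Integrable (fun z : ℝ × ℝ => g z.1 z.2) (stripVol T)) :
    ∀ᵐ x ∂volume.restrict (Ioc (0 : ℝ) 1), IntervalIntegrable (fun t => g t x) volume 0 T := by
  filter_upwards [hg.prod_left_ae] with x hx
  rwa [intervalIntegrable_iff_integrableOn_Ioc_of_le hT]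

/-- The weak continuity equation yields a strip path. -/
lemma IsTrajectory.isStripPath {ρ u : ℝ≥0 → ℝ → ℝ} (h : IsTrajectory ρ u)
    (hc : ∀ i, ∀ q : ℚ, (∫ x in (0 : ℝ)..1, ρ (q : ℝ).toNNReal x * bumpTest i x)
      - (∫ x in (0 : ℝ)..1, ρ 0 x * bumpTest i x)
      - (∫ s in (0 : ℝ)..(q : ℝ).toNNReal, ∫ x in (0 : ℝ)..1,
          ρ s.toNNReal x * u s.toNNReal x * deriv (bumpTest i) x) = 0) (T : ℕ) :
    IsStripPath T (toPath ρ u) := by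
  have h01 := zero_le_one (α := ℝ)
  have hT : (0 : ℝ) ≤ T := T.cast_nonneg
  have hp := h.isRegular hT
  refine ⟨hp, (hp.integrable_flux hT).neg, ?_⟩
  set p := toPath ρ u with hpdef
  have hρ : ∀ t, ∀ x ∈ uIcc (0 : ℝ) 1, ρ t.toNNReal x = p.ρ t x := fun t x hx => by
    rw [uIcc_of_le h01] at hx
    simp only [hpdef, toPath, clamp_eq hx]
  have hu : ∀ t, ∀ x ∈ uIcc (0 : ℝ) 1, u t.toNNReal x = p.u t x := fun t x hx => by
    rw [uIcc_of_le h01] at hx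
    simp only [hpdef, toPath, clamp_eq hx]
  have key : ∀ q : ℚ, (q : ℝ) ∈ Icc (0 : ℝ) T → ∀ᵐ x ∂volume.restrict (Ioc (0 : ℝ) 1),
      (p.ρ q x - p.ρ 0 x)
        + ∫ s in (0 : ℝ)..q, (p.ρx s x * p.u s x + p.ρ s x * p.ux s x) = 0 := by
    intro q hq
    have c1 := hp.continuous_ρ q
    have c2 := hp.continuous_ρ 0
    refine ae_eq_zero_of_weak hq.1 (Continuous.intervalIntegrable (by fun_prop) _ _)
      ((hp.integrable_flux hT).mono_measure (stripVol_mono hq.2)) fun i => ?_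
    have e := hc i q
    rw [Real.coe_toNNReal _ hq.1] at e
    have e1 : ∫ s in (0 : ℝ)..q, ∫ x in (0 : ℝ)..1,
          ρ s.toNNReal x * u s.toNNReal x * deriv (bumpTest i) x
        = -∫ s in (0 : ℝ)..q, ∫ x in (0 : ℝ)..1,
          (p.ρx s x * p.u s x + p.ρ s x * p.ux s x) * bumpTest i x := by
      rw [← intervalIntegral.integral_neg]
      refine intervalIntegral.integral_congr fun s hs => ?_
      rw [uIcc_of_le hq.1] at hs
      have hs' : s ∈ Icc (0 : ℝ) T := ⟨hs.1, hs.2.trans hq.2⟩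
      rw [← (isTestFunction_bumpTest i).integral_mul_deriv
        ((hp.ac_ρ s hs').mul h01 (hp.ac_u s hs'))]
      refine intervalIntegral.integral_congr fun x hx => ?_
      simp only [hρ s x hx, hu s x hx]
    have e2 : ∫ x in (0 : ℝ)..1, ρ (q : ℝ).toNNReal x * bumpTest i x
        = ∫ x in (0 : ℝ)..1, p.ρ q x * bumpTest i x :=
      intervalIntegral.integral_congr fun x hx => by simp only [hρ q x hx]
    have e3 : ∫ x in (0 : ℝ)..1, ρ 0 x * bumpTest i x
        = ∫ x in (0 : ℝ)..1, p.ρ 0 x * bumpTest i x :=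
      intervalIntegral.integral_congr fun x hx => by simp only [← hρ 0 x hx, Real.toNNReal_zero]
    have cb := continuous_bumpTest i
    simp only [sub_mul]
    rw [intervalIntegral.integral_sub (Continuous.intervalIntegrable (by fun_prop) _ _)
      (Continuous.intervalIntegrable (by fun_prop) _ _), ← e2, ← e3]
    rw [e1] at e
    linarith
  -- The null set of x may depend on the time. It is removed for all rational times at once, and
  -- continuity of both sides in time gives the remaining times.
  filter_upwards [ae_all_iff.2 fun q : ℚ => ae_all_iff.2 fun hq => key q hq,
    ae_strip_integrable (g := fun t x => p.ρx t x * p.u t x + p.ρ t x * p.ux t x) hT (hp.integrable_flux hT)] with x hx hi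
  have hac := ACPair.primitive hi
  have hct : Continuous fun t => p.ρ t x := hp.cont_ρ.comp (by fun_prop : Continuous fun t => (t, x))
  have := eq_zero_of_rat (f := fun t => (p.ρ t x - p.ρ 0 x)
    + ∫ s in (0 : ℝ)..t, (p.ρx s x * p.u s x + p.ρ s x * p.ux s x))
    ((hct.continuousOn.sub continuousOn_const).add (hac.continuousOn hT)) hx
  refine ⟨hi.neg, fun t ht => ?_⟩
  have := this t ht
  rw [intervalIntegral.integral_neg]
  linarith

/-- The drift of the momentum in the presence of the noise `ζ`. -/
def momentumDrift (A : ℝ) (p : Path) (ζ : ℝ → ℝ → ℝ) (t x : ℝ) : ℝ :=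
  (p.ρx t x * p.u t x + p.ρ t x * p.ux t x) * p.u t x + p.ρ t x * p.u t x * p.ux t x
    + A ^ 2 * p.ρx t x - p.uxx t x - (p.ρx t x * p.u t x + p.ρ t x * p.ux t x) * ζ t x

/-- The momentum equation at time `t`, tested against the family of test functions. -/
def WeakMomentum (A : ℝ) (p : Path) (ζ : ℝ → ℝ → ℝ) (t : ℝ) : Prop :=
  ∀ i, (∫ x in (0 : ℝ)..1, (p.ρ t x * (p.u t x - ζ t x) - p.ρ 0 x * p.u 0 x) * bumpTest i x)
    + ∫ s in (0 : ℝ)..t, ∫ x in (0 : ℝ)..1, momentumDrift A p ζ s x * bumpTest i x = 0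

/-- The noise term in the drift is integrable. -/
def NoiseIntegrable (T : ℝ) (p : Path) (ζ : ℝ → ℝ → ℝ) : Prop :=
  Integrable (fun z : ℝ × ℝ =>
    (p.ρx z.1 z.2 * p.u z.1 z.2 + p.ρ z.1 z.2 * p.ux z.1 z.2) * ζ z.1 z.2) (stripVol T)

lemma IsRegular.integrable_momentumDrift {T A : ℝ} (hT : 0 ≤ T) {p : Path} (hp : IsRegular T p)
    {ζ : ℝ → ℝ → ℝ} (hζ : NoiseIntegrable T p ζ) :
    Integrable (fun z : ℝ × ℝ => momentumDrift A p ζ z.1 z.2) (stripVol T) := by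
  have h1 := Integrable.strip_mul_continuous (f := p.u) (g := fun t x => p.ρx t x * p.u t x + p.ρ t x * p.ux t x) hp.cont_u (hp.integrable_flux hT)
  have h2 := Integrable.strip_mul_continuous (f := fun t x => p.ρ t x * p.u t x)
    (hp.cont_ρ.mul hp.cont_u) (hp.integrable_ux hT)
  have := (((h1.add h2).add ((hp.integrable_ρx hT).const_mul (A ^ 2))).sub
    (hp.integrable_uxx hT)).sub hζ
  refine this.congr (Eventually.of_forall fun z => ?_)
  simp only [momentumDrift, Pi.add_apply, Pi.sub_apply]
  ring

lemma IsRegular.integrable_acc {T A : ℝ} (hT : 0 ≤ T) {p : Path} (hp : IsRegular T p)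
    (hpos : ∀ t x, 0 < p.ρ t x) :
    Integrable (fun z : ℝ × ℝ => acc A p z.1 z.2) (stripVol T) := by
  have hc : Continuous fun z : ℝ × ℝ => (p.ρ z.1 z.2)⁻¹ :=
    hp.cont_ρ.inv₀ fun z => (hpos z.1 z.2).ne'
  have h1 := Integrable.strip_mul_continuous hp.cont_u (hp.integrable_ux hT)
  have h2 := Integrable.strip_mul_continuous (f := fun t x => (p.ρ t x)⁻¹) hc (hp.integrable_ρx hT)
  have h3 := Integrable.strip_mul_continuous (f := fun t x => (p.ρ t x)⁻¹) hc (hp.integrable_uxx hT)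
  refine ((h1.neg.sub (h2.const_mul (A ^ 2))).add h3).congr (Eventually.of_forall fun z => ?_)
  simp only [acc, Pi.add_apply, Pi.sub_apply, Pi.neg_apply]
  ring

/-- For almost every `x` the velocity minus the noise is absolutely continuous in time. -/
lemma exists_velocity_acPair {T : ℕ} {A : ℝ} {p : Path} (hp : IsStripPath T p)
    (hpos : ∀ t x, 0 < p.ρ t x) {ζ : ℝ → ℝ → ℝ} (hζ : NoiseIntegrable T p ζ)
    (hζm : AEMeasurable (fun z : ℝ × ℝ => ζ z.1 z.2) (stripVol T))
    (hζi : ∀ t, IntervalIntegrable (ζ t) volume 0 1)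
    (hrat : ∀ q : ℚ, (q : ℝ) ∈ Icc (0 : ℝ) T → WeakMomentum A p ζ q)
    (hae : ∀ᵐ t ∂volume.restrict (Ioc (0 : ℝ) T), WeakMomentum A p ζ t) :
    ∀ᵐ x ∂volume.restrict (Ioc (0 : ℝ) 1), ∃ V : ℝ → ℝ, ACPair T V (fun t => acc A p t x) ∧
      ∀ q : ℚ, (q : ℝ) ∈ Icc (0 : ℝ) T → V q = p.u q x - ζ q x := by
  have h01 := zero_le_one (α := ℝ)
  have hT : (0 : ℝ) ≤ T := T.cast_nonneg
  have hG := hp.toIsRegular.integrable_momentumDrift (A := A) hT hζ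
  have key : ∀ t ∈ Icc (0 : ℝ) T, WeakMomentum A p ζ t → ∀ᵐ x ∂volume.restrict (Ioc (0 : ℝ) 1),
      p.ρ t x * (p.u t x - ζ t x) - p.ρ 0 x * p.u 0 x
        + ∫ s in (0 : ℝ)..t, momentumDrift A p ζ s x = 0 := by
    intro t ht hw
    refine ae_eq_zero_of_weak ht.1 ?_ (hG.mono_measure (stripVol_mono ht.2)) hw
    have c1 := hp.continuous_ρ t
    have c2 := hp.continuous_u t
    have c3 := hp.continuous_ρ 0
    have c4 := hp.continuous_u 0
    exact (((c2.intervalIntegrable _ _).sub (hζi t)).continuousOn_mul c1.continuousOn).sub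
      (Continuous.intervalIntegrable (by fun_prop) _ _)
  -- the identity holds almost everywhere on the strip
  have hN : AEMeasurable (fun z : ℝ × ℝ => ∫ s in (0 : ℝ)..z.1, momentumDrift A p ζ s z.2)
      (stripVol T) := by
    have hG' := hG.aestronglyMeasurable.aemeasurable
    set g := hG'.mk _
    have hgm : Measurable g := hG'.measurable_mk
    have h1 : Measurable fun z : ℝ × ℝ => ∫ s in Ioc (0 : ℝ) T,
        ({w : (ℝ × ℝ) × ℝ | w.2 ≤ w.1.1}).indicator (fun w => g (w.2, w.1.2)) (z, s) := by
      refine (StronglyMeasurable.integral_prod_right (ν := volume.restrict (Ioc (0 : ℝ) T))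
        (Measurable.stronglyMeasurable ?_)).measurable
      exact (hgm.comp (by fun_prop : Measurable fun w : (ℝ × ℝ) × ℝ => (w.2, w.1.2))).indicator
        (measurableSet_le (by fun_prop) (by fun_prop))
    refine ⟨_, h1, ?_⟩
    have h2 : ∀ᵐ x ∂volume.restrict (Ioc (0 : ℝ) 1), ∀ᵐ t ∂volume.restrict (Ioc (0 : ℝ) T),
        momentumDrift A p ζ t x = g (t, x) :=
      ae_strip_swap (p := fun t x => momentumDrift A p ζ t x = g (t, x)) hG'.ae_eq_mk
    have h3 : ∀ᵐ z ∂stripVol T, ∀ᵐ t ∂volume.restrict (Ioc (0 : ℝ) T),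
        momentumDrift A p ζ t z.2 = g (t, z.2) :=
      Measure.quasiMeasurePreserving_snd.ae h2
    filter_upwards [h3, ae_stripVol_mem T] with z hz hmem
    have e : (fun s => ({w : (ℝ × ℝ) × ℝ | w.2 ≤ w.1.1}).indicator (fun w => g (w.2, w.1.2)) (z, s))
        = (Iic z.1).indicator fun s => g (s, z.2) := by
      funext s
      simp only [indicator, mem_ofPred_eq, mem_Iic]
    rw [e, setIntegral_indicator measurableSet_Iic, intervalIntegral.integral_of_le hmem.1.1.le]
    have e2 : Ioc (0 : ℝ) T ∩ Iic z.1 = Ioc 0 z.1 := by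
      ext s
      simp only [mem_inter_iff, mem_Ioc, mem_Iic]
      exact ⟨fun h => ⟨h.1.1, h.2⟩, fun h => ⟨⟨h.1, h.2.trans hmem.1.2⟩, h.2⟩⟩
    rw [e2]
    exact integral_congr_ae (ae_mono (Measure.restrict_mono (Ioc_subset_Ioc_right hmem.1.2) le_rfl) hz)
  -- The identity is available for almost every t and then almost every x. The order is exchanged
  -- through the strip, because below x is fixed and the identity is needed for almost every t.
  have hstrip : ∀ᵐ z ∂stripVol T, p.ρ z.1 z.2 * (p.u z.1 z.2 - ζ z.1 z.2) - p.ρ 0 z.2 * p.u 0 z.2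
      = -∫ s in (0 : ℝ)..z.1, momentumDrift A p ζ s z.2 := by
    have c1 := hp.cont_ρ.measurable
    have c2 := hp.cont_u.measurable
    have c3 := (hp.continuous_ρ 0).measurable
    have c4 := (hp.continuous_u 0).measurable
    refine ae_strip_of_ae_ae
      (f := fun t x => p.ρ t x * (p.u t x - ζ t x) - p.ρ 0 x * p.u 0 x)
      (g := fun t x => -∫ s in (0 : ℝ)..t, momentumDrift A p ζ s x) ?_ hN.neg ?_
    · exact (c1.aemeasurable.mul (c2.aemeasurable.sub hζm)).sub
        (by fun_prop : Measurable fun z : ℝ × ℝ => p.ρ 0 z.2 * p.u 0 z.2).aemeasurable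
    · filter_upwards [hae, ae_restrict_mem measurableSet_Ioc] with t ht htT
      filter_upwards [key t (Ioc_subset_Icc_self htT) ht] with x hx
      linarith
  obtain ⟨C₁, hC₁, hρC⟩ := exists_bound_strip hp.cont_ρ T
  obtain ⟨C₂, hC₂, hρC'⟩ := exists_bound_strip (f := fun t x => (p.ρ t x)⁻¹)
    (hp.cont_ρ.inv₀ fun z => (hpos z.1 z.2).ne') T
  filter_upwards [ae_all_iff.2 fun q : ℚ => ae_all_iff.2 fun hq => key q hq (hrat q hq),
    ae_strip_integrable hT hG, hp.continuity.ac, ae_restrict_mem measurableSet_Ioc,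
    ae_strip_swap (p := fun t x => p.ρ t x * (p.u t x - ζ t x) - p.ρ 0 x * p.u 0 x
      = -∫ s in (0 : ℝ)..t, momentumDrift A p ζ s x) hstrip] with x hx hi hρ hx1 hs
  have hx1' := Ioc_subset_Icc_self hx1
  have hinv := hρ.comp hT (G := fun y => y⁻¹) (G' := fun y => -(y ^ 2)⁻¹) (m := C₂⁻¹) (M := C₁)
    (fun t ht => ⟨by
      have := hρC' t ht x hx1'
      rw [abs_of_pos (inv_pos.2 (hpos t x))] at this
      exact (inv_le_comm₀ hC₂ (hpos t x)).2 this, (le_abs_self _).trans (hρC t ht x hx1')⟩)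
    (fun y hy => hasDerivAt_inv ((inv_pos.2 hC₂).trans_le hy.1).ne')
    (((continuousOn_id.pow 2).inv₀ fun y hy =>
      pow_ne_zero 2 ((inv_pos.2 hC₂).trans_le hy.1).ne').neg)
  -- V is the integrated momentum divided by the density. It is absolutely continuous in time
  -- although nothing is known about the regularity in time of ζ.
  have hV := ((ACPair.const (b := T) (p.ρ 0 x * p.u 0 x)).sub hT (ACPair.primitive hi)).mul hT hinv
  refine ⟨fun t => (p.ρ 0 x * p.u 0 x - ∫ s in (0 : ℝ)..t, momentumDrift A p ζ s x) * (p.ρ t x)⁻¹,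
    hV.congr hT (fun _ _ => rfl) ?_, fun q hq => ?_⟩
  -- In the derivative of the quotient the numerator may be replaced by ρ (u − ζ) at almost every t.
  -- The two contributions (ρu)_x ζ/ρ, from the drift and from the derivative of 1/ρ, then cancel,
  -- and `acc` remains.
  · filter_upwards [hs] with t ht
    have hne := (hpos t x).ne'
    have e : p.ρ 0 x * p.u 0 x - ∫ s in (0 : ℝ)..t, momentumDrift A p ζ s x
      = p.ρ t x * (p.u t x - ζ t x) := by linarith
    rw [e]
    simp only [momentumDrift, acc]
    field_simp
    ring
  · have e : p.ρ 0 x * p.u 0 x - ∫ s in (0 : ℝ)..q, momentumDrift A p ζ s x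
      = p.ρ q x * (p.u q x - ζ q x) := by linarith [hx q hq]
    have hne := (hpos q x).ne'
    dsimp only
    rw [e]
    field_simp

/-- Two solutions driven by the same noise. -/
lemma sameNoise {T : ℕ} {A : ℝ} {p q : Path} (hp : IsStripPath T p) (hq : IsStripPath T q)
    (hppos : ∀ t x, 0 < p.ρ t x) (hqpos : ∀ t x, 0 < q.ρ t x) {ζ : ℝ → ℝ → ℝ}
    (hpV : ∀ᵐ x ∂volume.restrict (Ioc (0 : ℝ) 1), ∃ V : ℝ → ℝ, ACPair T V (fun t => acc A p t x) ∧
      ∀ s : ℚ, (s : ℝ) ∈ Icc (0 : ℝ) T → V s = p.u s x - ζ s x)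
    (hqV : ∀ᵐ x ∂volume.restrict (Ioc (0 : ℝ) 1), ∃ V : ℝ → ℝ, ACPair T V (fun t => acc A q t x) ∧
      ∀ s : ℚ, (s : ℝ) ∈ Icc (0 : ℝ) T → V s = q.u s x - ζ s x) : SameNoise T A p q := by
  have hT : (0 : ℝ) ≤ T := T.cast_nonneg
  refine ⟨(hp.toIsRegular.integrable_acc hT hppos).sub (hq.toIsRegular.integrable_acc hT hqpos), ?_⟩
  filter_upwards [hpV, hqV] with x ⟨V, hV, hVq⟩ ⟨U, hU, hUq⟩
  have hVU := hV.sub hT hU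
  refine hVU.congr hT (fun t ht => ?_) (Eventually.of_forall fun _ => rfl)
  have c1 : Continuous fun t => p.u t x := hp.cont_u.comp (by fun_prop : Continuous fun t => (t, x))
  have c2 : Continuous fun t => q.u t x := hq.cont_u.comp (by fun_prop : Continuous fun t => (t, x))
  -- The noise has left the difference, and the velocities are continuous in time, so equality at
  -- rational times extends to [0,T].
  have := eq_zero_of_rat (f := fun t => V t - U t - (p.u t x - q.u t x))
    ((hVU.continuousOn hT).sub (c1.sub c2).continuousOn)
    (fun s hs => by rw [hVq s hs, hUq s hs]; ring) t ht
  linarith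

end

end CNSE

namespace CNSE

noncomputable section

/-! ### Convergence of the noise -/

section Moments

variable {Ω : Type*} {mΩ : MeasurableSpace Ω} {P : Measure Ω}
  {E : Type*} [NormedAddCommGroup E] [InnerProductSpace ℝ E]

/-- The first moment of a combination of orthogonal random variables. -/
lemma lintegral_enorm_sum_smul_le [IsProbabilityMeasure P] {X : ℕ → Ω → ℝ} {c : ℝ}
    (hX : ∀ k, MemLp (X k) 2 P) (hc : ∀ k, ∫ ω, X k ω ^ 2 ∂P = c)
    (h0 : ∀ k l, k ≠ l → ∫ ω, X k ω * X l ω ∂P = 0) (e : ℕ → E) (I : Finset ℕ) :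
    ∫⁻ ω, ‖∑ k ∈ I, X k ω • e k‖ₑ ∂P ≤ ENNReal.ofReal √(c * ∑ k ∈ I, ‖e k‖ ^ 2) := by
  have hv : MemLp (fun ω => ∑ k ∈ I, X k ω • e k) 2 P :=
    memLp_finsetSum _ fun k _ => (ContinuousLinearMap.toSpanSingleton ℝ (e k)).comp_memLp' (hX k)
  have hint : ∀ k l, Integrable (fun ω => X k ω * X l ω) P := fun k l =>
    (hX k).integrable_mul (hX l)
  have h2 : ∫ ω, ‖∑ k ∈ I, X k ω • e k‖ ^ 2 ∂P = c * ∑ k ∈ I, ‖e k‖ ^ 2 := by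
    have : ∀ ω, ‖∑ k ∈ I, X k ω • e k‖ ^ 2
        = ∑ k ∈ I, ∑ l ∈ I, X k ω * X l ω * inner ℝ (e k) (e l) := fun ω => by
      rw [← real_inner_self_eq_norm_sq, sum_inner]
      refine Finset.sum_congr rfl fun k _ => ?_
      rw [inner_sum]
      refine Finset.sum_congr rfl fun l _ => ?_
      rw [real_inner_smul_left, real_inner_smul_right]
      ring
    simp only [this]
    rw [integral_finsetSum _ fun k _ => integrable_finsetSum _ fun l _ => (hint k l).mul_const _,
      Finset.mul_sum]
    refine Finset.sum_congr rfl fun k hk => ?_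
    rw [integral_finsetSum _ fun l _ => (hint k l).mul_const _]
    simp only [integral_mul_const]
    rw [Finset.sum_eq_single_of_mem k hk fun l _ hl => by rw [h0 k l hl.symm, zero_mul],
      real_inner_self_eq_norm_sq, ← hc k]
    simp only [sq]
  rw [← ofReal_integral_norm_eq_lintegral_enorm (hv.integrable one_le_two)]
  refine ENNReal.ofReal_le_ofReal (Real.le_sqrt_of_sq_le ?_)
  -- Nonnegativity of the variance bounds the first moment of the norm by the root of its second
  -- moment.
  have h3 := variance_nonneg (fun ω => ‖∑ k ∈ I, X k ω • e k‖) P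
  rw [variance_eq_sub hv.norm] at h3
  simp only [Pi.pow_apply] at h3
  linarith

lemma memLp_increment {B : ℝ≥0 → Ω → ℝ} (hB : IsPreBrownianReal B P) (s t : ℝ≥0) :
    MemLp (fun ω => B t ω - B s ω) 2 P := by
  have h := hB.hasLaw_sub t s
  have h2 := memLp_id_gaussianReal (μ := 0) (v := nndist t.1 s.1) 2
  rw [← h.map_eq] at h2
  exact h2.comp_of_map h.aemeasurable

lemma integral_increment {B : ℝ≥0 → Ω → ℝ} (hB : IsPreBrownianReal B P) (s t : ℝ≥0) :
    ∫ ω, (B t ω - B s ω) ∂P = 0 := by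
  have := (hB.hasLaw_sub t s).integral_eq
  rwa [integral_id_gaussianReal] at this

lemma integral_increment_sq [IsProbabilityMeasure P] {B : ℝ≥0 → Ω → ℝ}
    (hB : IsPreBrownianReal B P) (s t : ℝ≥0) :
    ∫ ω, (B t ω - B s ω) ^ 2 ∂P = dist t s := by
  have h : Var[fun ω => B t ω - B s ω; P] = dist t s := by
    have := (hB.hasLaw_sub t s).variance_eq
    rw [variance_id_gaussianReal] at this
    exact this
  rw [variance_eq_sub (memLp_increment hB s t), integral_increment hB s t] at h
  simpa using h

end Moments

section Grid

/-- The first point of the grid of mesh `4⁻ᵐ` above `t`. -/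
def gridPoint (m : ℕ) (t : ℝ) : ℝ≥0 := (⌈t * 4 ^ m⌉₊ : ℝ≥0) / 4 ^ m

lemma dist_gridPoint_le (m : ℕ) {t : ℝ} (ht : 0 ≤ t) :
    dist (gridPoint m t) t.toNNReal ≤ (4 ^ m)⁻¹ := by
  have h4 : (0 : ℝ) < 4 ^ m := by positivity
  rw [NNReal.dist_eq, Real.coe_toNNReal _ ht, gridPoint]
  push_cast
  have h1 := Nat.le_ceil (t * 4 ^ m)
  have h2 := Nat.ceil_lt_add_one (mul_nonneg ht h4.le)
  rw [abs_le]
  constructor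
  · have : t ≤ (⌈t * 4 ^ m⌉₊ : ℝ) / 4 ^ m := (le_div_iff₀ h4).2 h1
    have : (0 : ℝ) < (4 ^ m)⁻¹ := by positivity
    linarith
  · rw [sub_le_iff_le_add, div_le_iff₀ h4, add_mul, inv_mul_cancel₀ h4.ne']
    linarith

lemma tendsto_gridPoint {t : ℝ} (ht : 0 ≤ t) :
    Tendsto (fun m => gridPoint m t) atTop (𝓝 t.toNNReal) := by
  rw [tendsto_iff_dist_tendsto_zero]
  refine squeeze_zero (fun _ => dist_nonneg) (fun m => dist_gridPoint_le m ht) ?_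
  simp only [← inv_pow]
  exact tendsto_pow_atTop_nhds_zero_of_lt_one (by norm_num) (by norm_num)

variable {Ω : Type*} {mΩ : MeasurableSpace Ω} {P : Measure Ω} {μ : Measure ℝ}

/-- The grid has countably many points, so only countably many random variables occur and their
exceptional sets can be discarded together. -/
lemma aemeasurable_gridPoint {B : ℝ≥0 → Ω → ℝ} (hB : ∀ t, AEMeasurable (B t) P) (m : ℕ) :
    AEMeasurable (fun z : ℝ × Ω => B (gridPoint m z.1) z.2) (μ.prod P) := by
  choose w hwm hwe using fun k : ℕ => hB ((k : ℝ≥0) / 4 ^ m)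
  refine ⟨fun z => w ⌈z.1 * 4 ^ m⌉₊ z.2, ?_, ?_⟩
  · have h1 : Measurable fun v : ℕ × Ω => w v.1 v.2 := measurable_from_prod_countable_right hwm
    exact h1.comp ((Nat.measurable_ceil.comp (measurable_fst.mul_const _)).prodMk measurable_snd)
  · filter_upwards [Measure.quasiMeasurePreserving_snd.ae (ae_all_iff.2 hwe)] with z hz using hz _

/-- Joint measurability in time and chance is inherited from the grid approximations, which converge
because almost every path is continuous. -/
lemma aemeasurable_uncurry {B : ℝ≥0 → Ω → ℝ} (hB : ∀ t, AEMeasurable (B t) P)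
    (hc : ∀ᵐ ω ∂P, Continuous fun t => B t ω) (hμ : ∀ᵐ t ∂μ, 0 ≤ t) :
    AEMeasurable (fun z : ℝ × Ω => B z.1.toNNReal z.2) (μ.prod P) := by
  refine aemeasurable_of_tendsto_metrizable_ae atTop (fun m => aemeasurable_gridPoint hB m) ?_
  filter_upwards [Measure.quasiMeasurePreserving_snd.ae hc,
    Measure.quasiMeasurePreserving_fst.ae hμ] with z hz hz'
  exact (hz.tendsto _).comp (tendsto_gridPoint hz')

end Grid

end

end CNSE

/-! ### Almost sure convergence of the noise series along a subsequence. -/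

namespace CNSE

noncomputable section

section PartialSums

variable {Ω : Type*} {mΩ : MeasurableSpace Ω} {P : Measure Ω} {W : ℕ → ℝ≥0 → Ω → ℝ}
  {E : Type*} [NormedAddCommGroup E] [InnerProductSpace ℝ E]

/-- The partial sums of the series `∑ W^k e_k`. -/
def partialNoise (W : ℕ → ℝ≥0 → Ω → ℝ) (e : ℕ → E) (n : ℕ) (t : ℝ≥0) (ω : Ω) : E :=
  ∑ k ∈ Finset.range n, W k t ω • e k

/-- Increments of different modes are independent and centred, hence orthogonal in L²(P), and each
has variance the length of the time interval. -/
lemma lintegral_enorm_sum_increment_le {F : Filtration ℝ≥0 mΩ} (hW : IsStochasticBasis P F W)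
    (e : ℕ → E) (I : Finset ℕ) (s t : ℝ≥0) :
    ∫⁻ ω, ‖∑ k ∈ I, (W k t ω - W k s ω) • e k‖ₑ ∂P
      ≤ ENNReal.ofReal √(dist t s * ∑ k ∈ I, ‖e k‖ ^ 2) := by
  have := hW.prob
  have hB := fun k => (hW.brownian k).toIsPreBrownianReal
  refine lintegral_enorm_sum_smul_le (X := fun k ω => W k t ω - W k s ω)
    (fun k => memLp_increment (hB k) s t)
    (fun k => integral_increment_sq (hB k) s t) (fun k l hkl => ?_) e I
  have h := (hW.indep.indepFun hkl).comp
    ((measurable_pi_apply t).sub (measurable_pi_apply s) :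
      Measurable fun f : ℝ≥0 → ℝ => f t - f s)
    ((measurable_pi_apply t).sub (measurable_pi_apply s) :
      Measurable fun f : ℝ≥0 → ℝ => f t - f s)
  have h2 := h.integral_fun_mul_eq_mul_integral
    (((hB k).aemeasurable t).sub ((hB k).aemeasurable s)).aestronglyMeasurable
    (((hB l).aemeasurable t).sub ((hB l).aemeasurable s)).aestronglyMeasurable
  simp only [Function.comp_apply, Pi.sub_apply] at h2
  rw [h2, integral_increment (hB k), zero_mul]

lemma lintegral_enorm_sum_le {F : Filtration ℝ≥0 mΩ} (hW : IsStochasticBasis P F W)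
    (e : ℕ → E) (I : Finset ℕ) (t : ℝ≥0) :
    ∫⁻ ω, ‖∑ k ∈ I, W k t ω • e k‖ₑ ∂P ≤ ENNReal.ofReal √(t * ∑ k ∈ I, ‖e k‖ ^ 2) := by
  have h := lintegral_enorm_sum_increment_le hW e I 0 t
  rw [NNReal.dist_eq, NNReal.coe_zero, sub_zero, abs_of_nonneg (NNReal.coe_nonneg t)] at h
  refine le_of_eq_of_le (lintegral_congr_ae ?_) h
  filter_upwards [ae_all_iff.2 fun k => (hW.brownian k).eval_zero_ae_eq_zero] with ω hω
  simp only [hω, sub_zero]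

lemma edist_partialNoise (e : ℕ → E) {n m : ℕ} (h : n ≤ m) (t : ℝ≥0) (ω : Ω) :
    edist (partialNoise W e n t ω) (partialNoise W e m t ω)
      = ‖∑ k ∈ Finset.Ico n m, W k t ω • e k‖ₑ := by
  rw [edist_comm, edist_eq_enorm_sub, partialNoise, partialNoise, Finset.sum_Ico_eq_sub _ h]

lemma edist_partialNoise_time (e : ℕ → E) (n : ℕ) (s t : ℝ≥0) (ω : Ω) :
    edist (partialNoise W e n t ω) (partialNoise W e n s ω)
      = ‖∑ k ∈ Finset.range n, (W k t ω - W k s ω) • e k‖ₑ := by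
  simp only [edist_eq_enorm_sub, partialNoise, sub_smul, Finset.sum_sub_distrib]

/-- A subsequence along which the tails decay geometrically. -/
lemma exists_strictMono_tail {a : ℕ → ℝ} (ha : ∀ k, 0 ≤ a k) (hs : Summable a) :
    ∃ K : ℕ → ℕ, StrictMono K ∧ ∀ j, ∑ k ∈ Finset.Ico (K j) (K (j + 1)), a k ≤ (4 ^ j)⁻¹ := by
  have h : ∀ j : ℕ, ∀ᶠ n in atTop, ∑' k, a (k + n) < ((4 : ℝ) ^ j)⁻¹ := fun j =>
    (tendsto_sum_nat_add a).eventually (Iio_mem_nhds (by positivity))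
  obtain ⟨K, hK, hK'⟩ := extraction_forall_of_eventually h
  refine ⟨K, hK, fun j => le_trans ?_ (hK' j).le⟩
  rw [Finset.sum_Ico_eq_sum_range]
  have := ((summable_nat_add_iff (K j)).2 hs).sum_le_tsum (Finset.range (K (j + 1) - K j))
    fun k _ => ha _
  simpa only [add_comm] using this

variable {F : Filtration ℝ≥0 mΩ} {e : ℕ → E} {K : ℕ → ℕ}

lemma aestronglyMeasurable_partialNoise (hW : IsStochasticBasis P F W) (n : ℕ) (t : ℝ≥0) :
    AEStronglyMeasurable (partialNoise W e n t) P := by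
  refine Finset.aestronglyMeasurable_fun_sum _ fun k _ => ?_
  exact ((hW.brownian k).aemeasurable t).aestronglyMeasurable.smul_const _

/-- Blocks of squared norm at most 4^{-j} have first moment of order 2^{-j}. This is summable, so
first moments suffice for almost sure convergence along the subsequence. -/
lemma lintegral_edist_partialNoise_le (hW : IsStochasticBasis P F W) (hK : StrictMono K)
    (ht : ∀ j, ∑ k ∈ Finset.Ico (K j) (K (j + 1)), ‖e k‖ ^ 2 ≤ (4 ^ j)⁻¹) (j : ℕ) {t b : ℝ≥0}
    (htb : t ≤ b) :
    ∫⁻ ω, edist (partialNoise W e (K j) t ω) (partialNoise W e (K (j + 1)) t ω) ∂P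
      ≤ ENNReal.ofReal √b * 2⁻¹ ^ j := by
  simp only [edist_partialNoise e (hK (Nat.lt_succ_self j)).le]
  refine (lintegral_enorm_sum_le hW e _ t).trans ?_
  have h2 : (2⁻¹ : ℝ≥0∞) ^ j = ENNReal.ofReal ((1 / 2) ^ j) := by
    rw [ENNReal.ofReal_pow (by norm_num), one_div, ENNReal.ofReal_inv_of_pos two_pos]
    norm_num
  rw [h2, ← ENNReal.ofReal_mul (Real.sqrt_nonneg _)]
  refine ENNReal.ofReal_le_ofReal ?_
  have h4 : ((1 : ℝ) / 2) ^ j = √((4 ^ j)⁻¹) := by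
    rw [eq_comm, Real.sqrt_eq_iff_mul_self_eq (by positivity) (by positivity), ← mul_pow, ← inv_pow]
    norm_num
  rw [h4, ← Real.sqrt_mul (NNReal.coe_nonneg b)]
  exact Real.sqrt_le_sqrt (mul_le_mul htb (ht j) (by positivity) b.coe_nonneg)

lemma tsum_geometric_tail (m : ℕ) : ∑' j, (2⁻¹ : ℝ≥0∞) ^ (m + j) = 2⁻¹ ^ m * 2 := by
  simp only [pow_add]
  rw [ENNReal.tsum_mul_left, ENNReal.tsum_geometric, ENNReal.one_sub_inv_two, inv_inv]

/-- The variation of the partial sums along a subsequence, started at an index. -/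
def noiseTail (W : ℕ → ℝ≥0 → Ω → ℝ) (e : ℕ → E) (K : ℕ → ℕ) (m : ℕ) (t : ℝ≥0) (ω : Ω) : ℝ≥0∞ :=
  ∑' j, edist (partialNoise W e (K (m + j)) t ω) (partialNoise W e (K (m + j + 1)) t ω)

lemma lintegral_noiseTail_le (hW : IsStochasticBasis P F W) (hK : StrictMono K)
    (ht : ∀ j, ∑ k ∈ Finset.Ico (K j) (K (j + 1)), ‖e k‖ ^ 2 ≤ (4 ^ j)⁻¹) (m : ℕ) {t b : ℝ≥0}
    (htb : t ≤ b) :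
    ∫⁻ ω, noiseTail W e K m t ω ∂P ≤ ENNReal.ofReal √b * (2⁻¹ ^ m * 2) := by
  unfold noiseTail
  rw [lintegral_tsum fun j => (aestronglyMeasurable_partialNoise hW _ t).edist
    (aestronglyMeasurable_partialNoise hW _ t), ← tsum_geometric_tail, ← ENNReal.tsum_mul_left]
  exact ENNReal.tsum_le_tsum fun j => lintegral_edist_partialNoise_le hW hK ht _ htb

/-- By Brownian scaling, a time step of length at most 4^{-m} costs a factor 2^{-m}. The mesh of the
grid is chosen to make this summable in m. -/
lemma lintegral_edist_partialNoise_time_le (hW : IsStochasticBasis P F W)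
    (he : Summable fun k => ‖e k‖ ^ 2) (n m : ℕ) {t : ℝ} (ht : 0 ≤ t) :
    ∫⁻ ω, edist (partialNoise W e n (gridPoint m t) ω) (partialNoise W e n t.toNNReal ω) ∂P
      ≤ ENNReal.ofReal √(∑' k, ‖e k‖ ^ 2) * 2⁻¹ ^ m := by
  simp only [edist_partialNoise_time]
  refine (lintegral_enorm_sum_increment_le hW e _ _ _).trans ?_
  have h2 : (2⁻¹ : ℝ≥0∞) ^ m = ENNReal.ofReal ((1 / 2) ^ m) := by
    rw [ENNReal.ofReal_pow (by norm_num), one_div, ENNReal.ofReal_inv_of_pos two_pos]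
    norm_num
  have h4 : ((1 : ℝ) / 2) ^ m = √((4 ^ m)⁻¹) := by
    rw [eq_comm, Real.sqrt_eq_iff_mul_self_eq (by positivity) (by positivity), ← mul_pow, ← inv_pow]
    norm_num
  rw [h2, ← ENNReal.ofReal_mul (Real.sqrt_nonneg _), h4, mul_comm √_,
    ← Real.sqrt_mul (by positivity)]
  exact ENNReal.ofReal_le_ofReal (Real.sqrt_le_sqrt (mul_le_mul (dist_gridPoint_le m ht)
    (he.sum_le_tsum _ fun k _ => by positivity) (Finset.sum_nonneg fun k _ => by positivity)
    (by positivity)))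

/-- A functional whose finiteness controls the convergence of the noise at a time and along the
grid points approximating it. -/
def noiseControl (W : ℕ → ℝ≥0 → Ω → ℝ) (e : ℕ → E) (K : ℕ → ℕ) (t : ℝ) (ω : Ω) : ℝ≥0∞ :=
  edist (partialNoise W e (K 0) t.toNNReal ω) 0 + noiseTail W e K 0 t.toNNReal ω
    + ∑' m, (edist (partialNoise W e (K m) (gridPoint m t) ω) (partialNoise W e (K m) t.toNNReal ω)
      + noiseTail W e K m (gridPoint m t) ω)

lemma aemeasurable_noiseControl (hW : IsStochasticBasis P F W) (T : ℝ) :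
    AEMeasurable (fun z : ℝ × Ω => noiseControl W e K z.1 z.2)
      ((volume.restrict (Ioc (0 : ℝ) T)).prod P) := by
  have h1 : ∀ n, AEStronglyMeasurable (fun z : ℝ × Ω => partialNoise W e n z.1.toNNReal z.2)
      ((volume.restrict (Ioc (0 : ℝ) T)).prod P) := fun n =>
    Finset.aestronglyMeasurable_fun_sum _ fun k _ =>
      (aemeasurable_uncurry (fun t => (hW.brownian k).aemeasurable t) (hW.brownian k).cont
        ((ae_restrict_mem measurableSet_Ioc).mono fun t ht => ht.1.le)).aestronglyMeasurable.smul_const _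
  have h2 : ∀ n m, AEStronglyMeasurable (fun z : ℝ × Ω => partialNoise W e n (gridPoint m z.1) z.2)
      ((volume.restrict (Ioc (0 : ℝ) T)).prod P) := fun n m =>
    Finset.aestronglyMeasurable_fun_sum _ fun k _ =>
      (aemeasurable_gridPoint (fun t => (hW.brownian k).aemeasurable t) m).aestronglyMeasurable.smul_const _
  refine (((h1 _).edist aestronglyMeasurable_const).add
    (AEMeasurable.tsum fun j => (h1 _).edist (h1 _))).add
    (AEMeasurable.tsum fun m => ((h2 _ _).edist (h1 _)).add
      (AEMeasurable.tsum fun j => (h2 _ _).edist (h2 _ _)))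

/-- The tails started at index m at the grid points contribute a double geometric series, and the
time increments a single one. Uniformity in t is what allows Tonelli to exchange expectation and
time integration. -/
lemma lintegral_noiseControl_le (hW : IsStochasticBasis P F W) (he : Summable fun k => ‖e k‖ ^ 2)
    (hK : StrictMono K) (hk : ∀ j, ∑ k ∈ Finset.Ico (K j) (K (j + 1)), ‖e k‖ ^ 2 ≤ (4 ^ j)⁻¹)
    (T : ℕ) : ∃ C : ℝ≥0, ∀ t ∈ Ioc (0 : ℝ) T, ∫⁻ ω, noiseControl W e K t ω ∂P ≤ C := by
  have hM := fun n t => aestronglyMeasurable_partialNoise (e := e) hW n t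
  have hMt : ∀ m t, AEMeasurable (noiseTail W e K m t) P := fun m t =>
    AEMeasurable.tsum fun j => (hM _ _).edist (hM _ _)
  refine ⟨ENNReal.toNNReal (ENNReal.ofReal √(T * ∑ k ∈ Finset.range (K 0), ‖e k‖ ^ 2)
    + ENNReal.ofReal √T * (2⁻¹ ^ 0 * 2) + (ENNReal.ofReal √(∑' k, ‖e k‖ ^ 2)
      + ENNReal.ofReal √(T + 1) * 2) * 2), fun t ht => ?_⟩
  rw [ENNReal.coe_toNNReal (by finiteness)]
  have htT : t.toNNReal ≤ (T : ℝ≥0) := by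
    rw [Real.toNNReal_le_iff_le_coe]
    exact_mod_cast ht.2
  have hg : ∀ m, gridPoint m t ≤ (T : ℝ≥0) + 1 := fun m => by
    have h1 := dist_gridPoint_le m ht.1.le
    have h2 : ((4 : ℝ) ^ m)⁻¹ ≤ 1 := inv_le_one_of_one_le₀ (one_le_pow₀ (by norm_num))
    rw [NNReal.dist_eq, Real.coe_toNNReal _ ht.1.le] at h1
    have h3 := (abs_le.1 h1).2
    rw [← NNReal.coe_le_coe]
    push_cast
    linarith [ht.2]
  unfold noiseControl
  have m1 : AEMeasurable (fun ω => edist (partialNoise W e (K 0) t.toNNReal ω) 0) P :=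
    (hM _ _).edist aestronglyMeasurable_const
  have m2 : AEMeasurable (fun ω => edist (partialNoise W e (K 0) t.toNNReal ω) 0
    + noiseTail W e K 0 t.toNNReal ω) P := m1.add (hMt _ _)
  have m3 : ∀ m, AEMeasurable (fun ω =>
      edist (partialNoise W e (K m) (gridPoint m t) ω) (partialNoise W e (K m) t.toNNReal ω)
        + noiseTail W e K m (gridPoint m t) ω) P := fun m =>
    ((hM _ _).edist (hM _ _)).add (hMt _ _)
  rw [lintegral_add_left' m2, lintegral_add_left' m1, lintegral_tsum m3]
  gcongr ?_ + ?_ + ?_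
  · simp only [edist_zero_right]
    refine (lintegral_enorm_sum_le hW e _ _).trans (ENNReal.ofReal_le_ofReal (Real.sqrt_le_sqrt ?_))
    gcongr
    exact_mod_cast htT
  · exact_mod_cast lintegral_noiseTail_le hW hK hk 0 htT
  · have h2 : (2 : ℝ≥0∞) = ∑' m, (2⁻¹ : ℝ≥0∞) ^ m := by
      rw [ENNReal.tsum_geometric, ENNReal.one_sub_inv_two, inv_inv]
    conv_rhs => rw [mul_comm, h2, ← ENNReal.tsum_mul_right]
    refine ENNReal.tsum_le_tsum fun m => ?_
    rw [lintegral_add_left' ((hM _ _).edist (hM _ _)), mul_add]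
    gcongr ?_ + ?_
    · rw [mul_comm]
      exact lintegral_edist_partialNoise_time_le hW he _ _ ht.1.le
    · refine (lintegral_noiseTail_le hW hK hk m (hg m)).trans_eq ?_
      rw [← h2]
      push_cast
      ring

/-- Pathwise convergence of the noise along a subsequence. -/
structure NoiseLimit (S : ℕ → ℝ≥0 → E) (ξ : ℝ → E) : Prop where
  rat : ∀ q : ℚ, Tendsto (fun j => S j (q : ℝ).toNNReal) atTop (𝓝 (ξ q))
  ae : ∀ᵐ t ∂volume.restrict (Ioi (0 : ℝ)), Tendsto (fun j => S j t.toNNReal) atTop (𝓝 (ξ t)) ∧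
    ∃ r : ℕ → ℚ, (∀ m, 0 ≤ r m) ∧ Tendsto (fun m => (r m : ℝ)) atTop (𝓝 t) ∧
      Tendsto (fun m => ξ (r m)) atTop (𝓝 (ξ t))
  bound : ∀ T : ℕ, ∃ Θ : ℝ → ℝ, IntervalIntegrable Θ volume 0 T ∧
    ∀ᵐ t ∂volume.restrict (Ioc (0 : ℝ) T), ∀ j, ‖S j t.toNNReal‖ ≤ Θ t

/-- At each rational time the variation along the subsequence has finite expectation. By Tonelli,
`noiseControl` is for almost every ω integrable on every (0,T]: its finiteness gives convergence at
almost every time and along the grid points, and the function itself is the dominating Θ. No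
supremum over time is estimated. -/
lemma exists_noiseLimit [CompleteSpace E] (hW : IsStochasticBasis P F W)
    (he : Summable fun k => ‖e k‖ ^ 2) : ∃ K : ℕ → ℕ, StrictMono K ∧
    ∀ᵐ ω ∂P, ∃ ξ : ℝ → E, NoiseLimit (fun j t => partialNoise W e (K j) t ω) ξ := by
  obtain ⟨K, hK, hk⟩ := exists_strictMono_tail (fun k => by positivity) he
  refine ⟨K, hK, ?_⟩
  have := hW.prob
  have hrat : ∀ᵐ ω ∂P, ∀ q : ℚ, noiseTail W e K 0 (q : ℝ).toNNReal ω < ∞ := by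
    refine ae_all_iff.2 fun q => ae_lt_top' ?_ ?_
    · exact AEMeasurable.tsum fun j => (aestronglyMeasurable_partialNoise hW _ _).edist
        (aestronglyMeasurable_partialNoise hW _ _)
    · exact ne_top_of_le_ne_top (by finiteness) (lintegral_noiseTail_le hW hK hk 0 le_rfl)
  have hint : ∀ᵐ ω ∂P, ∀ T : ℕ, AEMeasurable (fun t => noiseControl W e K t ω)
      (volume.restrict (Ioc (0 : ℝ) T)) ∧ ∫⁻ t in Ioc (0 : ℝ) T, noiseControl W e K t ω < ∞ := by
    refine ae_all_iff.2 fun T => ?_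
    have hm := aemeasurable_noiseControl (e := e) (K := K) hW T
    obtain ⟨C, hC⟩ := lintegral_noiseControl_le hW he hK hk T
    refine Filter.Eventually.and ?_ (ae_lt_top' ?_ ?_)
    · filter_upwards [hm.prod_swap.aestronglyMeasurable.prodMk_left] with ω hω using hω.aemeasurable
    · exact hm.prod_swap.lintegral_prod_right'
    · rw [lintegral_lintegral_swap hm.prod_swap]
      refine ne_top_of_le_ne_top (b := ∫⁻ t in Ioc (0 : ℝ) T, (C : ℝ≥0∞)) ?_
        (setLIntegral_mono' measurableSet_Ioc hC)
      simp [ENNReal.mul_eq_top]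
  filter_upwards [hrat, hint] with ω h1 h2
  set S : ℕ → ℝ≥0 → E := fun j t => partialNoise W e (K j) t ω with hS
  have hconv : ∀ t, noiseTail W e K 0 t ω < ∞ → ∃ a, Tendsto (fun j => S j t) atTop (𝓝 a) := by
    intro t ht
    refine cauchySeq_tendsto_of_complete
      (cauchySeq_of_edist_le_of_tsum_ne_top (fun j => edist (S j t) (S (j + 1) t))
        (fun _ => le_rfl) ?_)
    simpa only [noiseTail, zero_add] using ht.ne
  set ξ : ℝ → E := fun t => limUnder atTop fun j => S j t.toNNReal with hξ
  have hlim : ∀ t : ℝ, noiseTail W e K 0 t.toNNReal ω < ∞ →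
      Tendsto (fun j => S j t.toNNReal) atTop (𝓝 (ξ t)) := fun t ht =>
    tendsto_nhds_limUnder (hconv _ ht)
  have hfin : ∀ T : ℕ, ∀ᵐ t ∂volume.restrict (Ioc (0 : ℝ) T), noiseControl W e K t ω < ∞ :=
    fun T => ae_lt_top' (h2 T).1 (h2 T).2.ne
  have hfin' : ∀ᵐ t ∂volume.restrict (Ioi (0 : ℝ)), noiseControl W e K t ω < ∞ := by
    have : Ioi (0 : ℝ) = ⋃ T : ℕ, Ioc (0 : ℝ) T := by
      ext t
      simp only [mem_Ioi, mem_iUnion, mem_Ioc, exists_and_left]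
      exact ⟨fun h => ⟨h, exists_nat_ge t⟩, fun h => h.1⟩
    rw [this, ae_restrict_iUnion_iff]
    exact hfin
  refine ⟨ξ, fun q => hlim _ (h1 q), ?_, fun T => ?_⟩
  · filter_upwards [hfin', ae_restrict_mem measurableSet_Ioi] with t ht ht0
    have ht0 := mem_Ioi.1 ht0
    rw [noiseControl, ENNReal.add_lt_top, ENNReal.add_lt_top] at ht
    obtain ⟨⟨-, hA⟩, hB⟩ := ht
    have hz := ENNReal.tendsto_atTop_zero_of_tsum_ne_top hB.ne
    have hl := hlim t hA
    -- The rational approximants are the grid points entering `noiseControl`.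
    refine ⟨hl, fun m => (⌈t * 4 ^ m⌉₊ : ℚ) / 4 ^ m, fun m => by positivity, ?_, ?_⟩
    · have := (NNReal.continuous_coe.tendsto _).comp (tendsto_gridPoint ht0.le)
      rw [Real.coe_toNNReal _ ht0.le] at this
      refine this.congr fun m => ?_
      simp only [Function.comp_apply, gridPoint]
      push_cast
      rfl
    · have hgr : ∀ m : ℕ, ((((⌈t * 4 ^ m⌉₊ : ℚ) / 4 ^ m : ℚ)) : ℝ).toNNReal = gridPoint m t := by
        intro m
        rw [← NNReal.coe_inj, Real.coe_toNNReal _ (by positivity), gridPoint]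
        push_cast
        rfl
      -- ξ at the grid point is compared with ξ(t) through the partial sums of index m at both
      -- times. The first two distances are dominated by the m-th term of the convergent series in
      -- `noiseControl`; the third tends to zero by convergence at t.
      rw [tendsto_iff_edist_tendsto_0]
      have hl' := tendsto_iff_edist_tendsto_0.1 hl
      have hs := hz.add hl'
      rw [add_zero] at hs
      refine tendsto_of_tendsto_of_tendsto_of_le_of_le tendsto_const_nhds hs (fun _ => zero_le)
        fun m => ?_
      have hg := hlim _ (h1 ((⌈t * 4 ^ m⌉₊ : ℚ) / 4 ^ m))
      rw [hgr] at hg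
      have htail : edist (S m (gridPoint m t)) (ξ ((⌈t * 4 ^ m⌉₊ : ℚ) / 4 ^ m : ℚ))
          ≤ noiseTail W e K m (gridPoint m t) ω :=
        edist_le_tsum_of_edist_le_of_tendsto
          (fun j => edist (S j (gridPoint m t)) (S (j + 1) (gridPoint m t))) (fun _ => le_rfl) hg m
      calc edist (ξ ((⌈t * 4 ^ m⌉₊ : ℚ) / 4 ^ m : ℚ)) (ξ t)
          ≤ edist (ξ ((⌈t * 4 ^ m⌉₊ : ℚ) / 4 ^ m : ℚ)) (S m (gridPoint m t))
            + edist (S m (gridPoint m t)) (S m t.toNNReal) + edist (S m t.toNNReal) (ξ t) :=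
            edist_triangle4 _ _ _ _
        _ ≤ _ := by
          rw [edist_comm (ξ _), add_comm (edist _ (ξ _))]
          gcongr
  · refine ⟨fun t => (noiseControl W e K t ω).toReal, ?_, ?_⟩
    · rw [intervalIntegrable_iff_integrableOn_Ioc_of_le T.cast_nonneg]
      exact integrable_toReal_of_lintegral_ne_top (h2 T).1 (h2 T).2.ne
    · filter_upwards [hfin T] with t ht j
      have hle : ‖S j t.toNNReal‖ₑ ≤ noiseControl W e K t ω := by
        rw [← edist_zero_right]
        calc edist (S j t.toNNReal) 0
            ≤ edist (S 0 t.toNNReal) 0 + edist (S 0 t.toNNReal) (S j t.toNNReal) := by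
              rw [edist_comm (S 0 _) (S j _), add_comm]
              exact edist_triangle _ _ _
          _ ≤ edist (S 0 t.toNNReal) 0 + noiseTail W e K 0 t.toNNReal ω := by
              gcongr
              refine (edist_le_range_sum_edist (fun j => S j t.toNNReal) j).trans ?_
              simp only [noiseTail, zero_add]
              exact ENNReal.sum_le_tsum _
          _ ≤ _ := le_self_add
      have := ENNReal.toReal_mono ht.ne hle
      rwa [toReal_enorm] at this

end PartialSums

end

end CNSE

namespace CNSE

noncomputable section

/-! ### The stochastic integral of an absolutely continuous integrand -/

/-- Left-endpoint sums of an absolutely continuous integrand converge pathwise. -/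
lemma tendsto_leftSum {t : ℝ≥0} {B X : ℝ≥0 → ℝ} {X' : ℝ → ℝ} (hB : Continuous B) (hB0 : B 0 = 0)
    (hX : ACPair t (fun s => X s.toNNReal) X') :
    Tendsto (fun n : ℕ => ∑ i ∈ Finset.range n,
      X (t * i / n) * (B (t * (i + 1) / n) - B (t * i / n))) atTop
      (𝓝 (X t * B t - ∫ s in (0 : ℝ)..t, B s.toNNReal * X' s)) := by
  have ht := t.coe_nonneg
  -- Summation by parts writes the left-endpoint sum as X_t B_t minus the sum of B at right
  -- endpoints times increments of X; the boundary term at 0 drops since B starts at 0. G is the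
  -- step function of these right-endpoint values, and each increment of X is an integral of X', so
  -- the sum becomes ∫ G X'.
  set G : ℕ → ℝ → ℝ := fun n s => B (t * (⌈s * n / t⌉₊ : ℝ≥0) / n) with hG
  have hGm : ∀ n, Measurable (G n) := fun n =>
    (measurable_from_nat (f := fun k : ℕ => B (t * (k : ℝ≥0) / n))).comp
      (Nat.measurable_ceil.comp (by fun_prop))
  have hle : ∀ n i : ℕ, i ≤ n → t * (i : ℝ≥0) / n ≤ t := fun n i hi => by
    rcases Nat.eq_zero_or_pos n with rfl | hn
    · simp
    · rw [div_le_iff₀ (by exact_mod_cast hn)]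
      gcongr
  have hceil : ∀ n : ℕ, ∀ s ∈ Ioc (0 : ℝ) t, ⌈s * n / t⌉₊ ≤ n := fun n s hs => by
    have ht0 : (0 : ℝ) < t := hs.1.trans_le hs.2
    rw [Nat.ceil_le, div_le_iff₀ ht0, mul_comm]
    gcongr
    exact hs.2
  have hsum : ∀ n : ℕ, 0 < n → ∑ i ∈ Finset.range n,
      X (t * i / n) * (B (t * (i + 1) / n) - B (t * i / n))
      = X t * B t - ∫ s in (0 : ℝ)..t, G n s * X' s := by
    intro n hn
    have hn' : (0 : ℝ) < n := by exact_mod_cast hn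
    have hn'' : (n : ℝ≥0) ≠ 0 := by exact_mod_cast hn.ne'
    set a : ℕ → ℝ := fun i => ((t * (i : ℝ≥0) / n : ℝ≥0) : ℝ) with ha
    have haM : ∀ i, a i = t * i / n := fun i => by simp only [ha]; push_cast; rfl
    have hmono : ∀ i, a i ≤ a (i + 1) := fun i => by
      rw [haM, haM]
      push_cast
      gcongr
      linarith
    have hmem : ∀ i ≤ n, a i ∈ Icc (0 : ℝ) t := fun i hi =>
      ⟨NNReal.coe_nonneg _, by exact_mod_cast hle n i hi⟩
    have hcongr : ∀ i < n, ∀ s ∈ Ioc (a i) (a (i + 1)), G n s * X' s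
        = B (t * (i + 1 : ℕ) / n) * X' s := by
      intro i hi s hs
      rw [haM, haM] at hs
      have ht0 : (0 : ℝ) < t := by
        rcases ht.eq_or_lt with h | h
        · rw [← h] at hs
          simp only [zero_mul, zero_div] at hs
          exact absurd hs.1 (not_lt.2 hs.2)
        · exact h
      have : ⌈s * n / t⌉₊ = i + 1 := by
        rw [Nat.ceil_eq_iff (Nat.succ_ne_zero i), Nat.succ_sub_one, lt_div_iff₀ ht0, div_le_iff₀ ht0]
        have h1 := (div_lt_iff₀ hn').1 hs.1
        have h2 := (le_div_iff₀ hn').1 hs.2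
        constructor <;> linarith
      simp only [hG, this]
    have hint : ∀ i < n, IntervalIntegrable X' volume (a i) (a (i + 1)) := fun i hi =>
      hX.integrable.mono_set (by
        rw [uIcc_of_le (hmono i), uIcc_of_le ht]
        exact Icc_subset_Icc (hmem i hi.le).1 (hmem (i + 1) hi).2)
    have hpiece : ∀ i < n, B (t * (i + 1) / n) * (X (t * (i + 1) / n) - X (t * i / n))
        = ∫ s in a i..a (i + 1), G n s * X' s := by
      intro i hi
      have e : X (t * (i + 1 : ℕ) / n) - X (t * i / n) = ∫ s in a i..a (i + 1), X' s := by
        simpa only [ha, Real.toNNReal_coe] using hX.sub_eq (hmem i hi.le) (hmem (i + 1) hi)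
      rw [intervalIntegral.integral_congr_ae (g := fun s => B (t * (i + 1 : ℕ) / n) * X' s)
        (Eventually.of_forall fun s hs => hcongr i hi s (by rwa [uIoc_of_le (hmono i)] at hs)),
        intervalIntegral.integral_const_mul, ← e]
      push_cast
      rfl
    have hGint : ∀ i < n, IntervalIntegrable (fun s => G n s * X' s) volume (a i) (a (i + 1)) :=
      fun i hi => ((hint i hi).const_mul (B (t * (i + 1 : ℕ) / n))).congr fun s hs =>
        (hcongr i hi s (by rwa [uIoc_of_le (hmono i)] at hs)).symm
    have h1 := intervalIntegral.sum_integral_adjacent_intervals hGint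
    have h2 := Finset.sum_range_sub (fun i : ℕ => X (t * i / n) * B (t * i / n)) n
    have h3 : a 0 = 0 := by simp [ha]
    have h4 : a n = t := by rw [haM]; field_simp
    have h5 : t * (n : ℝ≥0) / n = t := by field_simp
    rw [h3, h4] at h1
    simp only [h5, Nat.cast_zero, mul_zero, zero_div, hB0, sub_zero] at h2
    rw [← h1, ← h2, ← Finset.sum_sub_distrib]
    refine Finset.sum_congr rfl fun i hi => ?_
    rw [← hpiece i (Finset.mem_range.1 hi)]
    push_cast
    ring
  obtain ⟨M, hM⟩ := isCompact_Icc.exists_bound_of_continuousOn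
    (s := Icc (0 : ℝ) t) (f := fun s => B s.toNNReal) (by fun_prop)
  have hlim : Tendsto (fun n : ℕ => ∫ s in (0 : ℝ)..t, G n s * X' s) atTop
      (𝓝 (∫ s in (0 : ℝ)..t, B s.toNNReal * X' s)) := by
    refine intervalIntegral.tendsto_integral_filter_of_dominated_convergence (fun s => M * |X' s|)
      (Eventually.of_forall fun n => ?_) (Eventually.of_forall fun n => ?_)
      (hX.integrable.abs.const_mul M) ?_
    · rw [uIoc_of_le ht]
      have := (intervalIntegrable_iff_integrableOn_Ioc_of_le ht).1 hX.integrable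
      exact (hGm n).aestronglyMeasurable.mul this.aestronglyMeasurable
    · refine Eventually.of_forall fun s hs => ?_
      rw [uIoc_of_le ht] at hs
      rw [norm_mul, Real.norm_eq_abs (X' s)]
      gcongr
      have := hM (t * (⌈s * n / t⌉₊ : ℝ≥0) / n : ℝ≥0)
        ⟨NNReal.coe_nonneg _, by exact_mod_cast hle n _ (hceil n s hs)⟩
      rwa [Real.toNNReal_coe] at this
    · refine Eventually.of_forall fun s hs => ?_
      rw [uIoc_of_le ht] at hs
      have ht0 : (0 : ℝ) < t := hs.1.trans_le hs.2
      refine Tendsto.mul_const _ ((hB.tendsto _).comp ?_)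
      rw [tendsto_iff_dist_tendsto_zero]
      refine squeeze_zero' (g := fun n : ℕ => (t : ℝ) * (1 / (n : ℝ)))
        (Eventually.of_forall fun _ => dist_nonneg) ?_ ?_
      · filter_upwards [eventually_gt_atTop 0] with n hn
        have hn' : (0 : ℝ) < n := by exact_mod_cast hn
        rw [NNReal.dist_eq, Real.coe_toNNReal _ hs.1.le]
        push_cast
        have h1 := Nat.le_ceil (s * n / t)
        have h2 := Nat.ceil_lt_add_one (a := s * n / t) (by have := hs.1; positivity)
        rw [div_le_iff₀ ht0] at h1
        have h3 : (⌈s * n / t⌉₊ : ℝ) * t ≤ s * n + t := by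
          have := mul_le_mul_of_nonneg_right h2.le ht
          rwa [add_mul, div_mul_cancel₀ _ ht0.ne', one_mul] at this
        rw [abs_of_nonneg (by rw [sub_nonneg, le_div_iff₀ hn']; linarith), sub_le_iff_le_add,
          div_le_iff₀ hn', add_mul, mul_assoc, one_div, inv_mul_cancel₀ hn'.ne']
        linarith
      · have := tendsto_one_div_atTop_nhds_zero_nat (𝕜 := ℝ) |>.const_mul (t : ℝ)
        rwa [mul_zero] at this
  refine (tendsto_const_nhds.sub hlim).congr' ?_
  filter_upwards [eventually_gt_atTop 0] with n hn using (hsum n hn).symm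

end

end CNSE

namespace CNSE

noncomputable section

/-! ### The noise as a field on the unit interval -/

instance : IsFiniteMeasure unitVol := by rw [unitVol_eq]; infer_instance

lemma setIntegral_unitVol (f : ℝ → ℝ) {x : ℝ} (hx : x ∈ Icc (0 : ℝ) 1) :
    ∫ y in Ioc 0 x, f y ∂unitVol = ∫ y in (0 : ℝ)..x, f y := by
  rw [intervalIntegral.integral_of_le hx.1, unitVol_eq,
    Measure.restrict_restrict measurableSet_Ioc, Ioc_inter_Ioc, max_self, min_eq_left hx.2]

/-- The primitive at `x` of a square integrable function. -/
def primitiveAt (x : ℝ) (v : Lp ℝ 2 unitVol) : ℝ :=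
  inner ℝ (indicatorConstLp 2 (measurableSet_Ioc (a := (0 : ℝ)) (b := x)) (measure_ne_top unitVol _)
    (1 : ℝ)) v

lemma primitiveAt_eq {x : ℝ} (hx : x ∈ Icc (0 : ℝ) 1) (v : Lp ℝ 2 unitVol) :
    primitiveAt x v = ∫ y in (0 : ℝ)..x, v y := by
  rw [primitiveAt, L2.inner_indicatorConstLp_one, setIntegral_unitVol _ hx]

lemma abs_primitiveAt_le (x : ℝ) (v : Lp ℝ 2 unitVol) : |primitiveAt x v| ≤ ‖v‖ := by
  refine (abs_real_inner_le_norm _ _).trans (mul_le_of_le_one_left (norm_nonneg _) ?_)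
  rw [norm_indicatorConstLp two_ne_zero ENNReal.ofNat_ne_top, norm_one, one_mul]
  refine Real.rpow_le_one measureReal_nonneg ?_ (by positivity)
  rw [unitVol_eq]
  refine (measureReal_mono (subset_univ _)).trans ?_
  simp

lemma continuous_primitiveAt (x : ℝ) : Continuous (primitiveAt x) :=
  continuous_const.inner continuous_id

lemma continuousOn_primitiveAt (v : Lp ℝ 2 unitVol) :
    ContinuousOn (fun x => primitiveAt x v) (Icc 0 1) := by
  have hv : IntervalIntegrable v volume 0 1 := by
    rw [intervalIntegrable_iff_integrableOn_Ioc_of_le zero_le_one]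
    exact ((Lp.memLp v).integrable one_le_two).mono_measure unitVol_eq.symm.le
  exact ((ACPair.primitive hv).continuousOn zero_le_one).congr fun x hx => primitiveAt_eq hx v

/-- The derivatives of the noise coefficients as elements of `L²(0,1)`. -/
def noiseVec {σ : ℕ → ℝ → ℝ} (hσ : IsNoiseCoefficient σ) (k : ℕ) : Lp ℝ 2 unitVol :=
  (hσ.memH2 k).1.2.toLp (deriv (σ k))

variable {σ : ℕ → ℝ → ℝ}

/-- The noise field is encoded by its x-derivative in L²(0,1). Since the coefficients vanish at 0,
evaluation at x is the continuous linear functional `primitiveAt x`, through which limits in L²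
pass. -/
lemma primitiveAt_noiseVec (hσ : IsNoiseCoefficient σ) (k : ℕ) {x : ℝ} (hx : x ∈ Icc (0 : ℝ) 1) :
    primitiveAt x (noiseVec hσ k) = σ k x := by
  rw [primitiveAt_eq hx, (hσ.memH2 k).1.acPair.eq x hx, (hσ.memH10 k).2.1, zero_add]
  refine intervalIntegral.integral_congr_ae ?_
  have := (ae_restrict_iff' measurableSet_Ioc).1
    (ae_mono unitVol_eq.symm.le (hσ.memH2 k).1.2.coeFn_toLp)
  filter_upwards [this] with y hy hy'
  rw [uIoc_of_le hx.1] at hy'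
  exact hy (Ioc_subset_Ioc_right hx.2 hy')

lemma primitiveAt_partialNoise {Ω : Type*} (W : ℕ → ℝ≥0 → Ω → ℝ) (hσ : IsNoiseCoefficient σ)
    (n : ℕ) (t : ℝ≥0) (ω : Ω) {x : ℝ} (hx : x ∈ Icc (0 : ℝ) 1) :
    primitiveAt x (partialNoise W (noiseVec hσ) n t ω)
      = ∑ k ∈ Finset.range n, W k t ω * σ k x := by
  rw [primitiveAt, partialNoise, inner_sum]
  refine Finset.sum_congr rfl fun k _ => ?_
  rw [real_inner_smul_right, ← primitiveAt_noiseVec hσ k hx, primitiveAt]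

/-- The coefficient vanishes at both ends, so its derivative has mean zero and is bounded by the L²
norm of the second derivative. The assumption on the second derivatives thereby yields summability
of the squared norms. -/
lemma norm_noiseVec_le (hσ : IsNoiseCoefficient σ) (k : ℕ) :
    ENNReal.ofReal (‖noiseVec hσ k‖ ^ 2) ≤ ∫⁻ x, ‖deriv (deriv (σ k)) x‖ₑ ^ 2 ∂unitVol := by
  have h01 := zero_le_one (α := ℝ)
  obtain ⟨g, hg, h1, h2⟩ := (hσ.memH2 k).exists_version
  have hd := (hσ.memH2 k).1.memL2_deriv
  have hg' := hg.memL2_deriv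
  have h1' : deriv (σ k) =ᵐ[volume.restrict (Ioc (0 : ℝ) 1)] g := ae_Ioo_of_forall h1
  have hz : ∫ x in (0 : ℝ)..1, g x = 0 := by
    have e := (hσ.memH2 k).1.acPair.integral_eq h01
    rw [(hσ.memH10 k).2.1, (hσ.memH10 k).2.2, sub_zero] at e
    refine Eq.trans ?_ e
    rw [intervalIntegral.integral_of_le h01, intervalIntegral.integral_of_le h01]
    exact (integral_congr_ae h1').symm
  have hle : nrm (deriv (σ k)) ^ 2 ≤ ∫ x in (0 : ℝ)..1, deriv g x ^ 2 := by
    rw [nrm_congr h1', nrm_sq, ← nrm_sq (deriv g)]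
    have := intervalIntegral.integral_mono_on h01 hg.acPair.memL2.sq_integrable
      (intervalIntegrable_const (c := nrm (deriv g) ^ 2)) fun x hx =>
        sq_le_sq' (neg_le_of_abs_le (hg.acPair.abs_le_of_integral_eq_zero hg' hz hx))
          (le_of_abs_le (hg.acPair.abs_le_of_integral_eq_zero hg' hz hx))
    simpa using this
  rw [noiseVec, Lp.norm_toLp, eLpNorm_eq_nrm hd, ENNReal.toReal_ofReal (nrm_nonneg _)]
  refine (ENNReal.ofReal_le_ofReal hle).trans_eq ?_
  rw [intervalIntegral.integral_of_le h01, ofReal_integral_eq_lintegral_ofReal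
    ((intervalIntegrable_iff_integrableOn_Ioc_of_le h01).1 hg'.sq_integrable)
    (Eventually.of_forall fun x => sq_nonneg _), unitVol_eq]
  refine lintegral_congr_ae (ae_Ioo_of_forall fun x hx => ?_)
  simp only [h2 x hx]
  rw [← sq_abs, ENNReal.ofReal_pow (abs_nonneg _), Real.enorm_eq_ofReal_abs]

lemma summable_norm_noiseVec (hσ : IsNoiseCoefficient σ) : Summable fun k => ‖noiseVec hσ k‖ ^ 2 := by
  have h : ∑' k, ENNReal.ofReal (‖noiseVec hσ k‖ ^ 2) < ∞ := by
    refine lt_of_le_of_lt (ENNReal.tsum_le_tsum (norm_noiseVec_le hσ)) ?_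
    rw [← lintegral_tsum fun k => ((measurable_deriv _).enorm.pow_const 2).aemeasurable]
    exact hσ.summable
  have := ENNReal.summable_toReal h.ne
  simpa only [ENNReal.toReal_ofReal (sq_nonneg _)] using this

end

end CNSE

namespace CNSE

noncomputable section

/-! ### The momentum equation along a path of the noise -/

lemma primitiveAt_sub (x : ℝ) (v w : Lp ℝ 2 unitVol) :
    primitiveAt x (v - w) = primitiveAt x v - primitiveAt x w := inner_sub_right _ _ _

/-- Evaluation is 1-Lipschitz in the field, uniformly in the point, and continuous in the point for
a fixed field. Together these give joint continuity. -/
lemma continuous_primitiveAt_clamp :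
    Continuous fun z : ℝ × Lp ℝ 2 unitVol => primitiveAt (clamp z.1) z.2 := by
  refine continuous_prod_of_continuous_lipschitzWith' _ 1 (fun x => ?_) fun v =>
    (continuousOn_primitiveAt v).comp_continuous continuous_clamp clamp_mem
  refine LipschitzWith.of_dist_le_mul fun v w => ?_
  rw [NNReal.coe_one, one_mul, Real.dist_eq, dist_eq_norm, ← primitiveAt_sub]
  exact abs_primitiveAt_le _ _

lemma continuous_primitiveAt_path {S : ℝ≥0 → Lp ℝ 2 unitVol} (hS : Continuous S) :
    Continuous fun z : ℝ × ℝ => primitiveAt (clamp z.2) (S z.1.toNNReal) :=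
  continuous_primitiveAt_clamp.comp (continuous_snd.prodMk (hS.comp (by fun_prop)))

/-- The spatial derivative of the momentum. -/
def massFlux (p : Path) (t x : ℝ) : ℝ := p.ρx t x * p.u t x + p.ρ t x * p.ux t x

/-- The dominating function of the noise is merely integrable in time. This suffices because the
spatial L¹ norm of the mass flux is bounded uniformly in time. -/
lemma IsRegular.integrable_mul_massFlux {T : ℝ} (hT : 0 ≤ T) {p : Path} (hp : IsRegular T p)
    {Θ : ℝ → ℝ} (hΘ : IntervalIntegrable Θ volume 0 T) :
    Integrable (fun z : ℝ × ℝ => Θ z.1 * massFlux p z.1 z.2) (stripVol T) := by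
  have h01 := zero_le_one (α := ℝ)
  have hF : Measurable fun z : ℝ × ℝ => massFlux p z.1 z.2 :=
    (hp.meas_ρx.mul hp.cont_u.measurable).add (hp.cont_ρ.measurable.mul hp.meas_ux)
  obtain ⟨C, hC⟩ := hp.bound
  obtain ⟨C₁, hC₁, hρ⟩ := exists_bound_strip hp.cont_ρ T
  obtain ⟨C₂, hC₂, hu⟩ := exists_bound_strip hp.cont_u T
  have hi : ∀ t ∈ Icc 0 T, IntervalIntegrable (massFlux p t) volume 0 1 ∧
      ∫ x in (0 : ℝ)..1, |massFlux p t x| ≤ C * C₂ + C₁ * C := by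
    intro t ht
    obtain ⟨m1, m2, n1, n2⟩ := hC t ht
    have i1 : IntervalIntegrable (massFlux p t) volume 0 1 :=
      (m1.integrable'.mul_continuousOn (hp.continuous_u t).continuousOn).add
        (m2.integrable'.continuousOn_mul (hp.continuous_ρ t).continuousOn)
    have b1 : IntervalIntegrable (fun x => |p.ρx t x| * C₂ + C₁ * |p.ux t x|) volume 0 1 :=
      (m1.integrable'.abs.mul_const _).add (m2.integrable'.abs.const_mul _)
    refine ⟨i1, (intervalIntegral.integral_mono_on h01 i1.abs b1 fun x hx => ?_).trans ?_⟩
    · refine (abs_add_le _ _).trans ?_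
      rw [abs_mul, abs_mul]
      gcongr
      · exact hu t ht x hx
      · exact hρ t ht x hx
    · rw [intervalIntegral.integral_add (m1.integrable'.abs.mul_const _)
        (m2.integrable'.abs.const_mul _), intervalIntegral.integral_mul_const,
        intervalIntegral.integral_const_mul]
      gcongr
      · exact (integral_abs_le_nrm m1).trans n1
      · exact (integral_abs_le_nrm m2).trans n2
  have hΘ' := (intervalIntegrable_iff_integrableOn_Ioc_of_le hT).1 hΘ
  have hmeas : AEStronglyMeasurable (fun z : ℝ × ℝ => Θ z.1 * massFlux p z.1 z.2) (stripVol T) :=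
    hΘ'.aestronglyMeasurable.comp_fst.mul hF.aestronglyMeasurable
  refine (integrable_prod_iff hmeas).2 ⟨?_, ?_⟩
  · refine ae_Icc_of_ae fun t ht => ?_
    exact ((intervalIntegrable_iff_integrableOn_Ioc_of_le h01).1 (hi t ht).1).const_mul (Θ t)
  · have hm : AEStronglyMeasurable (fun t => ∫ x in Ioc (0 : ℝ) 1, |massFlux p t x|)
        (volume.restrict (Ioc 0 T)) :=
      (hF.norm.stronglyMeasurable.integral_prod_right
        (ν := volume.restrict (Ioc (0 : ℝ) 1))).aestronglyMeasurable
    refine (hΘ'.norm.mul_bdd (c := C * C₂ + C₁ * C) hm (ae_Icc_of_ae fun t ht => ?_)).congr ?_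
    · rw [Real.norm_of_nonneg (integral_nonneg fun _ => abs_nonneg _),
        ← intervalIntegral.integral_of_le h01]
      exact (hi t ht).2
    · refine Eventually.of_forall fun t => ?_
      simp only [norm_mul, integral_const_mul]
      rfl

variable {S : ℕ → ℝ≥0 → Lp ℝ 2 unitVol} {ξ : ℝ → Lp ℝ 2 unitVol}

namespace NoiseLimit

lemma ae_Ioc (h : NoiseLimit S ξ) (T : ℝ) : ∀ᵐ t ∂volume.restrict (Ioc 0 T),
    Tendsto (fun j => S j t.toNNReal) atTop (𝓝 (ξ t)) ∧
    ∃ r : ℕ → ℚ, (∀ m, 0 ≤ r m) ∧ Tendsto (fun m => (r m : ℝ)) atTop (𝓝 t) ∧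
      Tendsto (fun m => ξ (r m)) atTop (𝓝 (ξ t)) :=
  ae_mono (Measure.restrict_mono Ioc_subset_Ioi_self le_rfl) h.ae

lemma aemeasurable (h : NoiseLimit S ξ) (hS : ∀ j, Continuous (S j)) (T : ℝ) :
    AEMeasurable (fun z : ℝ × ℝ => primitiveAt z.2 (ξ z.1)) (stripVol T) := by
  refine aemeasurable_of_tendsto_metrizable_ae atTop
    (f := fun j (z : ℝ × ℝ) => primitiveAt (clamp z.2) (S j z.1.toNNReal)) 
    (fun j => (continuous_primitiveAt_path (hS j)).aemeasurable) ?_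
  · filter_upwards [Measure.quasiMeasurePreserving_fst.ae (h.ae_Ioc T), ae_stripVol_mem T]
      with z hz hz'
    rw [clamp_eq (Ioc_subset_Icc_self hz'.2)]
    exact ((continuous_primitiveAt z.2).tendsto _).comp hz.1

lemma noiseIntegrable (h : NoiseLimit S ξ) (hS : ∀ j, Continuous (S j)) {T : ℕ} {p : Path}
    (hp : IsRegular T p) : NoiseIntegrable T p fun t x => primitiveAt x (ξ t) := by
  obtain ⟨Θ, hΘ, hb⟩ := h.bound T
  have hF := hp.integrable_flux T.cast_nonneg
  refine (hp.integrable_mul_massFlux T.cast_nonneg hΘ).mono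
    (hF.aestronglyMeasurable.mul (h.aemeasurable hS T).aestronglyMeasurable) ?_
  filter_upwards [Measure.quasiMeasurePreserving_fst.ae (h.ae_Ioc T),
    Measure.quasiMeasurePreserving_fst.ae hb] with z hz hz'
  rw [norm_mul, norm_mul, mul_comm]
  have : ‖ξ z.1‖ ≤ Θ z.1 := le_of_tendsto hz.1.norm (Eventually.of_forall hz')
  exact mul_le_mul_of_nonneg_right ((abs_primitiveAt_le _ _).trans (this.trans (le_abs_self _)))
    (norm_nonneg _)

/-- Convergence of the drift generated by the noise. -/
lemma tendsto_integral_massFlux (h : NoiseLimit S ξ) (hS : ∀ j, Continuous (S j)) {T : ℕ} {p : Path}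
    (hp : IsRegular T p) {q : ℝ} (hq : q ∈ Icc (0 : ℝ) T) (i : ℚ × ℚ × ℚ) :
    Tendsto (fun j => ∫ s in (0 : ℝ)..q, ∫ x in (0 : ℝ)..1,
      massFlux p s x * primitiveAt x (S j s.toNNReal) * bumpTest i x) atTop
      (𝓝 (∫ s in (0 : ℝ)..q, ∫ x in (0 : ℝ)..1,
        massFlux p s x * primitiveAt x (ξ s) * bumpTest i x)) := by
  have h01 := zero_le_one (α := ℝ)
  have hTm : stripVol q ≤ stripVol T := stripVol_mono hq.2
  obtain ⟨Θ, hΘ, hb⟩ := h.bound T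
  have hF := (hp.integrable_flux T.cast_nonneg).mono_measure hTm
  have hdom := ((hp.integrable_mul_massFlux T.cast_nonneg hΘ).mono_measure hTm).norm
  have hφ := ((continuous_bumpTest i).comp (continuous_snd (X := ℝ))).aestronglyMeasurable
    (μ := stripVol q)
  have mem := ae_stripVol_mem q
  have hb' : ∀ᵐ z ∂stripVol q, ∀ j, ‖S j z.1.toNNReal‖ ≤ Θ z.1 :=
    ae_mono hTm (Measure.quasiMeasurePreserving_fst.ae hb)
  have hl' : ∀ᵐ z ∂stripVol q, Tendsto (fun j => S j z.1.toNNReal) atTop (𝓝 (ξ z.1)) :=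
    (Measure.quasiMeasurePreserving_fst.ae (h.ae_Ioc q)).mono fun z hz => hz.1
  have hbound : ∀ (v : Lp ℝ 2 unitVol) (z : ℝ × ℝ), ‖v‖ ≤ Θ z.1 →
      ‖massFlux p z.1 z.2 * primitiveAt z.2 v * bumpTest i z.2‖
        ≤ ‖Θ z.1 * massFlux p z.1 z.2‖ := fun v z hv => by
    rw [norm_mul, norm_mul, norm_mul, mul_comm ‖massFlux _ _ _‖]
    refine mul_le_of_le_one_right (by positivity) (abs_bumpTest_le i _) |>.trans ?_
    exact mul_le_mul_of_nonneg_right ((abs_primitiveAt_le _ _).trans (hv.trans (le_abs_self _)))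
      (norm_nonneg _)
  have hmj : ∀ j, AEStronglyMeasurable (fun z : ℝ × ℝ =>
      massFlux p z.1 z.2 * primitiveAt z.2 (S j z.1.toNNReal) * bumpTest i z.2) (stripVol q) := by
    intro j
    refine (hF.aestronglyMeasurable.mul ?_).mul hφ
    refine (continuous_primitiveAt_path (hS j)).aestronglyMeasurable.congr ?_
    filter_upwards [mem] with z hz
    rw [clamp_eq (Ioc_subset_Icc_self hz.2)]
  have hml : AEStronglyMeasurable (fun z : ℝ × ℝ =>
      massFlux p z.1 z.2 * primitiveAt z.2 (ξ z.1) * bumpTest i z.2) (stripVol q) :=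
    (hF.aestronglyMeasurable.mul (h.aemeasurable hS q).aestronglyMeasurable).mul hφ
  have hij : ∀ j, Integrable (fun z : ℝ × ℝ =>
      massFlux p z.1 z.2 * primitiveAt z.2 (S j z.1.toNNReal) * bumpTest i z.2) (stripVol q) :=
    fun j => hdom.mono' (hmj j) (hb'.mono fun z hz => hbound _ z (hz j))
  have hil : Integrable (fun z : ℝ × ℝ =>
      massFlux p z.1 z.2 * primitiveAt z.2 (ξ z.1) * bumpTest i z.2) (stripVol q) :=
    hdom.mono' hml (by
      filter_upwards [hb', hl'] with z hz hz'
      exact hbound _ z (le_of_tendsto hz'.norm (Eventually.of_forall hz)))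
  have key := tendsto_integral_of_dominated_convergence _ hmj hdom
    (fun j => hb'.mono fun z hz => hbound _ z (hz j)) (by
      filter_upwards [hl'] with z hz
      exact ((((continuous_primitiveAt z.2).tendsto _).comp hz).const_mul _).mul_const (bumpTest i z.2))
  simp only [intervalIntegral.integral_of_le hq.1, intervalIntegral.integral_of_le h01]
  have e : ∫ z, massFlux p z.1 z.2 * primitiveAt z.2 (ξ z.1) * bumpTest i z.2 ∂stripVol q = _ :=
    integral_prod _ hil
  rw [← e]
  exact key.congr fun j => integral_prod _ (hij j)

end NoiseLimit

end

end CNSE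

/-! ### Insertion of the pathwise noise into the momentum equation. -/

namespace CNSE

noncomputable section

variable {S : ℕ → ℝ≥0 → Lp ℝ 2 unitVol} {ξ : ℝ → Lp ℝ 2 unitVol}

lemma intervalIntegrable_primitiveAt (v : Lp ℝ 2 unitVol) :
    IntervalIntegrable (fun x => primitiveAt x v) volume 0 1 :=
  ContinuousOn.intervalIntegrable (by
    rw [uIcc_of_le zero_le_one]
    exact continuousOn_primitiveAt v)

lemma integrable_mul_bumpTest {T : ℝ} {f : ℝ → ℝ → ℝ} (i : ℚ × ℚ × ℚ)
    (hf : Integrable (fun z : ℝ × ℝ => f z.1 z.2) (stripVol T)) :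
    Integrable (fun z : ℝ × ℝ => f z.1 z.2 * bumpTest i z.2) (stripVol T) :=
  hf.mul_bdd (c := 1) ((continuous_bumpTest i).comp continuous_snd).aestronglyMeasurable
    (Eventually.of_forall fun z => abs_bumpTest_le i z.2)

/-- The momentum equation extends from rational times to almost every time. -/
lemma NoiseLimit.weakMomentum_ae (h : NoiseLimit S ξ) (hS : ∀ j, Continuous (S j)) {T : ℕ} {A : ℝ}
    {p : Path} (hp : IsRegular T p)
    (hrat : ∀ q : ℚ, (q : ℝ) ∈ Icc (0 : ℝ) T → WeakMomentum A p (fun t x => primitiveAt x (ξ t)) q) :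
    ∀ᵐ t ∂volume.restrict (Ioc (0 : ℝ) T), WeakMomentum A p (fun t x => primitiveAt x (ξ t)) t := by
  have h01 := zero_le_one (α := ℝ)
  have hT : (0 : ℝ) ≤ T := T.cast_nonneg
  obtain ⟨C₁, hC₁, hρ⟩ := exists_bound_strip hp.cont_ρ T
  obtain ⟨C₂, hC₂, hu⟩ := exists_bound_strip hp.cont_u T
  -- The endpoint T is excluded because the approximating rational times may exceed t and would then
  -- leave [0,T].
  filter_upwards [h.ae_Ioc T, ae_restrict_mem measurableSet_Ioc,
    ae_restrict_of_ae (compl_mem_ae_iff.2 (measure_singleton (μ := volume) (T : ℝ)))]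
    with t ⟨_, r, hr0, hrt, hrξ⟩ ht htT
  intro i
  have htT' : t < T := lt_of_le_of_ne ht.2 htT
  have hev : ∀ᶠ m in atTop, (r m : ℝ) ∈ Icc (0 : ℝ) T := by
    filter_upwards [hrt.eventually (Iio_mem_nhds htT')] with m hm
    exact ⟨by exact_mod_cast hr0 m, (mem_Iio.1 hm).le⟩
  have hD := integrable_strip_iff (g := fun s x =>
    momentumDrift A p (fun t x => primitiveAt x (ξ t)) s x * bumpTest i x) hT (integrable_mul_bumpTest i
    (hp.integrable_momentumDrift (A := A) hT (h.noiseIntegrable hS hp)))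
  have h2 : Tendsto (fun m => ∫ s in (0 : ℝ)..(r m : ℝ), ∫ x in (0 : ℝ)..1,
      momentumDrift A p (fun t x => primitiveAt x (ξ t)) s x * bumpTest i x) atTop
      (𝓝 (∫ s in (0 : ℝ)..t, ∫ x in (0 : ℝ)..1,
        momentumDrift A p (fun t x => primitiveAt x (ξ t)) s x * bumpTest i x)) :=
    ((((ACPair.primitive hD).continuousOn hT).continuousAt (Icc_mem_nhds ht.1 htT')).tendsto).comp hrt
  have h1 : Tendsto (fun m => ∫ x in (0 : ℝ)..1, (p.ρ (r m) x * (p.u (r m) x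
      - primitiveAt x (ξ (r m))) - p.ρ 0 x * p.u 0 x) * bumpTest i x) atTop
      (𝓝 (∫ x in (0 : ℝ)..1, (p.ρ t x * (p.u t x - primitiveAt x (ξ t))
        - p.ρ 0 x * p.u 0 x) * bumpTest i x)) := by
    have cb := continuous_bumpTest i
    refine intervalIntegral.tendsto_integral_filter_of_dominated_convergence
      (fun _ => C₁ * (C₂ + (‖ξ t‖ + 1)) + C₁ * C₂) (Eventually.of_forall fun m => ?_) ?_
      intervalIntegrable_const (Eventually.of_forall fun x _ => ?_)
    · rw [uIoc_of_le h01]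
      have c1 := hp.continuous_ρ (r m)
      have c2 := hp.continuous_u (r m)
      have c3 := hp.continuous_ρ 0
      have c4 := hp.continuous_u 0
      have c5 := (continuousOn_primitiveAt (ξ (r m))).mono Ioc_subset_Icc_self
      exact ContinuousOn.aestronglyMeasurable (by fun_prop) measurableSet_Ioc
    · filter_upwards [hev, hrξ.norm.eventually (Iio_mem_nhds (lt_add_one _))] with m hm hm'
      refine Eventually.of_forall fun x hx => ?_
      rw [uIoc_of_le h01] at hx
      have hx := Ioc_subset_Icc_self hx
      rw [norm_mul]
      refine (mul_le_of_le_one_right (norm_nonneg _) (abs_bumpTest_le i x)).trans ?_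
      refine (norm_sub_le _ _).trans ?_
      rw [norm_mul, norm_mul]
      gcongr
      · exact hρ _ hm x hx
      · refine (norm_sub_le _ _).trans ?_
        gcongr
        · exact hu _ hm x hx
        · exact (abs_primitiveAt_le x _).trans (mem_Iio.1 hm').le
      · exact hρ 0 ⟨le_rfl, hT⟩ x hx
      · exact hu 0 ⟨le_rfl, hT⟩ x hx
    · have c1 : Continuous fun t => p.ρ t x :=
        hp.cont_ρ.comp (by fun_prop : Continuous fun t => (t, x))
      have c2 : Continuous fun t => p.u t x :=
        hp.cont_u.comp (by fun_prop : Continuous fun t => (t, x))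
      exact ((((c1.tendsto t).comp hrt).mul (((c2.tendsto t).comp hrt).sub
        (((continuous_primitiveAt x).tendsto _).comp hrξ))).sub_const _).mul_const _
  refine tendsto_nhds_unique (h1.add h2) (tendsto_const_nhds.congr' ?_)
  filter_upwards [hev] with m hm using (hrat (r m) hm i).symm

/-- The pairing of the density with a fixed function is absolutely continuous in time. -/
lemma IsStripPath.acPair_integral {T : ℝ} (hT : 0 ≤ T) {p : Path} (hp : IsStripPath T p) {κ : ℝ → ℝ}
    (hκ : Continuous κ) : ACPair T (fun t => ∫ x in (0 : ℝ)..1, p.ρ t x * κ x)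
      (fun t => -∫ x in (0 : ℝ)..1, massFlux p t x * κ x) := by
  have hk : TimeDeriv T (fun _ x => κ x) (fun _ _ => 0) :=
    ⟨integrable_zero _ _ _, Eventually.of_forall fun x => ACPair.const _⟩
  have c0 := hp.continuous_ρ 0
  have := (hp.continuity.mul hT hk hp.cont_ρ (hκ.comp continuous_snd)).integral hT
    (Continuous.intervalIntegrable (by fun_prop) _ _)
  refine this.congr hT (fun _ _ => rfl) (Eventually.of_forall fun t => ?_)
  rw [← intervalIntegral.integral_neg]
  refine intervalIntegral.integral_congr fun x _ => ?_
  simp only [massFlux]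
  ring

lemma IsRegular.intervalIntegrable_massFlux {T : ℝ} {p : Path} (hp : IsRegular T p) {t : ℝ}
    (ht : t ∈ Icc 0 T) : IntervalIntegrable (massFlux p t) volume 0 1 :=
  ((hp.ac_ρ t ht).mul zero_le_one (hp.ac_u t ht)).integrable

/-- Summation of the stochastic integrals of finitely many modes. -/
lemma IsStripPath.sum_integral {T : ℝ} {p : Path} (hp : IsStripPath T p)
    {w : ℕ → ℝ≥0 → ℝ} (hw : ∀ k, Continuous (w k)) {κ : ℕ → ℝ → ℝ} (hκ : ∀ k, Continuous (κ k))
    {φ : ℝ → ℝ} (hφ : Continuous φ) {q : ℝ} (hq : q ∈ Icc 0 T) (n : ℕ) :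
    ∑ k ∈ Finset.range n, ((∫ x in (0 : ℝ)..1, p.ρ q x * (κ k x * φ x)) * w k q.toNNReal
        - ∫ s in (0 : ℝ)..q, w k s.toNNReal * -∫ x in (0 : ℝ)..1, massFlux p s x * (κ k x * φ x))
      = (∫ x in (0 : ℝ)..1, p.ρ q x * (∑ k ∈ Finset.range n, w k q.toNNReal * κ k x) * φ x)
        + ∫ s in (0 : ℝ)..q, ∫ x in (0 : ℝ)..1,
          massFlux p s x * (∑ k ∈ Finset.range n, w k s.toNNReal * κ k x) * φ x := by
  have h01 := zero_le_one (α := ℝ)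
  have c0 := hp.continuous_ρ q
  have hκφ : ∀ k, Continuous fun x => κ k x * φ x := fun k => (hκ k).mul hφ
  have e1 : ∫ x in (0 : ℝ)..1, p.ρ q x * (∑ k ∈ Finset.range n, w k q.toNNReal * κ k x) * φ x
      = ∑ k ∈ Finset.range n, (∫ x in (0 : ℝ)..1, p.ρ q x * (κ k x * φ x)) * w k q.toNNReal := by
    simp only [← intervalIntegral.integral_mul_const]
    rw [← intervalIntegral.integral_finsetSum fun k _ => by
      have := hκ k
      exact Continuous.intervalIntegrable (by fun_prop) _ _]
    refine intervalIntegral.integral_congr fun x _ => ?_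
    simp only [Finset.mul_sum, Finset.sum_mul]
    exact Finset.sum_congr rfl fun k _ => by ring
  have e2 : ∫ s in (0 : ℝ)..q, ∫ x in (0 : ℝ)..1,
      massFlux p s x * (∑ k ∈ Finset.range n, w k s.toNNReal * κ k x) * φ x
      = ∑ k ∈ Finset.range n, ∫ s in (0 : ℝ)..q, w k s.toNNReal *
        ∫ x in (0 : ℝ)..1, massFlux p s x * (κ k x * φ x) := by
    rw [← intervalIntegral.integral_finsetSum]
    · refine intervalIntegral.integral_congr fun s hs => ?_
      rw [uIcc_of_le hq.1] at hs
      have hi := hp.toIsRegular.intervalIntegrable_massFlux ⟨hs.1, hs.2.trans hq.2⟩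
      simp only [← intervalIntegral.integral_const_mul]
      rw [← intervalIntegral.integral_finsetSum fun k _ =>
        (hi.mul_continuousOn (hκφ k).continuousOn).const_mul _]
      refine intervalIntegral.integral_congr fun x _ => ?_
      simp only [Finset.mul_sum, Finset.sum_mul]
      exact Finset.sum_congr rfl fun k _ => by ring
    · intro k _
      have h1 := (((hp.mono hq.1 hq.2).acPair_integral hq.1 (hκφ k)).integrable).neg
      have h2 := h1.continuousOn_mul
        ((hw k).comp continuous_real_toNNReal).continuousOn
      simpa only [Pi.neg_apply, neg_neg, Function.comp_apply] using h2
  rw [Finset.sum_sub_distrib, e1, e2]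
  simp only [mul_neg, intervalIntegral.integral_neg, Finset.sum_neg_distrib, sub_neg_eq_add]

/-- Identification of the noise in the momentum equation at a fixed time. -/
lemma NoiseLimit.weakMomentum_apply (h : NoiseLimit S ξ) (hS : ∀ j, Continuous (S j)) {T : ℕ} {A : ℝ}
    {p : Path} (hp : IsRegular T p) {q : ℝ} (hq : q ∈ Icc (0 : ℝ) T)
    (hSq : Tendsto (fun j => S j q.toNNReal) atTop (𝓝 (ξ q))) (i : ℚ × ℚ × ℚ) {ns : ℕ → ℕ}
    (hns : StrictMono ns)
    (hI : Tendsto (fun j => (∫ x in (0 : ℝ)..1, p.ρ q x * primitiveAt x (S (ns j) q.toNNReal)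
        * bumpTest i x) + ∫ s in (0 : ℝ)..q, ∫ x in (0 : ℝ)..1,
          massFlux p s x * primitiveAt x (S (ns j) s.toNNReal) * bumpTest i x) atTop
      (𝓝 ((∫ x in (0 : ℝ)..1, p.ρ q x * p.u q x * bumpTest i x)
          - (∫ x in (0 : ℝ)..1, p.ρ 0 x * p.u 0 x * bumpTest i x)
          - (∫ s in (0 : ℝ)..q, ∫ x in (0 : ℝ)..1,
              (p.ρ s x * p.u s x ^ 2 + A ^ 2 * p.ρ s x) * deriv (bumpTest i) x)
          + (∫ s in (0 : ℝ)..q, ∫ x in (0 : ℝ)..1, p.ux s x * deriv (bumpTest i) x)))) :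
    (∫ x in (0 : ℝ)..1, (p.ρ q x * (p.u q x - primitiveAt x (ξ q)) - p.ρ 0 x * p.u 0 x)
      * bumpTest i x) + ∫ s in (0 : ℝ)..q, ∫ x in (0 : ℝ)..1,
        momentumDrift A p (fun t x => primitiveAt x (ξ t)) s x * bumpTest i x = 0 := by
  have h01 := zero_le_one (α := ℝ)
  have hT : (0 : ℝ) ≤ T := T.cast_nonneg
  have cb := continuous_bumpTest i
  have cρ := hp.continuous_ρ q
  have cu := hp.continuous_u q
  have cρ0 := hp.continuous_ρ 0
  have cu0 := hp.continuous_u 0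
  obtain ⟨C₁, hC₁, hρ⟩ := exists_bound_strip hp.cont_ρ T
  have hl1 : Tendsto (fun j => ∫ x in (0 : ℝ)..1,
      p.ρ q x * primitiveAt x (S j q.toNNReal) * bumpTest i x) atTop
      (𝓝 (∫ x in (0 : ℝ)..1, p.ρ q x * primitiveAt x (ξ q) * bumpTest i x)) := by
    refine intervalIntegral.tendsto_integral_filter_of_dominated_convergence
      (fun _ => C₁ * (‖ξ q‖ + 1)) (Eventually.of_forall fun m => ?_) ?_
      intervalIntegrable_const (Eventually.of_forall fun x _ => ?_)
    · rw [uIoc_of_le h01]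
      have c5 := (continuousOn_primitiveAt (S m q.toNNReal)).mono Ioc_subset_Icc_self
      exact ContinuousOn.aestronglyMeasurable (by fun_prop) measurableSet_Ioc
    · filter_upwards [hSq.norm.eventually (Iio_mem_nhds (lt_add_one _))] with m hm
      refine Eventually.of_forall fun x hx => ?_
      rw [uIoc_of_le h01] at hx
      rw [norm_mul, norm_mul]
      refine (mul_le_of_le_one_right (by positivity) (abs_bumpTest_le i x)).trans ?_
      gcongr
      · exact hρ _ hq x (Ioc_subset_Icc_self hx)
      · exact (abs_primitiveAt_le x _).trans (mem_Iio.1 hm).le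
    · exact ((((continuous_primitiveAt x).tendsto _).comp hSq).const_mul _).mul_const _
  -- Uniqueness of limits identifies the tested stochastic term with ∫ ρ ζ φ plus the time integral
  -- of the mass flux against ζ φ, the integrated-by-parts form of ∫ ρ dζ.
  have hlim := tendsto_nhds_unique hI
    ((hl1.add (h.tendsto_integral_massFlux hS hp hq i)).comp hns.tendsto_atTop)
  have hTm : stripVol q ≤ stripVol T := stripVol_mono hq.2
  -- integrability in time of the tested terms
  have hN := (h.noiseIntegrable hS hp).mono_measure hTm
  have hDr := (hp.integrable_momentumDrift (A := A) hT (h.noiseIntegrable hS hp)).mono_measure hTm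
  have bN := integrable_mul_bumpTest (f := fun s x => massFlux p s x * primitiveAt x (ξ s)) i hN
  have bD := integrable_mul_bumpTest
    (f := momentumDrift A p fun t x => primitiveAt x (ξ t)) i hDr
  have bV := integrable_mul_bumpTest i ((hp.integrable_uxx hT).mono_measure hTm)
  have jN := integrable_strip_iff (g := fun s x => massFlux p s x * primitiveAt x (ξ s)
    * bumpTest i x) hq.1 bN
  have jD := integrable_strip_iff (g := fun s x =>
    momentumDrift A p (fun t x => primitiveAt x (ξ t)) s x * bumpTest i x) hq.1 bD
  have jV := integrable_strip_iff (g := fun s x => p.uxx s x * bumpTest i x) hq.1 bV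
  -- The viscous term is integrated by parts at almost every time only, where the velocity gradient
  -- has an absolutely continuous version.
  have e1 : ∀ᵐ s ∂volume.restrict (Ioc (0 : ℝ) q),
      ∫ x in (0 : ℝ)..1, p.ux s x * deriv (bumpTest i) x
        = -∫ x in (0 : ℝ)..1, p.uxx s x * bumpTest i x := by
    filter_upwards [ae_mono (Measure.restrict_mono (Ioc_subset_Ioc_right hq.2) le_rfl) hp.ac_ux]
      with s hs
    obtain ⟨-, g, hg, hgu⟩ := hs
    rw [← (isTestFunction_bumpTest i).integral_mul_deriv hg, intervalIntegral.integral_of_le h01,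
      intervalIntegral.integral_of_le h01]
    exact integral_congr_ae (hgu.mono fun x hx => by simp only [hx])
  have e2 : ∀ s ∈ Icc (0 : ℝ) q, ∫ x in (0 : ℝ)..1,
      (p.ρ s x * p.u s x ^ 2 + A ^ 2 * p.ρ s x) * deriv (bumpTest i) x
        = -∫ x in (0 : ℝ)..1, (massFlux p s x * p.u s x + p.ρ s x * p.u s x * p.ux s x
          + A ^ 2 * p.ρx s x) * bumpTest i x := by
    intro s hs
    have hs' : s ∈ Icc (0 : ℝ) T := ⟨hs.1, hs.2.trans hq.2⟩
    have a1 := hp.ac_ρ s hs'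
    have a2 := hp.ac_u s hs'
    have a3 := (((a1.mul h01 a2).mul h01 a2).add h01 (a1.const_mul h01 (A ^ 2)))
    have := (isTestFunction_bumpTest i).integral_mul_deriv a3
    simp only [massFlux]
    rw [← this]
    refine intervalIntegral.integral_congr fun x _ => ?_
    ring
  have e3 : ∀ᵐ s ∂volume.restrict (Ioc (0 : ℝ) q),
      ∫ x in (0 : ℝ)..1, (massFlux p s x * p.u s x + p.ρ s x * p.u s x * p.ux s x
          + A ^ 2 * p.ρx s x) * bumpTest i x
      = (∫ x in (0 : ℝ)..1, momentumDrift A p (fun t x => primitiveAt x (ξ t)) s x * bumpTest i x)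
        + (∫ x in (0 : ℝ)..1, massFlux p s x * primitiveAt x (ξ s) * bumpTest i x)
        + ∫ x in (0 : ℝ)..1, p.uxx s x * bumpTest i x := by
    filter_upwards [bD.prod_right_ae, bN.prod_right_ae, bV.prod_right_ae] with s i1 i2 i3
    simp only [intervalIntegral.integral_of_le h01]
    have i12 : Integrable (fun x => momentumDrift A p (fun t x => primitiveAt x (ξ t)) s x
      * bumpTest i x + massFlux p s x * primitiveAt x (ξ s) * bumpTest i x)
      (volume.restrict (Ioc (0 : ℝ) 1)) := i1.add i2
    rw [← integral_add i1 i2, ← integral_add i12 i3]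
    refine integral_congr_ae (Eventually.of_forall fun x => ?_)
    simp only [massFlux, momentumDrift]
    ring
  have e4 : ∫ s in (0 : ℝ)..q, ∫ x in (0 : ℝ)..1,
      (p.ρ s x * p.u s x ^ 2 + A ^ 2 * p.ρ s x) * deriv (bumpTest i) x
      = -((∫ s in (0 : ℝ)..q, ∫ x in (0 : ℝ)..1,
          momentumDrift A p (fun t x => primitiveAt x (ξ t)) s x * bumpTest i x)
        + (∫ s in (0 : ℝ)..q, ∫ x in (0 : ℝ)..1,
          massFlux p s x * primitiveAt x (ξ s) * bumpTest i x)
        + ∫ s in (0 : ℝ)..q, ∫ x in (0 : ℝ)..1, p.uxx s x * bumpTest i x) := by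
    rw [← intervalIntegral.integral_add jD jN, ← intervalIntegral.integral_add (jD.add jN) jV,
      ← intervalIntegral.integral_neg, intervalIntegral.integral_of_le hq.1,
      intervalIntegral.integral_of_le hq.1]
    refine integral_congr_ae ?_
    filter_upwards [e3, ae_restrict_mem measurableSet_Ioc] with s hs hs'
    rw [e2 s (Ioc_subset_Icc_self hs'), hs]
  have e5 : ∫ s in (0 : ℝ)..q, ∫ x in (0 : ℝ)..1, p.ux s x * deriv (bumpTest i) x
      = -∫ s in (0 : ℝ)..q, ∫ x in (0 : ℝ)..1, p.uxx s x * bumpTest i x := by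
    rw [← intervalIntegral.integral_neg, intervalIntegral.integral_of_le hq.1,
      intervalIntegral.integral_of_le hq.1]
    exact integral_congr_ae e1
  have e6 : ∫ x in (0 : ℝ)..1, (p.ρ q x * (p.u q x - primitiveAt x (ξ q)) - p.ρ 0 x * p.u 0 x)
      * bumpTest i x = (∫ x in (0 : ℝ)..1, p.ρ q x * p.u q x * bumpTest i x)
        - (∫ x in (0 : ℝ)..1, p.ρ q x * primitiveAt x (ξ q) * bumpTest i x)
        - ∫ x in (0 : ℝ)..1, p.ρ 0 x * p.u 0 x * bumpTest i x := by
    have i1 : IntervalIntegrable (fun x => p.ρ q x * p.u q x * bumpTest i x) volume 0 1 :=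
      Continuous.intervalIntegrable (by fun_prop) _ _
    have i2 : IntervalIntegrable (fun x => p.ρ q x * primitiveAt x (ξ q) * bumpTest i x) volume 0 1 :=
      ((intervalIntegrable_primitiveAt (ξ q)).continuousOn_mul cρ.continuousOn).mul_continuousOn
        cb.continuousOn
    have i3 : IntervalIntegrable (fun x => p.ρ 0 x * p.u 0 x * bumpTest i x) volume 0 1 :=
      Continuous.intervalIntegrable (by fun_prop) _ _
    rw [← intervalIntegral.integral_sub i1 i2, ← intervalIntegral.integral_sub (i1.sub i2) i3]
    refine intervalIntegral.integral_congr fun x _ => ?_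
    ring
  rw [e4, e5] at hlim
  rw [e6]
  linarith

end

end CNSE

namespace CNSE

noncomputable section

/-! ### Pathwise properties of solutions -/

variable {Ω : Type*} {mΩ : MeasurableSpace Ω} {P : Measure Ω} {F : Filtration ℝ≥0 mΩ}
  {W : ℕ → ℝ≥0 → Ω → ℝ} {A : ℝ} {σ : ℕ → ℝ → ℝ} {ρ₀ u₀ : ℝ → ℝ} {ρ u : ℝ≥0 → Ω → ℝ → ℝ}

/-- The path of a pair of processes at a point of the sample space. -/
def samplePath (ρ u : ℝ≥0 → Ω → ℝ → ℝ) (ω : Ω) : Path := toPath (fun t => ρ t ω) (fun t => u t ω)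

lemma samplePath_ρ (t : ℝ) (ω : Ω) {x : ℝ} (hx : x ∈ Icc (0 : ℝ) 1) :
    (samplePath ρ u ω).ρ t x = ρ t.toNNReal ω x := by
  simp only [samplePath, toPath, clamp_eq hx]

lemma samplePath_u (t : ℝ) (ω : Ω) {x : ℝ} (hx : x ∈ Icc (0 : ℝ) 1) :
    (samplePath ρ u ω).u t x = u t.toNNReal ω x := by
  simp only [samplePath, toPath, clamp_eq hx]

lemma IsSolution.isTrajectory (h : IsSolution P F W A σ ρ₀ u₀ ρ u) :
    ∀ᵐ ω ∂P, IsTrajectory (fun t => ρ t ω) (fun t => u t ω) := by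
  filter_upwards [h.continuous, h.density_H1, h.velocity_H1, h.velocity_H2] with ω h1 h2 h3 h4
  exact ⟨h1, h2, h3, h4⟩

/-- The exceptional event of the weak equation depends on the test function and on the time.
Countably many bumps and rational times leave a single null event. -/
lemma IsSolution.isStripPath (h : IsSolution P F W A σ ρ₀ u₀ ρ u) :
    ∀ᵐ ω ∂P, ∀ T : ℕ, IsStripPath T (samplePath ρ u ω) := by
  filter_upwards [h.isTrajectory, ae_all_iff.2 fun i : ℚ × ℚ × ℚ => ae_all_iff.2 fun q : ℚ =>
    h.continuity_eq _ (isTestFunction_bumpTest i) (q : ℝ).toNNReal] with ω h1 h2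
  exact h1.isStripPath h2

/-- A limit in probability is an almost sure limit along a subsequence, so it must agree with a
pathwise limit whenever one exists. -/
lemma IsItoIntegral.ae_eq {B X : ℝ≥0 → Ω → ℝ} {t : ℝ≥0} {I : Ω → ℝ} (h : IsItoIntegral P B X t I)
    {J : Ω → ℝ} (hJ : ∀ᵐ ω ∂P, Tendsto (fun n : ℕ => ∑ i ∈ Finset.range n,
      X (t * i / n) ω * (B (t * (i + 1) / n) ω - B (t * i / n) ω)) atTop (𝓝 (J ω))) :
    I =ᵐ[P] J := by
  obtain ⟨ns, hns, hlim⟩ := h.exists_seq_tendsto_ae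
  filter_upwards [hlim, hJ] with ω h1 h2
  exact tendsto_nhds_unique h1 (h2.comp hns.tendsto_atTop)

lemma continuous_noise_clamp (hσ : IsNoiseCoefficient σ) (k : ℕ) :
    Continuous fun x => σ k (clamp x) :=
  ((hσ.memH2 k).1.acPair.continuousOn zero_le_one).comp_continuous continuous_clamp clamp_mem

lemma integral_samplePath_ρ (t : ℝ) (ω : Ω) (φ : ℝ → ℝ) (k : ℕ) :
    ∫ x in (0 : ℝ)..1, ρ t.toNNReal ω x * σ k x * φ x
      = ∫ x in (0 : ℝ)..1, (samplePath ρ u ω).ρ t x * (σ k (clamp x) * φ x) := by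
  refine intervalIntegral.integral_congr fun x hx => ?_
  rw [uIcc_of_le zero_le_one] at hx
  simp only [samplePath_ρ t ω hx, clamp_eq hx]
  ring

/-- The momentum equation holds at rational times with the pathwise limit of the noise. -/
lemma IsSolution.weakMomentum_rat (hW : IsStochasticBasis P F W) (hσ : IsNoiseCoefficient σ)
    (h : IsSolution P F W A σ ρ₀ u₀ ρ u) {K : ℕ → ℕ} (hK : StrictMono K) :
    ∀ᵐ ω ∂P, ∀ ξ, NoiseLimit (fun j t => partialNoise W (noiseVec hσ) (K j) t ω) ξ → ∀ T : ℕ,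
      ∀ q : ℚ, (q : ℝ) ∈ Icc (0 : ℝ) T →
        WeakMomentum A (samplePath ρ u ω) (fun t x => primitiveAt x (ξ t)) q := by
  have h01 := zero_le_one (α := ℝ)
  have hWc : ∀ᵐ ω ∂P, ∀ k, Continuous (fun t => W k t ω) ∧ W k 0 ω = 0 :=
    ae_all_iff.2 fun k => (hW.brownian k).cont.and (hW.brownian k).eval_zero_ae_eq_zero
  have key : ∀ q : ℚ, ∀ i : ℚ × ℚ × ℚ, ∃ ns : ℕ → ℕ, StrictMono ns ∧
      ∀ᵐ ω ∂P, Tendsto (fun j => ∑ k ∈ Finset.range (K (ns j)),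
        ((∫ x in (0 : ℝ)..1, ρ (q : ℝ).toNNReal ω x * σ k x * bumpTest i x) * W k (q : ℝ).toNNReal ω
          - ∫ s in (0 : ℝ)..(q : ℝ).toNNReal, W k s.toNNReal ω *
            -∫ x in (0 : ℝ)..1, massFlux (samplePath ρ u ω) s x * (σ k (clamp x) * bumpTest i x)))
        atTop (𝓝 ((∫ x in (0 : ℝ)..1, ρ (q : ℝ).toNNReal ω x * u (q : ℝ).toNNReal ω x * bumpTest i x)
          - (∫ x in (0 : ℝ)..1, ρ 0 ω x * u 0 ω x * bumpTest i x)
          - (∫ s in (0 : ℝ)..(q : ℝ).toNNReal, ∫ x in (0 : ℝ)..1,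
              (ρ s.toNNReal ω x * u s.toNNReal ω x ^ 2 + A ^ 2 * ρ s.toNNReal ω x)
                * deriv (bumpTest i) x)
          + (∫ s in (0 : ℝ)..(q : ℝ).toNNReal, ∫ x in (0 : ℝ)..1,
              deriv (u s.toNNReal ω) x * deriv (bumpTest i) x))) := by
    intro q i
    obtain ⟨J, hJ, hser⟩ := h.momentum_eq _ (isTestFunction_bumpTest i) (q : ℝ).toNNReal
    -- The series is restricted to the indices K along which the noise converges pathwise. The
    -- further subsequence may depend on q and i, since only countably many pairs occur.
    obtain ⟨ns, hns, hlim⟩ := (hser.comp hK.tendsto_atTop).exists_seq_tendsto_ae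
    refine ⟨ns, hns, ?_⟩
    -- The integrand pairs the density with a fixed function of x and is absolutely continuous in
    -- time by the continuity equation, so the Itô integral is computed path by path.
    have hJk : ∀ᵐ ω ∂P, ∀ k, J k ω =
        (∫ x in (0 : ℝ)..1, ρ (q : ℝ).toNNReal ω x * σ k x * bumpTest i x) * W k (q : ℝ).toNNReal ω
          - ∫ s in (0 : ℝ)..(q : ℝ).toNNReal, W k s.toNNReal ω *
            -∫ x in (0 : ℝ)..1, massFlux (samplePath ρ u ω) s x * (σ k (clamp x) * bumpTest i x) := by
      refine ae_all_iff.2 fun k => (hJ k).ae_eq ?_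
      filter_upwards [hWc, h.isStripPath] with ω h1 h2
      refine tendsto_leftSum (X := fun s => ∫ x in (0 : ℝ)..1, ρ s ω x * σ k x * bumpTest i x)
        (h1 k).1 (h1 k).2 ?_
      obtain ⟨T, hT⟩ := exists_nat_ge (((q : ℝ).toNNReal : ℝ≥0) : ℝ)
      have := ((h2 T).mono (NNReal.coe_nonneg _) hT).acPair_integral (NNReal.coe_nonneg _)
        ((continuous_noise_clamp hσ k).mul (continuous_bumpTest i))
      exact this.congr (NNReal.coe_nonneg _) (fun s _ => (integral_samplePath_ρ s ω _ k).symm)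
        (Eventually.of_forall fun _ => rfl)
    filter_upwards [hlim, hJk] with ω h1 h2
    refine h1.congr fun j => ?_
    exact Finset.sum_congr rfl fun k _ => h2 k
  choose ns hns hlim using key
  filter_upwards [ae_all_iff.2 fun q => ae_all_iff.2 fun i => hlim q i, hWc, h.isStripPath]
    with ω hlim hWc hp ξ hξ T q hq i
  have hT : (0 : ℝ) ≤ T := T.cast_nonneg
  set p := samplePath ρ u ω with hpdef
  have hq' : (((q : ℝ).toNNReal : ℝ≥0) : ℝ) = q := Real.coe_toNNReal _ hq.1
  have hS : ∀ j, Continuous fun t => partialNoise W (noiseVec hσ) (K j) t ω := fun j =>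
    continuous_finsetSum _ fun k _ => (hWc k).1.smul continuous_const
  refine hξ.weakMomentum_apply hS (hp T).toIsRegular hq (hξ.rat q) i (hns q i) ?_
  have hl := hlim q i
  simp only [hq', integral_samplePath_ρ (u := u) (q : ℝ) ω] at hl
  rw [← hpdef] at hl
  have e1 : ∫ x in (0 : ℝ)..1, ρ (q : ℝ).toNNReal ω x * u (q : ℝ).toNNReal ω x * bumpTest i x
      = ∫ x in (0 : ℝ)..1, p.ρ q x * p.u q x * bumpTest i x := by
    refine intervalIntegral.integral_congr fun x hx => ?_
    rw [uIcc_of_le h01] at hx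
    simp only [hpdef, samplePath_ρ _ _ hx, samplePath_u _ _ hx]
  have e2 : ∫ x in (0 : ℝ)..1, ρ 0 ω x * u 0 ω x * bumpTest i x
      = ∫ x in (0 : ℝ)..1, p.ρ 0 x * p.u 0 x * bumpTest i x := by
    refine intervalIntegral.integral_congr fun x hx => ?_
    rw [uIcc_of_le h01] at hx
    simp only [hpdef, samplePath_ρ _ _ hx, samplePath_u _ _ hx, Real.toNNReal_zero]
  have e3 : ∀ s, ∫ x in (0 : ℝ)..1, (ρ s.toNNReal ω x * u s.toNNReal ω x ^ 2
      + A ^ 2 * ρ s.toNNReal ω x) * deriv (bumpTest i) x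
      = ∫ x in (0 : ℝ)..1, (p.ρ s x * p.u s x ^ 2 + A ^ 2 * p.ρ s x) * deriv (bumpTest i) x := by
    intro s
    refine intervalIntegral.integral_congr fun x hx => ?_
    rw [uIcc_of_le h01] at hx
    simp only [hpdef, samplePath_ρ _ _ hx, samplePath_u _ _ hx]
  have e4 : ∀ s : ℝ, ∫ x in (0 : ℝ)..1, deriv (u s.toNNReal ω) x * deriv (bumpTest i) x
      = ∫ x in (0 : ℝ)..1, p.ux s x * deriv (bumpTest i) x := by
    intro s
    rw [intervalIntegral.integral_of_le h01, intervalIntegral.integral_of_le h01]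
    refine integral_congr_ae ?_
    filter_upwards [deriv_comp_clamp_ae (u s.toNNReal ω)] with x hx
    simp only [hpdef, samplePath, toPath, hx]
  simp only [e1, e2, e3, e4] at hl
  refine hl.congr fun j => ?_
  have hs := (hp T).sum_integral (w := fun k t => W k t ω) (κ := fun k x => σ k (clamp x))
    (fun k => (hWc k).1) (continuous_noise_clamp hσ) (continuous_bumpTest i) hq (K (ns q i j))
  refine hs.trans ?_
  have e5 : ∀ (f : ℝ → ℝ) (t : ℝ≥0), ∫ x in (0 : ℝ)..1,
      f x * (∑ k ∈ Finset.range (K (ns q i j)), W k t ω * σ k (clamp x)) * bumpTest i x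
      = ∫ x in (0 : ℝ)..1, f x * primitiveAt x (partialNoise W (noiseVec hσ) (K (ns q i j)) t ω)
        * bumpTest i x := by
    intro f t
    refine intervalIntegral.integral_congr fun x hx => ?_
    rw [uIcc_of_le h01] at hx
    simp only [primitiveAt_partialNoise W hσ _ t ω hx, clamp_eq hx]
  simp only [e5]

end

end CNSE

namespace CNSE

noncomputable section

/-! ### Continuous dependence -/

lemma nrm_le_sqrt {f : ℝ → ℝ} {c : ℝ} (h : ∫ x in (0 : ℝ)..1, f x ^ 2 ≤ c) : nrm f ≤ √c :=
  Real.sqrt_le_sqrt h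

lemma IsStripPath.exists_isBounded {T : ℝ} (hT : 0 ≤ T) {q : Path} (hq : IsStripPath T q)
    (h0 : ∀ x ∈ Icc (0 : ℝ) 1, 0 < q.ρ 0 x) : ∃ m C, IsBounded T m C q := by
  obtain ⟨m, hm, hle⟩ := hq.exists_pos_le hT h0
  obtain ⟨C, hC⟩ := hq.bound
  obtain ⟨C₁, -, hρ⟩ := exists_bound_strip hq.cont_ρ T
  obtain ⟨C₂, -, hu⟩ := exists_bound_strip hq.cont_u T
  exact ⟨m, max C (max C₁ C₂), hm, hle,
    fun t ht x hx => (le_abs_self _).trans ((hρ t ht x hx).trans (by simp)),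
    fun t ht x hx => (hu t ht x hx).trans (by simp), fun t ht => (hC t ht).1,
    fun t ht => (hC t ht).2.2.1.trans (by simp)⟩

/-- Convergence of paths driven by the same noise. -/
lemma IsStripPath.tendsto_nrm_sub {T : ℝ} (hT : 0 ≤ T) {q : Path} (hq : IsStripPath T q)
    (h0 : ∀ x ∈ Icc (0 : ℝ) 1, 0 < q.ρ 0 x) {A K : ℝ} {p : ℕ → Path}
    (hp : ∀ n, IsStripPath T (p n)) (hpos : ∀ n t x, 0 < (p n).ρ t x)
    (hN : ∀ n, SameNoise T A (p n) q) (hmass : ∀ n, ∫ x in (0 : ℝ)..1, (p n).ρ 0 x = 1)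
    (hK : ∀ n, ∀ x ∈ Icc (0 : ℝ) 1, |Real.log ((p n).ρ 0 x)| ≤ K)
    (hY : Tendsto (fun n => relEnergy (p n) q 0) atTop (𝓝 0)) {t : ℝ} (ht : t ∈ Icc 0 T) :
    Tendsto (fun n => nrm fun x => (p n).ρ t x - q.ρ t x) atTop (𝓝 0) ∧
      Tendsto (fun n => nrm fun x => (p n).u t x - q.u t x) atTop (𝓝 0) := by
  have h01 := zero_le_one (α := ℝ)
  obtain ⟨m, C, hb⟩ := hq.exists_isBounded hT h0
  obtain ⟨η, Λ, κ, hη, hκ, H⟩ := exists_stability_constants hT hq hb A K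
  have hev : ∀ᶠ n in atTop, relEnergy (p n) q t ≤ Λ * relEnergy (p n) q 0 ∧
      ∀ x ∈ Icc (0 : ℝ) 1, κ ≤ (p n).ρ t x := by
    filter_upwards [hY.eventually (Iio_mem_nhds hη)] with n hn
    exact H (p n) (hp n) (hpos n) (hN n) ((hp n).mass hT (hmass n)) (hK n) (mem_Iio.1 hn).le t ht
  have hlim : ∀ c : ℝ, Tendsto (fun n => √(c * (Λ * relEnergy (p n) q 0))) atTop (𝓝 0) := fun c => by
    simpa using ((hY.const_mul Λ).const_mul c).sqrt
  have hint : ∀ n, IntervalIntegrable (fun x => 1 / 2 * ((p n).ρ t x *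
      ((p n).u t x - q.u t x) ^ 2) + 1 / 2 * ((p n).ρ t x - q.ρ t x) ^ 2) volume 0 1 := fun n => by
    have c1 := (hp n).continuous_ρ t
    have c2 := (hp n).continuous_u t
    have c3 := hq.continuous_ρ t
    have c4 := hq.continuous_u t
    exact Continuous.intervalIntegrable (by fun_prop) _ _
  have hintρ : ∀ n, IntervalIntegrable (fun x => ((p n).ρ t x - q.ρ t x) ^ 2) volume 0 1 := fun n => by
    have c1 := (hp n).continuous_ρ t
    have c3 := hq.continuous_ρ t
    exact Continuous.intervalIntegrable (by fun_prop) _ _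
  have hintu : ∀ n, IntervalIntegrable (fun x => ((p n).u t x - q.u t x) ^ 2) volume 0 1 := fun n => by
    have c1 := (hp n).continuous_u t
    have c3 := hq.continuous_u t
    exact Continuous.intervalIntegrable (by fun_prop) _ _
  constructor
  · refine tendsto_of_tendsto_of_tendsto_of_le_of_le' tendsto_const_nhds (hlim 2)
      (Eventually.of_forall fun _ => nrm_nonneg _) ?_
    filter_upwards [hev] with n hn
    refine nrm_le_sqrt ?_
    have := intervalIntegral.integral_mono_on h01 ((hintρ n).const_mul (1 / 2)) (hint n)
      fun x _ => le_add_of_nonneg_left (by have := hpos n t x; positivity)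
    rw [intervalIntegral.integral_const_mul] at this
    have h2 : _ ≤ relEnergy (p n) q t := this
    linarith [hn.1]
  -- The relative energy weighs the velocity difference with the density of the approximating
  -- solution. The uniform lower bound κ removes this weight.
  · refine tendsto_of_tendsto_of_tendsto_of_le_of_le' tendsto_const_nhds (hlim (2 / κ))
      (Eventually.of_forall fun _ => nrm_nonneg _) ?_
    filter_upwards [hev] with n hn
    refine nrm_le_sqrt ?_
    have := intervalIntegral.integral_mono_on h01 ((hintu n).const_mul (κ / 2)) (hint n)
      fun x hx => le_add_of_le_of_nonneg (by
        rw [div_mul_eq_mul_div, one_div, inv_mul_eq_div]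
        gcongr
        exact hn.2 x hx) (by positivity)
    rw [intervalIntegral.integral_const_mul] at this
    have h2 : _ ≤ relEnergy (p n) q t := this
    rw [div_mul_eq_mul_div, le_div_iff₀ hκ]
    linarith [hn.1]

variable {Ω : Type*} {mΩ : MeasurableSpace Ω} {P : Measure Ω} {F : Filtration ℝ≥0 mΩ}
  {W : ℕ → ℝ≥0 → Ω → ℝ} {A : ℝ} {σ : ℕ → ℝ → ℝ} {ρ₀ u₀ : ℝ → ℝ} {ρ u : ℝ≥0 → Ω → ℝ → ℝ}

/-- The almost sure properties of the path of a solution. -/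
structure IsSolutionPath (A : ℝ) (ρ₀ u₀ : ℝ → ℝ) (p : Path)
    (S : ℕ → ℝ≥0 → Lp ℝ 2 unitVol) : Prop where
  strip : ∀ T : ℕ, IsStripPath T p
  initial : ∀ x ∈ Icc (0 : ℝ) 1, p.ρ 0 x = ρ₀ x ∧ p.u 0 x = u₀ x
  pos : ∀ t x, 0 < p.ρ t x
  velocity : ∀ ξ, NoiseLimit S ξ → ∀ T : ℕ, ∀ᵐ x ∂volume.restrict (Ioc (0 : ℝ) 1),
    ∃ V : ℝ → ℝ, ACPair T V (fun t => acc A p t x) ∧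
      ∀ q : ℚ, (q : ℝ) ∈ Icc (0 : ℝ) T → V q = p.u q x - primitiveAt x (ξ q)

lemma IsSolution.isSolutionPath (hW : IsStochasticBasis P F W) (hσ : IsNoiseCoefficient σ)
    (hX₀ : (ρ₀, u₀) ∈ PhaseSpace) (h : IsSolution P F W A σ ρ₀ u₀ ρ u) {K : ℕ → ℕ}
    (hK : StrictMono K) : ∀ᵐ ω ∂P, IsSolutionPath A ρ₀ u₀ (samplePath ρ u ω)
      fun j t => partialNoise W (noiseVec hσ) (K j) t ω := by
  filter_upwards [h.isStripPath, h.initial, h.weakMomentum_rat hW hσ hK,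
    ae_all_iff.2 fun k => (hW.brownian k).cont] with ω hp hi hw hc
  have h0 : ∀ x ∈ Icc (0 : ℝ) 1, (samplePath ρ u ω).ρ 0 x = ρ₀ x ∧ (samplePath ρ u ω).u 0 x = u₀ x :=
    fun x hx => by
      rw [samplePath_ρ _ _ hx, samplePath_u _ _ hx, Real.toNNReal_zero]
      exact hi x hx
  have hpos : ∀ t x, 0 < (samplePath ρ u ω).ρ t x := by
    intro t x
    obtain ⟨T, hT⟩ := exists_nat_ge (t.toNNReal : ℝ)
    obtain ⟨m, hm, hle⟩ := (hp T).exists_pos_le T.cast_nonneg fun x hx => by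
      rw [(h0 x hx).1]
      exact hX₀.2.2.2 x hx
    have := hle _ ⟨t.toNNReal.coe_nonneg, hT⟩ _ (clamp_mem x)
    rw [samplePath_ρ _ _ (clamp_mem x), Real.toNNReal_coe] at this
    exact hm.trans_le this
  have hS : ∀ j, Continuous fun t => partialNoise W (noiseVec hσ) (K j) t ω := fun j =>
    continuous_finsetSum _ fun k _ => (hc k).smul continuous_const
  refine ⟨hp, h0, hpos, fun ξ hξ T => ?_⟩
  exact exists_velocity_acPair (hp T) hpos (hξ.noiseIntegrable hS (hp T).toIsRegular)
    (hξ.aemeasurable hS T) (fun t => intervalIntegrable_primitiveAt (ξ t)) (hw ξ hξ T)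
    (hξ.weakMomentum_ae hS (hp T).toIsRegular (hw ξ hξ T))

lemma nrm_congr_Icc {f g : ℝ → ℝ} (h : ∀ x ∈ Icc (0 : ℝ) 1, f x = g x) : nrm f = nrm g :=
  nrm_congr (ae_Ioo_of_forall fun x hx => h x (Ioo_subset_Icc_self hx))

lemma tendsto_nrm_of_tendstoL2 {f : ℕ → ℝ → ℝ} {g : ℝ → ℝ} (hf : ∀ n, MemH1 (f n)) (hg : MemH1 g)
    (h : TendstoL2 atTop f g) : Tendsto (fun n => nrm fun x => f n x - g x) atTop (𝓝 0) :=
  (tendstoL2_iff fun n => ((hf n).acPair.sub zero_le_one hg.acPair).memL2).1 h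

/-- The relative energy of the initial data tends to zero. -/
lemma tendsto_relEnergy_zero {p : ℕ → Path} {q : Path} {K : ℝ} (hp : ∀ n, IsStripPath 0 (p n))
    (hq : IsStripPath 0 q) (hpos : ∀ n t x, 0 < (p n).ρ t x)
    (hK : ∀ n, ∀ x ∈ Icc (0 : ℝ) 1, |Real.log ((p n).ρ 0 x)| ≤ K)
    (hρ : Tendsto (fun n => nrm fun x => (p n).ρ 0 x - q.ρ 0 x) atTop (𝓝 0))
    (hu : Tendsto (fun n => nrm fun x => (p n).u 0 x - q.u 0 x) atTop (𝓝 0)) :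
    Tendsto (fun n => relEnergy (p n) q 0) atTop (𝓝 0) := by
  have h01 := zero_le_one (α := ℝ)
  have hlim : Tendsto (fun n => Real.exp K / 2 * nrm (fun x => (p n).u 0 x - q.u 0 x) ^ 2
      + 1 / 2 * nrm (fun x => (p n).ρ 0 x - q.ρ 0 x) ^ 2) atTop (𝓝 0) := by
    simpa only [zero_pow two_ne_zero, mul_zero, add_zero] using
      ((hu.pow 2).const_mul (Real.exp K / 2)).add ((hρ.pow 2).const_mul (1 / 2))
  refine tendsto_of_tendsto_of_tendsto_of_le_of_le tendsto_const_nhds hlim (fun n => ?_) fun n => ?_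
  · refine intervalIntegral.integral_nonneg h01 fun x _ => ?_
    have := hpos n 0 x
    positivity
  · have c1 := (hp n).continuous_ρ 0
    have c2 := (hp n).continuous_u 0
    have c3 := hq.continuous_ρ 0
    have c4 := hq.continuous_u 0
    dsimp only
    rw [nrm_sq, nrm_sq, ← intervalIntegral.integral_const_mul, ← intervalIntegral.integral_const_mul,
      ← intervalIntegral.integral_add (Continuous.intervalIntegrable (by fun_prop) _ _)
        (Continuous.intervalIntegrable (by fun_prop) _ _)]
    refine intervalIntegral.integral_mono_on h01 (Continuous.intervalIntegrable (by fun_prop) _ _)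
      (Continuous.intervalIntegrable (by fun_prop) _ _) fun x hx => ?_
    -- The uniform logarithmic bound on the initial densities bounds the weight in front of the
    -- velocity difference, so L² convergence of the data suffices.
    have hle : (p n).ρ 0 x ≤ Real.exp K := by
      rw [← Real.log_le_iff_le_exp (hpos n 0 x)]
      exact (le_abs_self _).trans (hK n x hx)
    have := mul_le_mul_of_nonneg_right hle (sq_nonneg ((p n).u 0 x - q.u 0 x))
    linarith

lemma MemH1.memL2_sub {f g : ℝ → ℝ} (hf : MemH1 f) (hg : MemH1 g) : MemL2 fun x => f x - g x :=
  (hf.acPair.sub zero_le_one hg.acPair).memL2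

end

end CNSE

theorem mainTheorem5 {Ω : Type*} {mΩ : MeasurableSpace Ω} (P : Measure Ω)
    (F : Filtration ℝ≥0 mΩ) (W : ℕ → ℝ≥0 → Ω → ℝ) (hW : CNSE.IsStochasticBasis P F W)
    (A : ℝ) (hA : 0 < A) (σ : ℕ → ℝ → ℝ) (hσ : CNSE.IsNoiseCoefficient σ)
    (ρ₀n u₀n : ℕ → ℝ → ℝ) (hX₀n : ∀ n, (ρ₀n n, u₀n n) ∈ CNSE.PhaseSpace)
    (ρn un : ℕ → ℝ≥0 → Ω → ℝ → ℝ)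
    (hsoln : ∀ n, CNSE.IsSolution P F W A σ (ρ₀n n) (u₀n n) (ρn n) (un n))
    (hE : BddAbove (Set.range fun n => CNSE.modifiedEnergy A (ρ₀n n) (u₀n n)))
    (ρ₀ u₀ : ℝ → ℝ) (hX₀ : (ρ₀, u₀) ∈ CNSE.PhaseSpace)
    (ρ u : ℝ≥0 → Ω → ℝ → ℝ) (hsol : CNSE.IsSolution P F W A σ ρ₀ u₀ ρ u)
    (hρ₀ : CNSE.TendstoL2 atTop ρ₀n ρ₀) (hu₀ : CNSE.TendstoL2 atTop u₀n u₀) :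
    ∀ᵐ ω ∂P, ∀ t : ℝ≥0,
      CNSE.TendstoL2 atTop (fun n => ρn n t ω) (ρ t ω) ∧
      CNSE.TendstoL2 atTop (fun n => un n t ω) (u t ω) := by
  -- The subsequence K depends only on the Brownian motions and on σ. The same noise path ξ
  -- therefore serves all the solutions, which is what makes it cancel.
  obtain ⟨K, hK, hξ⟩ := CNSE.exists_noiseLimit hW (CNSE.summable_norm_noiseVec hσ)
  obtain ⟨E, hE⟩ := hE
  have hlog : ∀ n, ∀ x ∈ Icc (0 : ℝ) 1, |Real.log (ρ₀n n x)| ≤ √(8 * E) := fun n x hx =>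
    (CNSE.abs_log_density_le (A := A) (hX₀n n) hx).trans
      (Real.sqrt_le_sqrt (mul_le_mul_of_nonneg_left (hE ⟨n, rfl⟩) (by norm_num)))
  filter_upwards [hξ, hsol.isSolutionPath hW hσ hX₀ hK,
    ae_all_iff.2 fun n => (hsoln n).isSolutionPath hW hσ (hX₀n n) hK,
    hsol.isTrajectory, ae_all_iff.2 fun n => (hsoln n).isTrajectory] with ω ⟨ξ, hξ⟩ hq hp hqt hpt t
  obtain ⟨T, hT⟩ := exists_nat_ge (t : ℝ)
  have hT0 : (0 : ℝ) ≤ T := T.cast_nonneg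
  set q := CNSE.samplePath ρ u ω with hqdef
  set p := fun n => CNSE.samplePath (ρn n) (un n) ω with hpdef
  have hlog' : ∀ n, ∀ x ∈ Icc (0 : ℝ) 1, |Real.log ((p n).ρ 0 x)| ≤ √(8 * E) := fun n x hx => by
    rw [((hp n).initial x hx).1]
    exact hlog n x hx
  have hmass : ∀ n, ∫ x in (0 : ℝ)..1, (p n).ρ 0 x = 1 := fun n => by
    refine Eq.trans (intervalIntegral.integral_congr fun x hx => ?_) (hX₀n n).2.2.1
    rw [uIcc_of_le zero_le_one] at hx
    exact ((hp n).initial x hx).1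
  have hY : Tendsto (fun n => CNSE.relEnergy (p n) q 0) atTop (𝓝 0) := by
    refine CNSE.tendsto_relEnergy_zero (fun n => by simpa using (hp n).strip 0)
      (by simpa using hq.strip 0) (fun n => (hp n).pos) hlog' ?_ ?_
    · refine (CNSE.tendsto_nrm_of_tendstoL2 (fun n => (hX₀n n).1) hX₀.1 hρ₀).congr fun n =>
        CNSE.nrm_congr_Icc fun x hx => ?_
      rw [((hp n).initial x hx).1, (hq.initial x hx).1]
    · refine (CNSE.tendsto_nrm_of_tendstoL2 (fun n => (hX₀n n).2.1.1) hX₀.2.1.1 hu₀).congr fun n =>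
        CNSE.nrm_congr_Icc fun x hx => ?_
      rw [((hp n).initial x hx).2, (hq.initial x hx).2]
  have key := CNSE.IsStripPath.tendsto_nrm_sub hT0 (hq.strip T) (fun x _ => hq.pos 0 x)
    (fun n => (hp n).strip T) (fun n => (hp n).pos) (A := A)
    (fun n => CNSE.sameNoise (ζ := fun t x => CNSE.primitiveAt x (ξ t)) ((hp n).strip T) (hq.strip T) (hp n).pos hq.pos
      ((hp n).velocity ξ hξ T) (hq.velocity ξ hξ T)) hmass hlog' hY ⟨t.coe_nonneg, hT⟩
  constructor
  · refine (CNSE.tendstoL2_iff fun n =>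
      ((hpt n).density_H1.1 t).memL2_sub (hqt.density_H1.1 t)).2 (key.1.congr fun n =>
        CNSE.nrm_congr_Icc fun x hx => ?_)
    simp only [hqdef, CNSE.samplePath_ρ _ _ hx, Real.toNNReal_coe]
  · refine (CNSE.tendstoL2_iff fun n =>
      ((hpt n).velocity_H1.1 t).1.memL2_sub (hqt.velocity_H1.1 t).1).2 (key.2.congr fun n =>
        CNSE.nrm_congr_Icc fun x hx => ?_)
    simp only [hqdef, CNSE.samplePath_u _ _ hx, Real.toNNReal_coe]
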